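/- Let $\mathbb{K}$ be a commutative ring and $X$ a topological space. A commutative DG $\mathbb{K}_X$-ring is a sheaf on $X$ of unital associative differential graded $\mathbb{K}$-algebras $\mathcal{B}=\bigoplus_{n\le 0}\mathcal{B}^n$ (each $\mathcal{B}^n$ being a sheaf of $\mathbb{K}$-modules), with a $\mathbb{K}$-linear differential of degree $+1$ satisfying the graded Leibniz rule, and strongly commutative: local sections $a\in\mathcal{B}^m$, $b\in\mathcal{B}^n$ satisfy $b\cdot a=(-1)^{mn}a\cdot b$, and $a\cdot a=0$ if $m$ is odd. Homomorphisms are the homomorphisms of sheaves that respect the whole structure. A homomorphism is a quasi-isomorphism if it induces isomorphisms on all the cohomology sheaves, where $\mathrm{H}^n(\mathcal{B})$ is the sheaf associated to the presheaf $U\mapsto \mathrm{H}^n(\Gamma(U,\mathcal{B}))$. Fix a commutative DG $\mathbb{K}_X$-ring $\mathcal{A}$, and let $\mathrm{DGR}/\mathcal{A}$ be the category of commutative DG $\mathbb{K}_X$-rings $\mathcal{B}$ equipped with a homomorphism $\mathcal{A}\to\mathcal{B}$, with the homomorphisms under $\mathcal{A}$ as morphisms. In it the tensor product $\mathcal{B}\otimes_{\mathcal{A}}\mathcal{B}$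 is the coproduct of $\mathcal{B}$ with itself; let $\mu:\mathcal{B}\otimes_{\mathcal{A}}\mathcal{B}\to\mathcal{B}$ be the multiplication homomorphism. Two morphisms $\phi_0,\phi_1:\mathcal{B}\to\mathcal{C}$ in $\mathrm{DGR}/\mathcal{A}$ are homotopic relative to $\mathcal{A}$ if there are an object $\mathcal{B}^+$ (a cylinder object) and morphisms $\eta:\mathcal{B}\otimes_{\mathcal{A}}\mathcal{B}\to\mathcal{B}^+$, $\epsilon:\mathcal{B}^+\to\mathcal{B}$, $\phi:\mathcal{B}^+\to\mathcal{C}$ in $\mathrm{DGR}/\mathcal{A}$ such that $\epsilon$ is a quasi-isomorphism, $\epsilon\circ\eta=\mu$ and $\phi\circ\eta=\phi_0\otimes\phi_1$. They are quasi-homotopic relative to $\mathcal{A}$ if there is a quasi-isomorphism $\psi:\tilde{\mathcal{B}}\to\mathcal{B}$ in $\mathrm{DGR}/\mathcal{A}$ such that $\phi_0\circ\psi$ and $\phi_1\circ\psi$ are homotopic relative to $\mathcal{A}$. Theorem. Relative quasi-homotopy is a congruence on $\mathrm{DGR}/\mathcal{A}$: it is an equivalence relation on every set $\mathrm{Hom}_{\mathrm{DGR}/\mathcal{A}}(\mathcal{B},\mathcal{C})$,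 and it is preserved by composition with morphisms on either side. Hence the homotopy category $\mathrm{K}(\mathrm{DGR}/\mathcal{A})$ exists as a quotient category: the canonical functor $\mathrm{P}:\mathrm{DGR}/\mathcal{A}\to\mathrm{K}(\mathrm{DGR}/\mathcal{A})$ to the quotient category modulo relative quasi-homotopy is bijective on objects and surjective on morphisms, and $\mathrm{P}(\phi_0)=\mathrm{P}(\phi_1)$ if and only if $\phi_0$ and $\phi_1$ are quasi-homotopic relative to $\mathcal{A}$. -/

import Mathlib

open CategoryTheory CategoryTheory.Limits TopologicalSpace Opposite

universe u

/-- A commutative DG `K`-ring: a nonpositively graded, strongly commutative differential graded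
unital associative `K`-algebra, with a differential of degree `+1`. -/
structure DGRing (K : Type u) [CommRing K] where
  /-- the underlying (ungraded) ring, the direct sum of its homogeneous components -/
  carrier : Type u
  [ring : Ring carrier]
  [algebra : Algebra K carrier]
  /-- the homogeneous component of cohomological degree `n` -/
  deg : ℤ → Submodule K carrier
  [graded : GradedAlgebra deg]
  deg_eq_bot : ∀ n : ℤ, 0 < n → deg n = ⊥
  mul_comm' : ∀ (m n : ℤ) (a b : carrier), a ∈ deg m → b ∈ deg n →
    b * a = (m * n).negOnePow • (a * b)
  mul_self' : ∀ (n : ℤ) (a : carrier), Odd n → a ∈ deg n → a * a = 0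
  /-- the differential -/
  d : carrier →ₗ[K] carrier
  d_mem : ∀ (n : ℤ) (a : carrier), a ∈ deg n → d a ∈ deg (n + 1)
  d_d : ∀ a : carrier, d (d a) = 0
  leibniz : ∀ (n : ℤ) (a b : carrier), a ∈ deg n →
    d (a * b) = d a * b + n.negOnePow • (a * d b)

namespace DGRing

variable {K : Type u} [CommRing K]

attribute [instance] DGRing.ring DGRing.algebra DGRing.graded

/-- Homomorphisms of commutative DG `K`-rings: `K`-algebra homomorphisms that respect the gradings
and commute with the differentials. -/
@[ext]
structure Hom (A B : DGRing K) where
  toAlgHom : A.carrier →ₐ[K] B.carrier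
  map_deg : ∀ (n : ℤ) (a : A.carrier), a ∈ A.deg n → toAlgHom a ∈ B.deg n
  map_d : ∀ a : A.carrier, toAlgHom (A.d a) = B.d (toAlgHom a)

instance : Category (DGRing K) where
  Hom A B := Hom A B
  id A := ⟨AlgHom.id K A.carrier, fun _ _ h => h, fun _ => rfl⟩
  comp f g := ⟨g.toAlgHom.comp f.toAlgHom, fun n a h => g.map_deg n _ (f.map_deg n a h),
    fun a => by simp [f.map_d, g.map_d]⟩

@[simp]
theorem id_toAlgHom (A : DGRing K) : Hom.toAlgHom (𝟙 A) = AlgHom.id K A.carrier := rfl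

@[simp]
theorem comp_toAlgHom {A B C : DGRing K} (f : A ⟶ B) (g : B ⟶ C) :
    Hom.toAlgHom (f ≫ g) = (Hom.toAlgHom g).comp (Hom.toAlgHom f) := rfl

/-- The differential as a map between homogeneous components, from degree `i` to degree `j`. -/
def dComponent (A : DGRing K) (i j : ℤ) (h : i + 1 = j) : A.deg i →ₗ[K] A.deg j :=
  A.d.restrict (fun a ha => h ▸ A.d_mem i a ha)

@[simp]
theorem coe_dComponent (A : DGRing K) (i j : ℤ) (h : i + 1 = j) (a : A.deg i) :
    (A.dComponent i j h a : A.carrier) = A.d a := rfl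

/-- The map induced by a homomorphism on the homogeneous components of degree `n`. -/
def Hom.component {A B : DGRing K} (f : Hom A B) (n : ℤ) : A.deg n →ₗ[K] B.deg n :=
  f.toAlgHom.toLinearMap.restrict (f.map_deg n)

@[simp]
theorem Hom.coe_component {A B : DGRing K} (f : Hom A B) (n : ℤ) (a : A.deg n) :
    (f.component n a : B.carrier) = f.toAlgHom a := rfl

open Classical in
/-- The underlying cochain complex of `K`-modules of a commutative DG `K`-ring. -/
noncomputable def complex (A : DGRing K) : CochainComplex (ModuleCat.{u} K) ℤ where
  X n := ModuleCat.of K (A.deg n)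
  d i j := if h : i + 1 = j then ModuleCat.ofHom (A.dComponent i j h) else 0
  shape i j h := dif_neg h
  d_comp_d' i j k hij hjk := by
    have hij' : i + 1 = j := hij
    have hjk' : j + 1 = k := hjk
    rw [dif_pos hij', dif_pos hjk']
    exact ModuleCat.hom_ext (LinearMap.ext fun a => Subtype.ext (A.d_d a.1))

/-- The functor that sends a commutative DG `K`-ring to its underlying complex of `K`-modules. -/
noncomputable def toComplex (K : Type u) [CommRing K] :
    DGRing K ⥤ CochainComplex (ModuleCat.{u} K) ℤ where
  obj A := A.complex
  map {A B} f :=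
    { f := fun n => ModuleCat.ofHom (Hom.component f n)
      comm' := by
        intro i j hij
        have hij' : i + 1 = j := hij
        simp only [complex, dif_pos hij']
        exact ModuleCat.hom_ext (LinearMap.ext fun a => Subtype.ext (Hom.map_d f a.1).symm) }
  map_id A := by
    ext n a
    rfl
  map_comp f g := by
    ext n a
    rfl

/-- The functor that sends a commutative DG `K`-ring to its component of degree `n`. -/
noncomputable def component (K : Type u) [CommRing K] (n : ℤ) : DGRing K ⥤ ModuleCat.{u} K :=
  toComplex K ⋙ HomologicalComplex.eval _ _ n

/-- The functor that sends a commutative DG `K`-ring to its cohomology in degree `n`. -/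
noncomputable def cohomology (K : Type u) [CommRing K] (n : ℤ) : DGRing K ⥤ ModuleCat.{u} K :=
  toComplex K ⋙ HomologicalComplex.homologyFunctor _ _ n

end DGRing

/-- A presheaf of commutative DG `K`-rings on `X` is a sheaf if each of its homogeneous components
is a sheaf of `K`-modules. -/
def DGRing.isSheaf (K : Type u) [CommRing K] (X : TopCat.{u}) :
    ObjectProperty (TopCat.Presheaf (DGRing K) X) :=
  fun F => ∀ n : ℤ, TopCat.Presheaf.IsSheaf (F ⋙ DGRing.component K n : TopCat.Presheaf _ X)

/-- The category of commutative DG `K_X`-rings on the topological space `X`, i.e. of sheaves of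
commutative DG `K`-rings on `X`. -/
abbrev DGSheaf (K : Type u) [CommRing K] (X : TopCat.{u}) : Type _ :=
  (DGRing.isSheaf K X).FullSubcategory

/-- The category of commutative DG `A`-rings: pairs of a commutative DG `K_X`-ring `B` and a
homomorphism `A ⟶ B`. -/
abbrev DGRingOver {K : Type u} [CommRing K] {X : TopCat.{u}} (A : DGSheaf K X) : Type _ :=
  Under A

section

variable {K : Type u} [CommRing K] {X : TopCat.{u}}

/-- The cohomology `Hⁿ(B)` of a sheaf of commutative DG rings: the sheaf associated to the presheaf
`U ↦ Hⁿ(Γ(U, B))`. -/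
noncomputable def DGSheaf.cohomology (K : Type u) [CommRing K] (X : TopCat.{u}) (n : ℤ) :
    DGSheaf K X ⥤ Sheaf (Opens.grothendieckTopology X) (ModuleCat.{u} K) :=
  (DGRing.isSheaf K X).ι ⋙ (Functor.whiskeringRight _ _ _).obj (DGRing.cohomology K n) ⋙
    presheafToSheaf (Opens.grothendieckTopology X) (ModuleCat.{u} K)

/-- A homomorphism of sheaves of commutative DG rings is a quasi-isomorphism if it induces an
isomorphism on the cohomology sheaves in all degrees. -/
def DGSheaf.IsQuasiIso {B C : DGSheaf K X} (f : B ⟶ C) : Prop :=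
  ∀ n : ℤ, IsIso ((DGSheaf.cohomology K X n).map f)

variable {A : DGSheaf K X}

/-- A homotopy between `φ₀` and `φ₁` relative to `A`: a factorization `B ⊗_A B ⟶ Bplus ⟶ B` of the
multiplication homomorphism, whose second map is a quasi-isomorphism, together with an extension
to the cylinder object `Bplus` of the homomorphism `φ₀ ⊗ φ₁ : B ⊗_A B ⟶ C`.
The tensor product `B ⊗_A B` is the coproduct of `B` with itself in the category of commutative
DG `A`-rings; its coprojections are `b ↦ b ⊗ 1` and `b ↦ 1 ⊗ b`. -/
structure RelHomotopy {B C : DGRingOver A} (φ₀ φ₁ : B ⟶ C) where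
  /-- the tensor product `B ⊗_A B` -/
  tensor : DGRingOver A
  ι₀ : B ⟶ tensor
  ι₁ : B ⟶ tensor
  isColimit : IsColimit (BinaryCofan.mk ι₀ ι₁)
  /-- the cylinder object -/
  Bplus : DGRingOver A
  η : tensor ⟶ Bplus
  ε : Bplus ⟶ B
  φ : Bplus ⟶ C
  quasiIso : DGSheaf.IsQuasiIso ε.right
  /-- `ε ∘ η` is the multiplication homomorphism `μ`, which is the identity on both factors -/
  η_ε : η ≫ ε = isColimit.desc (BinaryCofan.mk (𝟙 B) (𝟙 B))
  /-- `φ ∘ η` is `φ₀ ⊗ φ₁`, which is `φ₀` on the first and `φ₁` on the second factor -/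
  η_φ : η ≫ φ = isColimit.desc (BinaryCofan.mk φ₀ φ₁)

/-- `φ₀` and `φ₁` are homotopic relative to `A`. -/
def RelHomotopic {B C : DGRingOver A} (φ₀ φ₁ : B ⟶ C) : Prop :=
  Nonempty (RelHomotopy φ₀ φ₁)

/-- Relative quasi-homotopy: `φ₀` and `φ₁` become homotopic relative to `A` after precomposing with
some quasi-isomorphism of commutative DG `A`-rings. -/
def relQuasiHomotopy (A : DGSheaf K X) : HomRel (DGRingOver A) :=
  fun B _ φ₀ φ₁ => ∃ (B' : DGRingOver A) (ψ : B' ⟶ B),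
    DGSheaf.IsQuasiIso ψ.right ∧ RelHomotopic (ψ ≫ φ₀) (ψ ≫ φ₁)

/-- The homotopy category of commutative DG `A`-rings: the quotient of the category of commutative
DG `A`-rings by relative quasi-homotopy. -/
abbrev DGHomotopyCategory (A : DGSheaf K X) : Type _ :=
  CategoryTheory.Quotient (relQuasiHomotopy A)

/-- The canonical functor to the homotopy category. -/
abbrev toDGHomotopyCategory (A : DGSheaf K X) : DGRingOver A ⥤ DGHomotopyCategory A :=
  CategoryTheory.Quotient.functor (relQuasiHomotopy A)

end

/-!
Relative quasi-homotopy is treated as the homotopy relation of a category with weak equivalences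
`W`, the quasi-isomorphisms, and trivial fibrations `F`, the quasi-isomorphisms that are surjective
on homogeneous sections over every open set. No model structure is needed. What is used
(`IsTrivialFibrationStructure`) is that

* `W` has the two-out-of-three property, and a weak equivalence with a section is in `F`;
* `F` is stable under composition and base change;
* every morphism factors as an h-cofibration followed by a trivial fibration, where an
  *h-cofibration* is a morphism `i` that has pushouts along all morphisms, such that the cobase
  change of a weak equivalence along `i` is a weak equivalence.

A cylinder `Z ⟶ B` has sections, so it is a trivial fibration, and homotopies can be pulled back
along any morphism to the source (`leftHomotopic_precomp`). Hence quasi-homotopy is compatible with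
composition, and two quasi-homotopies can be brought to the same source. There, one end of the
first cylinder is replaced by an h-cofibration and the second cylinder is glued to it; this
costs another trivial fibration (`exists_leftHomotopic_trans`). By a similar gluing, a
quasi-isomorphism `ψ` in a quasi-homotopy can be replaced by a trivial fibration
(`quasiHomotopic_of_W`). The same structure exists on objects under `A`, and factoring `A ⟶ B`
through an h-cofibration gives sources that have a tensor product with themselves
(`exists_coproduct_under`), as relative homotopies require. These facts are combined in
`DGSheaf.relQuasiHomotopy_iff`.

The structure itself is built on presheaves. Quasi-isomorphisms are characterized by a local lifting
condition on sections, the acyclicity of the mapping cone (`presheafQuasiIso_iff`). The generating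
h-cofibrations adjoin freely, over an open set `U`, a generator `gen` of degree `n ≤ 0` with given
differential `c`: over `V ⊆ U` the sections are `Q(V)[gen]`, polynomials if `n` is even and
`Q(V) ⊕ Q(V) gen` if `n` is odd, and over other `V` nothing changes. Comparing leading coefficients
in `gen` shows that this preserves quasi-isomorphisms (`presheafQuasiIso_attachMap`). Compositions
and directed colimits of h-cofibrations are h-cofibrations, so a countable sequence of steps, each
of which attaches a cell for every lifting problem, factors any morphism as an h-cofibration
followed by one that lifts against all cells, and such a morphism is a surjective quasi-isomorphism
(`exists_factorization`). The associated sheaf functor, which is constructed by germs, carries these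
factorizations and pushouts over to sheaves (`hCofibrations_toOfPresheaf`). Free generators, directed
colimits, associated sheaves and fibre products are all defined by families of homogeneous
subspaces of an auxiliary algebra (`GradedModel`), because the underlying ring of a commutative DG
ring is the direct sum of its components, which neither infinite products nor the sheaf condition
respect.
-/

/-! ### Commutative DG rings from graded subspaces of an algebra -/

namespace DGRing

variable {K : Type u} [CommRing K]

open DirectSum

/-- Additive data for a commutative DG ring inside a `K`-algebra `R`: submodules `D n` of `R`
closed under multiplication, and linear maps `d n` that restrict to `D n → D (n + 1)`. The sum of
the `D n` need not be direct in `R`, and `d n` is constrained on `D n` only, so that signs that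
depend on the degree can be built into it. -/
structure GradedModel (K : Type u) [CommRing K] (R : Type u) [Ring R] [Algebra K R] where
  D : ℤ → Submodule K R
  one_mem : (1 : R) ∈ D 0
  mul_mem : ∀ {m n : ℤ} {a b : R}, a ∈ D m → b ∈ D n → a * b ∈ D (m + n)
  eq_zero : ∀ {n : ℤ} {a : R}, 0 < n → a ∈ D n → a = 0
  mul_comm' : ∀ {m n : ℤ} {a b : R}, a ∈ D m → b ∈ D n → b * a = (m * n).negOnePow • (a * b)
  mul_self' : ∀ {n : ℤ} {a : R}, Odd n → a ∈ D n → a * a = 0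
  d : ℤ → R →ₗ[K] R
  d_mem : ∀ {n : ℤ} {a : R}, a ∈ D n → d n a ∈ D (n + 1)
  d_d : ∀ {n : ℤ} {a : R}, a ∈ D n → d (n + 1) (d n a) = 0
  leibniz : ∀ {m n : ℤ} {a b : R}, a ∈ D m → b ∈ D n →
    d (m + n) (a * b) = d m a * b + m.negOnePow • (a * d n b)

namespace GradedModel

variable {R : Type u} [Ring R] [Algebra K R] (M : GradedModel K R)

instance : SetLike.GradedMonoid M.D where
  one_mem := M.one_mem
  mul_mem _ _ _ _ := M.mul_mem

/-- The homogeneous element of `⨁ n, D n` given by an element of `D n`. -/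
noncomputable def elt (n : ℤ) : M.D n →ₗ[K] ⨁ n, M.D n := lof K ℤ (fun n => M.D n) n

theorem elt_mul {m n k : ℤ} (h : m + n = k) (a : M.D m) (b : M.D n) :
    M.elt m a * M.elt n b = M.elt k ⟨a * b, h ▸ M.mul_mem a.2 b.2⟩ := by
  subst h
  exact of_mul_of (A := fun n => M.D n) a b

theorem elt_one : M.elt 0 ⟨1, M.one_mem⟩ = 1 := rfl

noncomputable instance : GradedAlgebra (fun n => LinearMap.range (M.elt n)) where
  one_mem := ⟨_, M.elt_one⟩
  mul_mem := by
    rintro m n _ _ ⟨a, rfl⟩ ⟨b, rfl⟩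
    exact ⟨_, (M.elt_mul rfl a b).symm⟩
  decompose' := DirectSum.lmap (fun n => (M.elt n).rangeRestrict)
  left_inv x := by
    induction x using DirectSum.induction_on with
    | zero => simp
    | of n a =>
      have := DirectSum.lmap_lof (R := K) (fun n => (M.elt n).rangeRestrict) (i := n) a
      erw [this]
      erw [DirectSum.coeAddMonoidHom_of]
      rfl
    | add x y hx hy => simp only [map_add, hx, hy]
  right_inv x := by
    induction x using DirectSum.induction_on with
    | zero => simp
    | of n a =>
      obtain ⟨_, a, rfl⟩ := a
      erw [DirectSum.coeAddMonoidHom_of]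
      exact DirectSum.lmap_lof (R := K) (fun n => (M.elt n).rangeRestrict) (i := n) a
    | add x y hx hy => simp only [map_add, hx, hy]

/-- The differential of the commutative DG ring defined by a graded model. -/
noncomputable def diff : (⨁ n, M.D n) →ₗ[K] ⨁ n, M.D n :=
  toModule K ℤ _ fun n => (M.elt (n + 1)).comp ((M.d n).restrict fun _ => M.d_mem)

theorem diff_elt {n k : ℤ} (h : n + 1 = k) (a : M.D n) :
    M.diff (M.elt n a) = M.elt k ⟨M.d n a, h ▸ M.d_mem a.2⟩ := by
  subst h
  exact toModule_lof K (M := fun n => M.D n) n a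

theorem elt_congr {m n : ℤ} (h : m = n) {a b : R} (ha : a ∈ M.D m) (hb : b ∈ M.D n) (hab : a = b) :
    M.elt m ⟨a, ha⟩ = M.elt n ⟨b, hb⟩ := by
  subst h hab
  rfl

theorem units_smul_elt (s : ℤˣ) (n : ℤ) (a : M.D n) : s • M.elt n a = M.elt n (s • a) := by
  rcases Int.units_eq_one_or s with rfl | rfl
  · rw [one_smul, one_smul]
  · refine (neg_one_zsmul (M.elt n a)).trans ?_
    rw [Units.neg_smul, one_smul]
    exact (map_neg (M.elt n) a).symm

/-- The commutative DG ring `⨁ n, D n` defined by a graded model. -/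
noncomputable def toDGRing : DGRing K where
  carrier := ⨁ n, M.D n
  deg n := LinearMap.range (M.elt n)
  deg_eq_bot n hn := by
    rw [LinearMap.range_eq_bot]
    ext a
    have : a = 0 := Subtype.ext (M.eq_zero hn a.2)
    simp [this]
  mul_comm' := by
    rintro m n _ _ ⟨a, rfl⟩ ⟨b, rfl⟩
    rw [M.elt_mul (add_comm n m), M.elt_mul rfl, units_smul_elt]
    exact M.elt_congr rfl _ _ (M.mul_comm' a.2 b.2)
  mul_self' := by
    rintro n _ hn ⟨a, rfl⟩
    rw [M.elt_mul rfl]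
    have : (⟨a * a, M.mul_mem a.2 a.2⟩ : M.D (n + n)) = 0 := Subtype.ext (M.mul_self' hn a.2)
    simp [this]
  d := M.diff
  d_mem := by
    rintro n _ ⟨a, rfl⟩
    exact ⟨_, (M.diff_elt rfl a).symm⟩
  d_d x := by
    induction x using DirectSum.induction_on with
    | zero => simp
    | of n a =>
      erw [M.diff_elt rfl a, M.diff_elt rfl]
      rw [show (⟨_, _⟩ : M.D (n + 1 + 1)) = 0 from Subtype.ext (M.d_d a.2), map_zero]
    | add x y hx hy => simp only [map_add, hx, hy, add_zero]
  leibniz := by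
    rintro m _ y ⟨a, rfl⟩
    induction y using DirectSum.induction_on with
    | zero => simp
    | of n b =>
      change M.diff (M.elt m a * M.elt n b) = M.diff (M.elt m a) * M.elt n b +
        m.negOnePow • (M.elt m a * M.diff (M.elt n b))
      rw [M.elt_mul rfl, M.diff_elt rfl, M.diff_elt rfl, M.diff_elt rfl,
        M.elt_mul (by ring : m + 1 + n = m + n + 1), M.elt_mul (by ring : m + (n + 1) = m + n + 1),
        units_smul_elt, ← map_add]
      exact M.elt_congr rfl _ _ (M.leibniz a.2 b.2)
    | add x y hx hy =>
      rw [mul_add, map_add, hx, hy, mul_add, map_add, mul_add, smul_add]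
      abel

/-- The evaluation `⨁ n, D n → R`. It identifies the component of degree `n` with `D n`. -/
noncomputable def val : M.toDGRing.carrier →ₐ[K] R := DirectSum.coeAlgHom M.D

@[simp]
theorem val_elt (n : ℤ) (a : M.D n) : M.val (M.elt n a) = a :=
  DirectSum.coeAlgHom_of M.D n a

/-- The homogeneous element given by an element of `D n`, as an element of the DG ring. -/
noncomputable def homog (n : ℤ) : M.D n →ₗ[K] M.toDGRing.carrier := M.elt n

theorem val_homog (n : ℤ) (a : M.D n) : M.val (M.homog n a) = a := M.val_elt n a

theorem elt_mem (n : ℤ) (a : M.D n) : (M.elt n a : M.toDGRing.carrier) ∈ M.toDGRing.deg n :=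
  ⟨a, rfl⟩

theorem val_mem {n : ℤ} {x : M.toDGRing.carrier} (hx : x ∈ M.toDGRing.deg n) : M.val x ∈ M.D n := by
  obtain ⟨a, rfl⟩ := hx
  rw [val_elt]
  exact a.2

theorem val_inj {n : ℤ} {x y : M.toDGRing.carrier} (hx : x ∈ M.toDGRing.deg n)
    (hy : y ∈ M.toDGRing.deg n) (h : M.val x = M.val y) : x = y := by
  obtain ⟨a, rfl⟩ := hx
  obtain ⟨b, rfl⟩ := hy
  rw [val_elt, val_elt] at h
  rw [Subtype.ext h]

theorem val_d {n : ℤ} {x : M.toDGRing.carrier} (hx : x ∈ M.toDGRing.deg n) :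
    M.val (M.toDGRing.d x) = M.d n (M.val x) := by
  obtain ⟨a, rfl⟩ := hx
  rw [val_elt]
  erw [M.diff_elt rfl]
  rw [val_elt]

end GradedModel

variable {A B : DGRing K}

/-- A homomorphism of commutative DG rings is determined by its homogeneous components. -/
theorem hom_ext_deg {f g : A ⟶ B}
    (h : ∀ (n : ℤ) (a : A.carrier), a ∈ A.deg n → Hom.toAlgHom f a = Hom.toAlgHom g a) : f = g := by
  apply Hom.ext
  ext a
  induction a using DirectSum.Decomposition.inductionOn A.deg with
  | zero => simp
  | homogeneous a => exact h _ _ a.2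
  | add a b ha hb => rw [map_add, map_add, ha, hb]

/-- A homomorphism of commutative DG rings from its homogeneous components. -/
noncomputable def Hom.ofDeg (f : ∀ n : ℤ, A.deg n →ₗ[K] B.carrier) (mem : ∀ n a, f n a ∈ B.deg n)
    (one : f 0 ⟨1, SetLike.GradedOne.one_mem⟩ = 1)
    (mul : ∀ m n (a : A.deg m) (b : A.deg n),
      f (m + n) ⟨a * b, SetLike.GradedMul.mul_mem a.2 b.2⟩ = f m a * f n b)
    (hd : ∀ n (a : A.deg n), f (n + 1) ⟨A.d a, A.d_mem n _ a.2⟩ = B.d (f n a)) : A ⟶ B :=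
  let F : A.carrier →ₗ[K] B.carrier :=
    (DirectSum.toModule K ℤ _ f).comp (DirectSum.decomposeLinearEquiv A.deg).toLinearMap
  have hF : ∀ n (a : A.deg n), F a = f n a := fun n a => by
    change DirectSum.toModule K ℤ _ f (DirectSum.decompose A.deg (a : A.carrier)) = _
    rw [DirectSum.decompose_coe]
    exact toModule_lof K (M := fun n => A.deg n) n a
  have hF' : ∀ n (a : A.carrier) (ha : a ∈ A.deg n), F a = f n ⟨a, ha⟩ := fun n a ha => hF n ⟨a, ha⟩
  { toAlgHom := AlgHom.ofLinearMap F ((hF' 0 1 _).trans one) (by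
      intro a b
      induction a using DirectSum.Decomposition.inductionOn A.deg with
      | zero => simp
      | @homogeneous m a =>
        induction b using DirectSum.Decomposition.inductionOn A.deg with
        | zero => simp
        | @homogeneous n b =>
          rw [hF, hF, hF' (m + n) _ (SetLike.GradedMul.mul_mem a.2 b.2), mul]
        | add b c hb hc => rw [mul_add, map_add, hb, hc, map_add, mul_add]
      | add a c ha hc => rw [add_mul, map_add, ha, hc, map_add, add_mul])
    map_deg := fun n a ha => by
      rw [AlgHom.ofLinearMap_apply, hF' n a ha]
      exact mem _ _
    map_d := fun a => by
      rw [AlgHom.ofLinearMap_apply, AlgHom.ofLinearMap_apply]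
      induction a using DirectSum.Decomposition.inductionOn A.deg with
      | zero => simp
      | @homogeneous m a => rw [hF, hF' (m + 1) _ (A.d_mem m _ a.2), hd]
      | add a b ha hb => simp only [map_add, ha, hb] }

theorem Hom.ofDeg_apply (f : ∀ n : ℤ, A.deg n →ₗ[K] B.carrier) (mem one mul hd)
    {n : ℤ} {a : A.carrier} (ha : a ∈ A.deg n) :
    Hom.toAlgHom (Hom.ofDeg f mem one mul hd) a = f n ⟨a, ha⟩ := by
  change DirectSum.toModule K ℤ _ f (DirectSum.decompose A.deg a) = _
  rw [DirectSum.decompose_of_mem A.deg ha]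
  exact toModule_lof K (M := fun n => A.deg n) n _

end DGRing

/-! ### Directed colimits of commutative DG rings -/

namespace DGRing

variable {K : Type u} [CommRing K]

theorem one_mem_deg (A : DGRing K) : (1 : A.carrier) ∈ A.deg 0 := SetLike.GradedOne.one_mem

theorem mul_mem_deg (A : DGRing K) {m n : ℤ} {a b : A.carrier} (ha : a ∈ A.deg m)
    (hb : b ∈ A.deg n) : a * b ∈ A.deg (m + n) := SetLike.GradedMul.mul_mem ha hb

theorem units_smul_mem_deg (A : DGRing K) (s : ℤˣ) {n : ℤ} {a : A.carrier} (ha : a ∈ A.deg n) :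
    s • a ∈ A.deg n := by
  rcases Int.units_eq_one_or s with rfl | rfl
  · rwa [one_smul]
  · rw [Units.neg_smul, one_smul]
    exact neg_mem ha

theorem eq_zero_of_pos (A : DGRing K) {n : ℤ} (hn : 0 < n) {a : A.carrier} (ha : a ∈ A.deg n) :
    a = 0 := by
  rw [A.deg_eq_bot n hn] at ha
  exact ha

namespace GradedModel

variable {R : Type u} [Ring R] [Algebra K R] (M : GradedModel K R)

/-- A homomorphism into the DG ring of a graded model, from its values in the ambient algebra. -/
noncomputable def lift {A : DGRing K} (f : ℤ → A.carrier →ₗ[K] R)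
    (mem : ∀ n a, a ∈ A.deg n → f n a ∈ M.D n) (one : f 0 1 = 1)
    (mul : ∀ m n a b, a ∈ A.deg m → b ∈ A.deg n → f (m + n) (a * b) = f m a * f n b)
    (hd : ∀ n a, a ∈ A.deg n → f (n + 1) (A.d a) = M.d n (f n a)) : A ⟶ M.toDGRing :=
  Hom.ofDeg (B := M.toDGRing)
    (fun n => (M.homog n).comp ((f n).restrict (p := A.deg n) (q := M.D n) (mem n)))
    (fun n _ => M.elt_mem n _) (M.elt_congr rfl _ M.one_mem one)
    (fun m n a b => (M.elt_congr rfl _ _ (mul m n _ _ a.2 b.2)).trans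
      (M.elt_mul rfl ⟨f m a, mem m a a.2⟩ ⟨f n b, mem n b b.2⟩).symm)
    (fun n a => (M.elt_congr rfl _ (M.d_mem (mem n a a.2)) (hd n a a.2)).trans
      (M.diff_elt rfl ⟨f n a, mem n a a.2⟩).symm)

theorem val_lift {A : DGRing K} (f : ℤ → A.carrier →ₗ[K] R) (mem one mul hd) {n : ℤ}
    {a : A.carrier} (ha : a ∈ A.deg n) :
    M.val (Hom.toAlgHom (M.lift f mem one mul hd) a) = f n a := by
  exact (congrArg M.val (Hom.ofDeg_apply _ _ _ _ _ ha)).trans (M.val_homog _ _)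

/-- A homomorphism out of the DG ring of a graded model, from its values on the ambient algebra. -/
noncomputable def desc {B : DGRing K} (g : ℤ → R →ₗ[K] B.carrier)
    (mem : ∀ n a, a ∈ M.D n → g n a ∈ B.deg n) (one : g 0 1 = 1)
    (mul : ∀ m n a b, a ∈ M.D m → b ∈ M.D n → g (m + n) (a * b) = g m a * g n b)
    (hd : ∀ n a, a ∈ M.D n → g (n + 1) (M.d n a) = B.d (g n a)) : M.toDGRing ⟶ B :=
  Hom.ofDeg (fun n => ((g n).comp M.val.toLinearMap).comp (M.toDGRing.deg n).subtype)
    (fun n a => mem n _ (M.val_mem a.2))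
    (by simpa using! one)
    (fun m n a b => by
      simpa using! mul m n _ _ (M.val_mem a.2) (M.val_mem b.2))
    (fun n a => by
      have := hd n _ (M.val_mem a.2)
      rw [← M.val_d a.2] at this
      exact this)

theorem desc_apply {B : DGRing K} (g : ℤ → R →ₗ[K] B.carrier) (mem one mul hd) {n : ℤ}
    {x : M.toDGRing.carrier} (hx : x ∈ M.toDGRing.deg n) :
    Hom.toAlgHom (M.desc g mem one mul hd) x = g n (M.val x) :=
  Hom.ofDeg_apply _ _ _ _ _ hx

theorem exists_val_eq {n : ℤ} {a : R} (ha : a ∈ M.D n) :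
    ∃ x ∈ M.toDGRing.deg n, M.val x = a :=
  ⟨_, M.elt_mem n ⟨a, ha⟩, M.val_elt _ _⟩

end GradedModel

section DirectedColimit

universe w

variable {J : Type w} [Preorder J] (F : J ⥤ DGRing.{u} K)

/-- The transition maps of a directed system of commutative DG rings. -/
abbrev transition (i j : J) (h : i ≤ j) : (F.obj i).carrier →ₐ[K] (F.obj j).carrier :=
  Hom.toAlgHom (F.map (homOfLE h))

instance : DirectedSystem (fun i => (F.obj i).carrier) (transition F · · ·) where
  map_self i x := by
    change Hom.toAlgHom (F.map (𝟙 i)) x = x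
    rw [F.map_id]
    rfl
  map_map k j i hij hjk x := by
    change Hom.toAlgHom (F.map (homOfLE hjk)) (Hom.toAlgHom (F.map (homOfLE hij)) x) =
      Hom.toAlgHom (F.map (homOfLE (hij.trans hjk))) x
    rw [← homOfLE_comp hij hjk, F.map_comp]
    rfl

end DirectedColimit

section DirectedColimit

variable {J : Type u} [Preorder J] [IsDirectedOrder J] [Nonempty J] (F : J ⥤ DGRing.{u} K)

/-- The direct limit of the underlying algebras of a directed system of commutative DG rings. -/
abbrev LimAlg : Type u := DirectLimit (fun i => (F.obj i).carrier) (transition F)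

/-- The canonical maps to the direct limit of algebras. -/
def toLimAlg (i : J) : (F.obj i).carrier →ₐ[K] LimAlg F where
  toFun a := ⟦⟨i, a⟩⟧
  map_one' := (DirectLimit.one_def (f := transition F) i).symm
  map_mul' a b := (DirectLimit.mul_def (f := transition F) i a b).symm
  map_zero' := (DirectLimit.zero_def (f := transition F) i).symm
  map_add' a b := (DirectLimit.add_def (f := transition F) i a b).symm
  commutes' r := (DirectLimit.map₀_algebraMap (f := transition F) i r).symm

theorem toLimAlg_transition {i j : J} (h : i ≤ j) (a : (F.obj i).carrier) :
    toLimAlg F j (transition F i j h a) = toLimAlg F i a := 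
  DirectLimit.mk_apply (f := transition F) _ _ _ h

theorem toLimAlg_eq_iff {i : J} {a b : (F.obj i).carrier} :
    toLimAlg F i a = toLimAlg F i b ↔ ∃ j, ∃ h : i ≤ j,
      transition F i j h a = transition F i j h b := by
  constructor
  · intro h
    obtain ⟨j, h1, _, h2⟩ := Quotient.exact h
    exact ⟨j, h1, h2⟩
  · rintro ⟨j, h, e⟩
    rw [← toLimAlg_transition F h, e, toLimAlg_transition]

/-- The differential of the direct limit. -/
def limD : LimAlg F →ₗ[K] LimAlg F where
  toFun := DirectLimit.map (transition F) (transition F) (fun i => (F.obj i).d)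
    (fun i j h x => (Hom.map_d (F.map (homOfLE h)) x))
  map_add' := DirectLimit.induction₂ _ fun i x y => by
    change _ = toLimAlg F i ((F.obj i).d x) + toLimAlg F i ((F.obj i).d y)
    rw [← map_add, ← map_add, DirectLimit.add_def]
    rfl
  map_smul' r := DirectLimit.induction _ fun i x => by
    change _ = r • toLimAlg F i ((F.obj i).d x)
    rw [← map_smul, ← map_smul, DirectLimit.smul_def]
    rfl

theorem limD_toLimAlg (i : J) (a : (F.obj i).carrier) :
    limD F (toLimAlg F i a) = toLimAlg F i ((F.obj i).d a) := rfl

/-- The component of degree `n` of the direct limit. -/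
def limDeg (n : ℤ) : Submodule K (LimAlg F) where
  carrier := {x | ∃ i, ∃ a ∈ (F.obj i).deg n, toLimAlg F i a = x}
  zero_mem' := ⟨Classical.arbitrary J, 0, zero_mem _, map_zero _⟩
  add_mem' := by
    rintro _ _ ⟨i, a, ha, rfl⟩ ⟨j, b, hb, rfl⟩
    obtain ⟨k, hi, hj⟩ := exists_ge_ge i j
    refine ⟨k, transition F i k hi a + transition F j k hj b,
      add_mem (Hom.map_deg _ _ _ ha) (Hom.map_deg _ _ _ hb), ?_⟩
    rw [map_add, toLimAlg_transition, toLimAlg_transition]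
  smul_mem' := by
    rintro r _ ⟨i, a, ha, rfl⟩
    exact ⟨i, r • a, Submodule.smul_mem _ _ ha, map_smul _ _ _⟩

theorem limDeg_pair {m n : ℤ} {x y : LimAlg F} (hx : x ∈ limDeg F m) (hy : y ∈ limDeg F n) :
    ∃ i, ∃ a ∈ (F.obj i).deg m, ∃ b ∈ (F.obj i).deg n, toLimAlg F i a = x ∧ toLimAlg F i b = y := by
  obtain ⟨i, a, ha, rfl⟩ := hx
  obtain ⟨j, b, hb, rfl⟩ := hy
  obtain ⟨k, hi, hj⟩ := exists_ge_ge i j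
  exact ⟨k, transition F i k hi a, Hom.map_deg _ _ _ ha, transition F j k hj b,
    Hom.map_deg _ _ _ hb, toLimAlg_transition F hi a, toLimAlg_transition F hj b⟩

theorem map_units_smul {R S : Type*} [Ring R] [Ring S] [Algebra K R] [Algebra K S] (f : R →ₗ[K] S)
    (s : ℤˣ) (a : R) : f (s • a) = s • f a := by
  rcases Int.units_eq_one_or s with rfl | rfl <;> simp

/-- The graded model of the colimit of a directed system inside the direct limit of algebras. -/
def limModel : GradedModel K (LimAlg F) where
  D := limDeg F
  one_mem := ⟨Classical.arbitrary J, 1, one_mem_deg _, map_one _⟩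
  mul_mem hx hy := by
    obtain ⟨i, a, ha, b, hb, rfl, rfl⟩ := limDeg_pair F hx hy
    exact ⟨i, a * b, mul_mem_deg _ ha hb, map_mul _ _ _⟩
  eq_zero hn := by
    rintro ⟨i, a, ha, rfl⟩
    rw [eq_zero_of_pos _ hn ha, map_zero]
  mul_comm' hx hy := by
    obtain ⟨i, a, ha, b, hb, rfl, rfl⟩ := limDeg_pair F hx hy
    rw [← map_mul, ← map_mul, (F.obj i).mul_comm' _ _ a b ha hb]
    exact map_units_smul (toLimAlg F i).toLinearMap _ _
  mul_self' hn := by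
    rintro ⟨i, a, ha, rfl⟩
    rw [← map_mul, (F.obj i).mul_self' _ a hn ha, map_zero]
  d _ := limD F
  d_mem := by
    rintro n _ ⟨i, a, ha, rfl⟩
    exact ⟨i, _, (F.obj i).d_mem n a ha, rfl⟩
  d_d := by
    rintro n _ ⟨i, a, ha, rfl⟩
    rw [limD_toLimAlg, limD_toLimAlg, (F.obj i).d_d, map_zero]
  leibniz hx hy := by
    obtain ⟨i, a, ha, b, hb, rfl, rfl⟩ := limDeg_pair F hx hy
    have h : ∀ (s : ℤˣ) (c : (F.obj i).carrier), toLimAlg F i (s • c) = s • toLimAlg F i c :=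
      map_units_smul (toLimAlg F i).toLinearMap
    rw [← map_mul, limD_toLimAlg, (F.obj i).leibniz _ a b ha, map_add, map_mul, limD_toLimAlg,
      limD_toLimAlg, h, map_mul]

/-- The canonical homomorphisms to the colimit of a directed system. -/
noncomputable def toLim (i : J) : F.obj i ⟶ (limModel F).toDGRing :=
  (limModel F).lift (fun _ => (toLimAlg F i).toLinearMap) (fun _ a ha => ⟨i, a, ha, rfl⟩)
    (map_one (toLimAlg F i)) (fun _ _ a b _ _ => map_mul (toLimAlg F i) a b)
    (fun _ _ _ => rfl)

theorem val_toLim (i : J) {n : ℤ} {a : (F.obj i).carrier} (ha : a ∈ (F.obj i).deg n) :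
    (limModel F).val (Hom.toAlgHom (toLim F i) a) = toLimAlg F i a :=
  (limModel F).val_lift _ _ _ _ _ ha

/-- The cocone on a directed system given by its direct limit. -/
noncomputable def limCocone : Cocone F where
  pt := (limModel F).toDGRing
  ι :=
    { app := toLim F
      naturality := fun i j f => by
        apply hom_ext_deg
        intro n a ha
        have h1 := Hom.map_deg (F.map f) n a ha
        have h2 := Hom.map_deg (toLim F j) n _ h1
        refine (limModel F).val_inj (n := n) h2 (Hom.map_deg (toLim F i) n _ ha) ?_
        exact (val_toLim F j h1).trans ((toLimAlg_transition F (leOfHom f) a).trans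
          (val_toLim F i ha).symm) }

/-- The map out of the direct limit of algebras induced by a cocone. -/
def limAlgDesc (c : Cocone F) : LimAlg F →ₗ[K] c.pt.carrier where
  toFun := DirectLimit.lift _ (fun i => Hom.toAlgHom (c.ι.app i))
    (fun i j h x => by
      rw [← c.w (homOfLE h)]
      rfl)
  map_add' := DirectLimit.induction₂ _ fun i x y => by
    rw [DirectLimit.add_def]
    exact map_add (Hom.toAlgHom (c.ι.app i)) x y
  map_smul' r := DirectLimit.induction _ fun i x => by
    rw [DirectLimit.smul_def]
    exact map_smul (Hom.toAlgHom (c.ι.app i)) r x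

/-- The homomorphism out of the direct limit induced by a cocone. -/
noncomputable def limDesc (c : Cocone F) : (limModel F).toDGRing ⟶ c.pt :=
  (limModel F).desc (fun _ => limAlgDesc F c)
    (by
      rintro n _ ⟨i, a, ha, rfl⟩
      exact Hom.map_deg (c.ι.app i) n a ha)
    (map_one (Hom.toAlgHom (c.ι.app (Classical.arbitrary J))))
    (by
      intro m n x y hx hy
      obtain ⟨i, a, ha, b, hb, rfl, rfl⟩ := limDeg_pair F hx hy
      rw [← map_mul]
      exact map_mul (Hom.toAlgHom (c.ι.app i)) a b)
    (by
      rintro n _ ⟨i, a, ha, rfl⟩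
      exact Hom.map_d (c.ι.app i) a)

theorem limDesc_apply (c : Cocone F) {n : ℤ} {x : (limModel F).toDGRing.carrier}
    (hx : x ∈ (limModel F).toDGRing.deg n) :
    Hom.toAlgHom (limDesc F c) x = limAlgDesc F c ((limModel F).val x) :=
  (limModel F).desc_apply _ _ _ _ _ hx

theorem limDesc_toLim (c : Cocone F) (i : J) {n : ℤ} {a : (F.obj i).carrier}
    (ha : a ∈ (F.obj i).deg n) :
    Hom.toAlgHom (limDesc F c) (Hom.toAlgHom (toLim F i) a) = Hom.toAlgHom (c.ι.app i) a := by
  rw [limDesc_apply F c (Hom.map_deg (toLim F i) n a ha), val_toLim F i ha]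
  rfl

/-- Directed colimits exist in the category of commutative DG rings. -/
noncomputable def isColimitLimCocone : IsColimit (limCocone F) where
  desc c := limDesc F c
  fac c i := hom_ext_deg fun n a ha => limDesc_toLim F c i ha
  uniq c m hm := by
    apply hom_ext_deg
    intro n x hx
    obtain ⟨i, a, ha, h⟩ := (limModel F).val_mem hx
    have hx' : x = Hom.toAlgHom (toLim F i) a :=
      (limModel F).val_inj hx (Hom.map_deg (toLim F i) n a ha)
        (h.symm.trans (val_toLim F i ha).symm)
    rw [hx']
    refine Eq.trans ?_ (limDesc_toLim F c i ha).symm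
    rw [← hm i]
    rfl

instance : HasColimit F := ⟨⟨⟨limCocone F, isColimitLimCocone F⟩⟩⟩

instance : HasColimitsOfShape J (DGRing.{u} K) where

variable {F}

/-- Every homogeneous element of a directed colimit comes from some stage. -/
theorem exists_of_isColimit {c : Cocone F} (hc : IsColimit c) {n : ℤ} {x : c.pt.carrier}
    (hx : x ∈ c.pt.deg n) :
    ∃ i, ∃ a ∈ (F.obj i).deg n, Hom.toAlgHom (c.ι.app i) a = x := by
  let e := hc.coconePointUniqueUpToIso (isColimitLimCocone F)
  obtain ⟨i, a, ha, h⟩ := (limModel F).val_mem (Hom.map_deg e.hom n x hx)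
  refine ⟨i, a, ha, ?_⟩
  have h1 : Hom.toAlgHom e.hom x = Hom.toAlgHom (toLim F i) a :=
    (limModel F).val_inj (Hom.map_deg e.hom n x hx) (Hom.map_deg (toLim F i) n a ha)
      (h.symm.trans (val_toLim F i ha).symm)
  have h2 : toLim F i ≫ e.inv = c.ι.app i :=
    hc.comp_coconePointUniqueUpToIso_inv (isColimitLimCocone F) i
  have h3 : Hom.toAlgHom (e.hom ≫ e.inv) x = x := by
    rw [e.hom_inv_id]
    rfl
  rw [← h2, ← h3]
  exact congrArg (Hom.toAlgHom e.inv) h1.symm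

/-- Two homogeneous elements of some stage that agree in a directed colimit agree at a later
stage. -/
theorem eq_of_isColimit {c : Cocone F} (hc : IsColimit c) {i : J} {n : ℤ}
    {a b : (F.obj i).carrier} (ha : a ∈ (F.obj i).deg n) (hb : b ∈ (F.obj i).deg n)
    (h : Hom.toAlgHom (c.ι.app i) a = Hom.toAlgHom (c.ι.app i) b) :
    ∃ j, ∃ hij : i ≤ j, Hom.toAlgHom (F.map (homOfLE hij)) a =
      Hom.toAlgHom (F.map (homOfLE hij)) b := by
  rw [← toLimAlg_eq_iff F, ← val_toLim F i ha, ← val_toLim F i hb]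
  let e := hc.coconePointUniqueUpToIso (isColimitLimCocone F)
  have h2 : c.ι.app i ≫ e.hom = toLim F i :=
    hc.comp_coconePointUniqueUpToIso_hom (isColimitLimCocone F) i
  rw [← h2]
  exact congrArg (fun x => (limModel F).val (Hom.toAlgHom e.hom x)) h

end DirectedColimit

end DGRing

/-! ### Presheaves and quasi-isomorphisms -/

namespace DGRing

variable {K : Type u} [CommRing K]

section Homology

theorem complex_d (A : DGRing K) {i j : ℤ} (h : i + 1 = j) :
    A.complex.d i j = ModuleCat.ofHom (A.dComponent i j h) := dif_pos h

/-- The submodule of cocycles of degree `n`. -/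
def cocycles (A : DGRing K) (n : ℤ) : Submodule K (A.deg n) :=
  LinearMap.ker (A.dComponent n (n + 1) rfl)

theorem mem_cocycles {A : DGRing K} {n : ℤ} {a : A.deg n} : a ∈ A.cocycles n ↔ A.d a = 0 := by
  rw [cocycles, LinearMap.mem_ker, Subtype.ext_iff]
  rfl

/-- A cocycle as an element of the cycles of the underlying complex. -/
noncomputable def toCycles (A : DGRing K) (n : ℤ) :
    ModuleCat.of K (A.cocycles n) ⟶ A.complex.cycles n :=
  A.complex.liftCycles (ModuleCat.ofHom (A.cocycles n).subtype) (n + 1) (by simp) (by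
    rw [complex_d A rfl]
    exact ModuleCat.hom_ext (LinearMap.ext fun a => LinearMap.mem_ker.mp a.2))

theorem iCycles_toCycles (A : DGRing K) (n : ℤ) (a : A.cocycles n) :
    A.complex.iCycles n (A.toCycles n a) = (a : A.deg n) := by
  have h : A.toCycles n ≫ A.complex.iCycles n = ModuleCat.ofHom (A.cocycles n).subtype :=
    A.complex.liftCycles_i _ _ _ _
  exact congrArg (fun f => f.hom a) h

theorem iCycles_injective (A : DGRing K) (n : ℤ) : Function.Injective (A.complex.iCycles n) :=
  (ModuleCat.mono_iff_injective (A.complex.iCycles n)).mp inferInstance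

/-- The cohomology class of a cocycle. -/
noncomputable def cocycleClass (A : DGRing K) (n : ℤ) :
    ModuleCat.of K (A.cocycles n) ⟶ (cohomology K n).obj A :=
  A.toCycles n ≫ A.complex.homologyπ n

theorem cocycleClass_surjective (A : DGRing K) (n : ℤ) :
    Function.Surjective (A.cocycleClass n) := by
  intro h
  obtain ⟨z, rfl⟩ := (ModuleCat.epi_iff_surjective (A.complex.homologyπ n)).mp inferInstance h
  let y : A.deg n := A.complex.iCycles n z
  have hz : y ∈ A.cocycles n := by
    rw [cocycles, LinearMap.mem_ker]
    have := congrArg (fun f => f z) (A.complex.iCycles_d n (n + 1))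
    rw [complex_d A rfl] at this
    exact this
  refine ⟨(⟨y, hz⟩ : A.cocycles n), congrArg (A.complex.homologyπ n) ?_⟩
  exact A.iCycles_injective n (A.iCycles_toCycles n ⟨y, hz⟩)

theorem cocycleClass_eq_zero_iff (A : DGRing K) {m n : ℤ} (h : m + 1 = n) (a : A.cocycles n) :
    A.cocycleClass n a = 0 ↔ ∃ c ∈ A.deg m, A.d c = (a : A.carrier) := by
  have hprev : (ComplexShape.up ℤ).prev n = m := by
    subst h
    simp
  have hex := ShortComplex.exact_of_g_is_cokernel
    (ShortComplex.mk (A.complex.toCycles m n) (A.complex.homologyπ n)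
    (A.complex.toCycles_comp_homologyπ m n)) (A.complex.homologyIsCokernel m n hprev)
  rw [ShortComplex.moduleCat_exact_iff] at hex
  have h1 : ∀ c : A.deg m,
      A.complex.iCycles n (A.complex.toCycles m n c) = A.dComponent m n h c := by
    intro c
    have := congrArg (fun f => f c) (A.complex.toCycles_i m n)
    rw [complex_d A h] at this
    exact this
  have h2 := A.iCycles_toCycles n a
  constructor
  · intro ha
    obtain ⟨c, hc⟩ := hex (A.toCycles n a) ha
    have hc' : A.complex.toCycles m n c = A.toCycles n a := hc
    have := (h1 c).symm.trans ((congrArg _ hc').trans h2)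
    exact ⟨(c : A.deg m).1, (c : A.deg m).2, congrArg Subtype.val this⟩
  · rintro ⟨c, hc, e⟩
    have : A.complex.toCycles m n (⟨c, hc⟩ : A.deg m) = A.toCycles n a :=
      A.iCycles_injective n ((h1 _).trans (Eq.trans (Subtype.ext e) h2.symm))
    have h3 := congrArg (fun f => f (⟨c, hc⟩ : A.deg m)) (A.complex.toCycles_comp_homologyπ m n)
    change A.complex.homologyπ n (A.toCycles n a) = 0
    rw [← this]
    exact h3

theorem component_mem_cocycles {A B : DGRing K} (f : A ⟶ B) {n : ℤ} (a : A.cocycles n) :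
    Hom.component f n a ∈ B.cocycles n := by
  rw [mem_cocycles, Hom.coe_component, ← Hom.map_d, mem_cocycles.mp a.2, map_zero]

theorem map_cocycleClass {A B : DGRing K} (f : A ⟶ B) {n : ℤ} (a : A.cocycles n) :
    (cohomology K n).map f (A.cocycleClass n a) =
      B.cocycleClass n ⟨_, component_mem_cocycles f a⟩ := by
  have h1 : A.complex.homologyπ n ≫ (cohomology K n).map f =
      HomologicalComplex.cyclesMap ((toComplex K).map f) n ≫ B.complex.homologyπ n :=
    HomologicalComplex.homologyπ_naturality _ _
  change (A.complex.homologyπ n ≫ (cohomology K n).map f) _ = _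
  rw [h1]
  refine congrArg (B.complex.homologyπ n) (B.iCycles_injective n ?_)
  refine Eq.trans ?_ (B.iCycles_toCycles n _).symm
  have h4 := HomologicalComplex.cyclesMap_i ((toComplex K).map f) n
  refine (congrArg (fun g => g (A.toCycles n a)) h4).trans ?_
  exact congrArg (((toComplex K).map f).f n) (A.iCycles_toCycles n a)

end Homology

variable {X : TopCat.{u}}

section Presheaf

variable (E : TopCat.Presheaf (DGRing.{u} K) X) {E' E'' : TopCat.Presheaf (DGRing.{u} K) X}

/-- The sections over an open set. -/
abbrev sec (U : Opens X) : DGRing K := E.obj (op U)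

/-- The restriction of sections to a smaller open set. -/
def res {U V : Opens X} (h : V ≤ U) : (sec E U).carrier →ₐ[K] (sec E V).carrier :=
  Hom.toAlgHom (E.map (homOfLE h).op)

theorem res_mem {U V : Opens X} (h : V ≤ U) {n : ℤ} {a : (sec E U).carrier}
    (ha : a ∈ (sec E U).deg n) : res E h a ∈ (sec E V).deg n := Hom.map_deg _ _ _ ha

theorem res_d {U V : Opens X} (h : V ≤ U) (a : (sec E U).carrier) :
    res E h ((sec E U).d a) = (sec E V).d (res E h a) := Hom.map_d _ _

@[simp]
theorem res_self {U : Opens X} (h : U ≤ U) (a : (sec E U).carrier) : res E h a = a := by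
  change Hom.toAlgHom (E.map (𝟙 _)) a = a
  rw [E.map_id]
  rfl

@[simp]
theorem res_res {U V W : Opens X} (h : V ≤ U) (h' : W ≤ V) (a : (sec E U).carrier) :
    res E h' (res E h a) = res E (h'.trans h) a := by
  have : (homOfLE (h'.trans h)).op = (homOfLE h).op ≫ (homOfLE h').op := rfl
  rw [res, res, res, this, E.map_comp]
  rfl

variable {E}

/-- The map on sections induced by a morphism of presheaves. -/
def ap (f : E ⟶ E') (U : Opens X) : (sec E U).carrier →ₐ[K] (sec E' U).carrier :=
  Hom.toAlgHom (f.app (op U))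

theorem ap_mem (f : E ⟶ E') {U : Opens X} {n : ℤ} {a : (sec E U).carrier}
    (ha : a ∈ (sec E U).deg n) : ap f U a ∈ (sec E' U).deg n := Hom.map_deg _ _ _ ha

theorem ap_d (f : E ⟶ E') {U : Opens X} (a : (sec E U).carrier) :
    ap f U ((sec E U).d a) = (sec E' U).d (ap f U a) := Hom.map_d _ _

theorem ap_res (f : E ⟶ E') {U V : Opens X} (h : V ≤ U) (a : (sec E U).carrier) :
    ap f V (res E h a) = res E' h (ap f U a) :=
  congrArg (fun g => Hom.toAlgHom g a) (f.naturality (homOfLE h).op)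

@[simp]
theorem ap_comp (f : E ⟶ E') (g : E' ⟶ E'') {U : Opens X} (a : (sec E U).carrier) :
    ap (f ≫ g) U a = ap g U (ap f U a) := rfl

@[simp]
theorem ap_id {U : Opens X} (a : (sec E U).carrier) : ap (𝟙 E) U a = a := rfl

theorem presheaf_hom_ext {f g : E ⟶ E'}
    (h : ∀ (U : Opens X) (n : ℤ), ∀ a ∈ (sec E U).deg n, ap f U a = ap g U a) : f = g := by
  apply NatTrans.ext
  funext U
  exact hom_ext_deg (h U.unop)

/-- A morphism of presheaves of commutative DG rings is a quasi-isomorphism if it induces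
isomorphisms on the sheaves associated to the cohomology presheaves. -/
def PresheafQuasiIso (f : E ⟶ E') : Prop :=
  ∀ n : ℤ, IsIso ((presheafToSheaf (Opens.grothendieckTopology X) (ModuleCat.{u} K)).map
    (Functor.whiskerRight f (DGRing.cohomology K n)))

/-- The mapping cone of `f` is locally acyclic: a cocycle `(e, e')` of the cone is locally the
coboundary of some `(a, a')`. -/
def LocallyConeAcyclic (f : E ⟶ E') : Prop :=
  ∀ ⦃U : Opens X⦄ ⦃l m n : ℤ⦄, l + 1 = m → m + 1 = n →
    ∀ e ∈ (sec E U).deg n, ∀ e' ∈ (sec E' U).deg m, (sec E U).d e = 0 →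
      ap f U e = (sec E' U).d e' → ∀ x ∈ U, ∃ (V : Opens X) (h : V ≤ U), x ∈ V ∧
        ∃ a ∈ (sec E V).deg m, ∃ a' ∈ (sec E' V).deg l, (sec E V).d a = res E h e ∧
          ap f V a - res E' h e' = (sec E' V).d a'

theorem presheaf_map_cocycleClass {U V : Opens X} (h : V ≤ U) {n : ℤ} (a : (sec E U).cocycles n) :
    (E ⋙ cohomology K n).map (homOfLE h).op ((sec E U).cocycleClass n a) =
      (sec E V).cocycleClass n ⟨_, component_mem_cocycles (E.map (homOfLE h).op) a⟩ :=
  map_cocycleClass _ _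

theorem whisker_cocycleClass (f : E ⟶ E') {U : Opens X} {n : ℤ} (a : (sec E U).cocycles n) :
    (Functor.whiskerRight f (cohomology K n)).app (op U) ((sec E U).cocycleClass n a) =
      (sec E' U).cocycleClass n ⟨_, component_mem_cocycles (f.app (op U)) a⟩ :=
  map_cocycleClass _ _

/-- Quasi-isomorphisms can be tested on sections: this is the long exact cohomology sequence of the
mapping cone, for the sheaves of cohomology. -/
theorem presheafQuasiIso_iff (f : E ⟶ E') : PresheafQuasiIso f ↔ LocallyConeAcyclic f := by
  have key : PresheafQuasiIso f ↔ ∀ n : ℤ,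
      Presheaf.IsLocallyInjective (Opens.grothendieckTopology X)
        (Functor.whiskerRight f (cohomology K n)) ∧
      Presheaf.IsLocallySurjective (Opens.grothendieckTopology X)
        (Functor.whiskerRight f (cohomology K n)) := by
    refine forall_congr' fun n => ?_
    rw [← GrothendieckTopology.W_iff, GrothendieckTopology.W_iff_isLocallyBijective]
  rw [key]
  constructor
  · intro H U l m n hlm hmn e he e' he' hde hfe x hx
    -- the class of `e` dies in `E'`, hence locally in `E`
    obtain ⟨H1, -⟩ := H n
    obtain ⟨-, H2⟩ := H m
    let ec : (sec E U).cocycles n := ⟨⟨e, he⟩, mem_cocycles.mpr hde⟩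
    have h0 : (Functor.whiskerRight f (cohomology K n)).app (op U) ((sec E U).cocycleClass n ec) =
        (Functor.whiskerRight f (cohomology K n)).app (op U) 0 := by
      rw [whisker_cocycleClass, map_zero, cocycleClass_eq_zero_iff _ hmn]
      exact ⟨e', he', hfe.symm⟩
    obtain ⟨V, i, hi, hxV⟩ := Presheaf.equalizerSieve_mem (Opens.grothendieckTopology X)
      _ _ _ h0 x hx
    have hVU : V ≤ U := leOfHom i
    have hi' : (E ⋙ cohomology K n).map (homOfLE hVU).op ((sec E U).cocycleClass n ec) =
      (E ⋙ cohomology K n).map (homOfLE hVU).op 0 := hi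
    rw [presheaf_map_cocycleClass, map_zero, cocycleClass_eq_zero_iff _ hmn] at hi'
    obtain ⟨a, ha, hda⟩ := hi'
    have hda' : (sec E V).d a = res E hVU e := hda
    -- correct the primitive by a cocycle
    let w : (sec E' V).carrier := ap f V a - res E' hVU e'
    have hw : w ∈ (sec E' V).deg m := sub_mem (ap_mem f ha) (res_mem E' hVU he')
    have hdw : (sec E' V).d w = 0 := by
      rw [map_sub, ← ap_d, hda', ← res_d, ← hfe, ap_res, sub_self]
    let wc : (sec E' V).cocycles m := ⟨⟨w, hw⟩, mem_cocycles.mpr hdw⟩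
    obtain ⟨W, j, ⟨t, ht⟩, hxW⟩ := Presheaf.imageSieve_mem (Opens.grothendieckTopology X)
      (Functor.whiskerRight f (cohomology K m)) (U := op V) ((sec E' V).cocycleClass m wc) x hxV
    have hWV : W ≤ V := leOfHom j
    obtain ⟨z, rfl⟩ := (sec E W).cocycleClass_surjective m t
    have ht' : (Functor.whiskerRight f (cohomology K m)).app (op W) ((sec E W).cocycleClass m z) =
      (E' ⋙ cohomology K m).map (homOfLE hWV).op ((sec E' V).cocycleClass m wc) := ht
    rw [presheaf_map_cocycleClass, whisker_cocycleClass, ← sub_eq_zero, ← map_sub,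
      cocycleClass_eq_zero_iff _ hlm] at ht'
    obtain ⟨c, hc, hdc⟩ := ht'
    have hdc' : (sec E' W).d c = ap f W z - res E' hWV w := hdc
    refine ⟨W, hWV.trans hVU, hxW, res E hWV a - z, sub_mem (res_mem E hWV ha) z.1.2, -c,
      neg_mem hc, ?_, ?_⟩
    · rw [map_sub, ← res_d, hda', res_res, mem_cocycles.mp z.2, sub_zero]
    · rw [map_neg, hdc', map_sub, map_sub, ap_res, res_res]
      abel
  · intro H n
    constructor
    -- apply the acyclicity to `(a - b, c)` for injectivity, and to `(0, b)` for surjectivity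
    · constructor
      intro U s t hst x hx
      obtain ⟨a, rfl⟩ := (E.obj U).cocycleClass_surjective n s
      obtain ⟨b, rfl⟩ := (E.obj U).cocycleClass_surjective n t
      rw [← sub_eq_zero, ← map_sub, ← map_sub] at hst
      have h0 := (whisker_cocycleClass (U := U.unop) f (a - b)).symm.trans hst
      rw [cocycleClass_eq_zero_iff _ (sub_add_cancel n 1)] at h0
      obtain ⟨c, hc, hdc⟩ := h0
      obtain ⟨V, hVU, hxV, a', ha', -, -, hda', -⟩ := H
        (sub_add_cancel (n - 1) 1) (sub_add_cancel n 1) _ (a - b).1.2 c hc (mem_cocycles.mp (a - b).2) hdc.symm x hx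
      refine ⟨V, homOfLE hVU, ?_, hxV⟩
      change (E ⋙ cohomology K n).map (homOfLE hVU).op ((sec E U.unop).cocycleClass n a) =
        (E ⋙ cohomology K n).map (homOfLE hVU).op ((sec E U.unop).cocycleClass n b)
      rw [← sub_eq_zero, ← map_sub, ← map_sub, presheaf_map_cocycleClass,
        cocycleClass_eq_zero_iff _ (sub_add_cancel n 1)]
      exact ⟨a', ha', hda'⟩
    · constructor
      intro U s x hx
      obtain ⟨b, rfl⟩ := (sec E' U).cocycleClass_surjective n s
      obtain ⟨V, hVU, hxV, a, ha, a', ha', hda, hda'⟩ := H (sub_add_cancel n 1) rfl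
        (0 : (sec E U).carrier) (zero_mem _) b.1 b.1.2 (map_zero _)
        (by rw [map_zero, mem_cocycles.mp b.2]) x hx
      rw [map_zero] at hda
      refine ⟨V, homOfLE hVU, ⟨(sec E V).cocycleClass n ⟨⟨a, ha⟩, mem_cocycles.mpr hda⟩, ?_⟩, hxV⟩
      refine (whisker_cocycleClass f _).trans ?_
      refine Eq.trans ?_ (presheaf_map_cocycleClass hVU b).symm
      rw [← sub_eq_zero, ← map_sub, cocycleClass_eq_zero_iff _ (sub_add_cancel n 1)]
      exact ⟨a', ha', hda'.symm⟩

theorem PresheafQuasiIso.comp {f : E ⟶ E'} {g : E' ⟶ E''} (hf : PresheafQuasiIso f)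
    (hg : PresheafQuasiIso g) : PresheafQuasiIso (f ≫ g) := by
  intro n
  have := hf n
  have := hg n
  rw [Functor.whiskerRight_comp, Functor.map_comp]
  infer_instance

theorem PresheafQuasiIso.of_comp_left {f : E ⟶ E'} {g : E' ⟶ E''} (hf : PresheafQuasiIso f)
    (hfg : PresheafQuasiIso (f ≫ g)) : PresheafQuasiIso g := by
  intro n
  have := hf n
  have := hfg n
  rw [Functor.whiskerRight_comp, Functor.map_comp] at this
  exact IsIso.of_isIso_comp_left ((presheafToSheaf _ _).map (Functor.whiskerRight f _)) _

theorem PresheafQuasiIso.of_comp_right {f : E ⟶ E'} {g : E' ⟶ E''} (hg : PresheafQuasiIso g)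
    (hfg : PresheafQuasiIso (f ≫ g)) : PresheafQuasiIso f := by
  intro n
  have := hg n
  have := hfg n
  rw [Functor.whiskerRight_comp, Functor.map_comp] at this
  exact IsIso.of_isIso_comp_right _ ((presheafToSheaf _ _).map (Functor.whiskerRight g _))

theorem presheafQuasiIso_of_isIso (f : E ⟶ E') [IsIso f] : PresheafQuasiIso f := by
  intro n
  infer_instance

end Presheaf

end DGRing

/-! ### The associated sheaf -/

namespace DGRing

variable {K : Type u} [CommRing K] {X : TopCat.{u}}

/-- The sheaf condition for a presheaf of commutative DG rings, in terms of homogeneous sections: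
sections are determined locally, and compatible families of sections, indexed by the points of an
open set, can be glued. -/
structure HasGluing (F : TopCat.Presheaf (DGRing.{u} K) X) : Prop where
  sep : ∀ {U : Opens X} {n : ℤ} {a b : (sec F U).carrier}, a ∈ (sec F U).deg n →
    b ∈ (sec F U).deg n →
    (∀ x ∈ U, ∃ (V : Opens X) (h : V ≤ U), x ∈ V ∧ res F h a = res F h b) → a = b
  glue : ∀ {U : Opens X} {n : ℤ} (V : U → Opens X) (hV : ∀ x, V x ≤ U) (_ : ∀ x : U, x.1 ∈ V x)
    (s : ∀ x, (sec F (V x)).carrier) (_ : ∀ x, s x ∈ (sec F (V x)).deg n)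
    (_ : ∀ x y, res F (inf_le_left : V x ⊓ V y ≤ V x) (s x) =
      res F (inf_le_right : V x ⊓ V y ≤ V y) (s y)),
    ∃ t ∈ (sec F U).deg n, ∀ x, res F (hV x) t = s x

/-- The sheaf condition on every homogeneous component. Gluing for open covers indexed by the points
is enough, since a member of a cover can be chosen at every point. -/
theorem isSheaf_iff_hasGluing (F : TopCat.Presheaf (DGRing.{u} K) X) :
    DGRing.isSheaf K X F ↔ HasGluing F := by
  constructor
  · intro H
    constructor
    · intro U n a b ha hb h
      choose! V hV hx hab using h
      let G : TopCat.Sheaf (ModuleCat.{u} K) X := ⟨_, H n⟩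
      let s : ToType (G.obj.obj (op U)) := (⟨a, ha⟩ : (sec F U).deg n)
      let t : ToType (G.obj.obj (op U)) := (⟨b, hb⟩ : (sec F U).deg n)
      have := G.eq_of_locally_eq' (fun x : U => V x) U (fun x => homOfLE (hV x x.2))
        (fun x hxU => Opens.mem_iSup.mpr ⟨⟨x, hxU⟩, hx x hxU⟩) s t
        (fun x => Subtype.ext (hab x x.2))
      exact congrArg Subtype.val this
    · intro U n V hV hx s hs hc
      let G : TopCat.Sheaf (ModuleCat.{u} K) X := ⟨_, H n⟩
      obtain ⟨t, ht, -⟩ := G.existsUnique_gluing' V U (fun x => homOfLE (hV x))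
        (fun x hxU => Opens.mem_iSup.mpr ⟨⟨x, hxU⟩, hx ⟨x, hxU⟩⟩)
        (fun x => (⟨s x, hs x⟩ : (sec F (V x)).deg n)) (fun x y => Subtype.ext (hc x y))
      exact ⟨(t : (sec F U).deg n).1, (t : (sec F U).deg n).2,
        fun x => congrArg Subtype.val (ht x)⟩
  · intro H n
    refine (TopCat.Presheaf.isSheaf_iff_isSheafUniqueGluing _).mpr ?_
    intro ι U sf hsf
    have hsf' : ∀ i j, res F (inf_le_left : U i ⊓ U j ≤ U i) (sf i : (sec F (U i)).deg n).1 =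
        res F (inf_le_right : U i ⊓ U j ≤ U j) (sf j : (sec F (U j)).deg n).1 :=
      fun i j => congrArg Subtype.val (hsf i j)
    have hmem : ∀ x : (iSup U : Opens X), ∃ i, x.1 ∈ U i := fun x => Opens.mem_iSup.mp x.2
    choose i hi using hmem
    obtain ⟨t, ht, hts⟩ := H.glue (fun x => U (i x)) (fun x => le_iSup U (i x)) hi
      (fun x => (sf (i x) : (sec F (U (i x))).deg n).1)
      (fun x => (sf (i x) : (sec F (U (i x))).deg n).2) (fun x y => hsf' _ _)
    refine ⟨(⟨t, ht⟩ : (sec F (iSup U)).deg n), fun j => ?_, fun t' ht' => ?_⟩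
    · refine Subtype.ext ?_
      refine H.sep (n := n) (res_mem F (le_iSup U j) ht) (sf j : (sec F (U j)).deg n).2 ?_
      intro x hx
      let x' : (iSup U : Opens X) := ⟨x, le_iSup U j hx⟩
      refine ⟨U (i x') ⊓ U j, inf_le_right, ⟨hi x', hx⟩, ?_⟩
      rw [← hsf', ← hts x', res_res]
      exact res_res F _ _ t
    · refine Subtype.ext ?_
      refine H.sep (n := n) (t' : (sec F (iSup U)).deg n).2 ht ?_
      intro x hx
      refine ⟨U (i ⟨x, hx⟩), le_iSup U _, hi ⟨x, hx⟩, ?_⟩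
      rw [hts ⟨x, hx⟩]
      exact congrArg Subtype.val (ht' (i ⟨x, hx⟩))

namespace GradedModel

/-- The homomorphism of commutative DG rings induced by a map of graded models. -/
noncomputable def map {R S : Type u} [Ring R] [Algebra K R] [Ring S] [Algebra K S]
    (M : GradedModel K R) (N : GradedModel K S) (g : R →ₐ[K] S)
    (mem : ∀ n a, a ∈ M.D n → g a ∈ N.D n)
    (hd : ∀ n a, a ∈ M.D n → g (M.d n a) = N.d n (g a)) : M.toDGRing ⟶ N.toDGRing :=
  N.lift (fun _ => (g.comp M.val).toLinearMap) (fun n _ ha => mem n _ (M.val_mem ha))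
    (map_one (g.comp M.val)) (fun _ _ a b _ _ => map_mul (g.comp M.val) a b)
    (fun n _ ha => (congrArg g (M.val_d ha)).trans (hd n _ (M.val_mem ha)))

theorem val_map {R S : Type u} [Ring R] [Algebra K R] [Ring S] [Algebra K S]
    (M : GradedModel K R) (N : GradedModel K S) (g : R →ₐ[K] S) (mem hd) {n : ℤ}
    {x : M.toDGRing.carrier} (hx : x ∈ M.toDGRing.deg n) :
    N.val (Hom.toAlgHom (M.map N g mem hd) x) = g (M.val x) := N.val_lift _ _ _ _ _ hx

/-- A homomorphism out of the DG ring of a graded model, from its homogeneous components. -/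
noncomputable def descDeg {R : Type u} [Ring R] [Algebra K R] (M : GradedModel K R) {B : DGRing K}
    (g : ∀ n : ℤ, M.D n →ₗ[K] B.carrier)
    (mem : ∀ n a, g n a ∈ B.deg n) (one : g 0 ⟨1, M.one_mem⟩ = 1)
    (mul : ∀ m n (a : M.D m) (b : M.D n),
      g (m + n) ⟨a * b, M.mul_mem a.2 b.2⟩ = g m a * g n b)
    (hd : ∀ n (a : M.D n), g (n + 1) ⟨M.d n a, M.d_mem a.2⟩ = B.d (g n a)) : M.toDGRing ⟶ B :=
  Hom.ofDeg (fun n => (g n).comp (M.val.toLinearMap.restrict fun _ => M.val_mem))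
    (fun n _ => mem n _)
    (by
      refine Eq.trans (congrArg (g 0) (Subtype.ext ?_)) one
      exact map_one M.val)
    (fun m n a b => by
      refine Eq.trans (congrArg (g (m + n)) (Subtype.ext ?_))
        (mul m n ⟨_, M.val_mem a.2⟩ ⟨_, M.val_mem b.2⟩)
      exact map_mul M.val a.1 b.1)
    (fun n a => by
      refine Eq.trans (congrArg (g (n + 1)) (Subtype.ext ?_)) (hd n ⟨_, M.val_mem a.2⟩)
      exact M.val_d a.2)

theorem descDeg_apply {R : Type u} [Ring R] [Algebra K R] (M : GradedModel K R) {B : DGRing K}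
    (g : ∀ n : ℤ, M.D n →ₗ[K] B.carrier) (mem one mul hd) {n : ℤ}
    {x : M.toDGRing.carrier} (hx : x ∈ M.toDGRing.deg n) :
    Hom.toAlgHom (M.descDeg g mem one mul hd) x = g n ⟨M.val x, M.val_mem hx⟩ :=
  Hom.ofDeg_apply _ _ _ _ _ hx

end GradedModel

section Sheafification

/-- The open neighbourhoods of a point, ordered by reverse inclusion. -/
abbrev Nhds (x : X) : Type u := {V : Opens X // x ∈ V}ᵒᵈ

instance (x : X) : IsDirectedOrder (Nhds x) where
  directed V W := ⟨OrderDual.toDual ⟨V.ofDual.1 ⊓ W.ofDual.1, V.ofDual.2, W.ofDual.2⟩,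
    (inf_le_left : V.ofDual.1 ⊓ W.ofDual.1 ≤ V.ofDual.1),
    (inf_le_right : V.ofDual.1 ⊓ W.ofDual.1 ≤ W.ofDual.1)⟩

instance (x : X) : Nonempty (Nhds x) := ⟨OrderDual.toDual ⟨⊤, trivial⟩⟩

variable (Q : TopCat.Presheaf (DGRing.{u} K) X)

/-- The restriction of a presheaf to the neighbourhoods of a point. -/
def atPoint (x : X) : Nhds x ⥤ DGRing.{u} K where
  obj V := sec Q V.ofDual.1
  map {V W} f := Q.map (homOfLE (show W.ofDual.1 ≤ V.ofDual.1 from leOfHom f)).op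
  map_id _ := Q.map_id _
  map_comp _ _ := Q.map_comp _ _

/-- The algebra underlying the stalk at a point. -/
abbrev StalkAlg (x : X) : Type u := LimAlg (atPoint Q x)

/-- The germ of a section. -/
def germ {V : Opens X} (x : V) : (sec Q V).carrier →ₐ[K] StalkAlg Q x.1 :=
  toLimAlg (atPoint Q x.1) (OrderDual.toDual ⟨V, x.2⟩)

theorem germ_res {V W : Opens X} (h : W ≤ V) (x : W) (a : (sec Q V).carrier) :
    germ Q x (res Q h a) = germ Q ⟨x.1, h x.2⟩ a :=
  toLimAlg_transition (atPoint Q x.1) (i := OrderDual.toDual ⟨V, h x.2⟩)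
    (j := OrderDual.toDual ⟨W, x.2⟩) h a

theorem limD_germ {V : Opens X} (x : V) (a : (sec Q V).carrier) :
    limD (atPoint Q x.1) (germ Q x a) = germ Q x ((sec Q V).d a) := rfl

/-- Two sections with the same germ at a point agree near this point. -/
theorem eq_of_germ_eq {V W : Opens X} {x : X} (hV : x ∈ V) (hW : x ∈ W)
    {a : (sec Q V).carrier} {b : (sec Q W).carrier}
    (h : germ Q ⟨x, hV⟩ a = germ Q ⟨x, hW⟩ b) :
    ∃ (N : Opens X) (hNV : N ≤ V) (hNW : N ≤ W), x ∈ N ∧ res Q hNV a = res Q hNW b := by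
  have hx : x ∈ V ⊓ W := ⟨hV, hW⟩
  rw [← germ_res Q (inf_le_left : V ⊓ W ≤ V) ⟨x, hx⟩,
    ← germ_res Q (inf_le_right : V ⊓ W ≤ W) ⟨x, hx⟩]
    at h
  obtain ⟨N, hN, e⟩ := (toLimAlg_eq_iff (atPoint Q x)).mp h
  have hN' : N.ofDual.1 ≤ V ⊓ W := hN
  refine ⟨N.ofDual.1, hN'.trans inf_le_left, hN'.trans inf_le_right, N.ofDual.2, ?_⟩
  have e' : res Q hN' (res Q inf_le_left a) = res Q hN' (res Q inf_le_right b) := e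
  rwa [res_res, res_res] at e'

/-- The families of germs on `U` that are locally given by sections of degree `n`. -/
noncomputable def sheafifyDeg (U : Opens X) (n : ℤ) : Submodule K (∀ x : U, StalkAlg Q x.1) where
  carrier := {s | ∀ x : U, ∃ (V : Opens X) (h : V ≤ U), x.1 ∈ V ∧ ∃ a ∈ (sec Q V).deg n,
    ∀ y : V, s ⟨y.1, h y.2⟩ = germ Q y a}
  zero_mem' x := ⟨U, le_rfl, x.2, 0, zero_mem _, fun y => (map_zero _).symm⟩
  add_mem' := by
    intro s t hs ht x
    obtain ⟨V, hV, hxV, a, ha, hsa⟩ := hs x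
    obtain ⟨W, hW, hxW, b, hb, htb⟩ := ht x
    refine ⟨V ⊓ W, inf_le_left.trans hV, ⟨hxV, hxW⟩, res Q inf_le_left a + res Q inf_le_right b,
      add_mem (res_mem Q _ ha) (res_mem Q _ hb), fun y => ?_⟩
    rw [map_add, germ_res, germ_res, Pi.add_apply, hsa ⟨y.1, y.2.1⟩, htb ⟨y.1, y.2.2⟩]
  smul_mem' := by
    intro r s hs x
    obtain ⟨V, hV, hxV, a, ha, hsa⟩ := hs x
    refine ⟨V, hV, hxV, r • a, Submodule.smul_mem _ _ ha, fun y => ?_⟩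
    rw [map_smul, Pi.smul_apply, hsa]

theorem sheafifyDeg_pair {U : Opens X} {m n : ℤ} {s t : ∀ x : U, StalkAlg Q x.1}
    (hs : s ∈ sheafifyDeg Q U m) (ht : t ∈ sheafifyDeg Q U n) (x : U) :
    ∃ (V : Opens X) (h : V ≤ U), x.1 ∈ V ∧ ∃ a ∈ (sec Q V).deg m, ∃ b ∈ (sec Q V).deg n,
      ∀ y : V, s ⟨y.1, h y.2⟩ = germ Q y a ∧ t ⟨y.1, h y.2⟩ = germ Q y b := by
  obtain ⟨V, hV, hxV, a, ha, hsa⟩ := hs x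
  obtain ⟨W, hW, hxW, b, hb, htb⟩ := ht x
  refine ⟨V ⊓ W, inf_le_left.trans hV, ⟨hxV, hxW⟩, res Q inf_le_left a, res_mem Q _ ha,
    res Q inf_le_right b, res_mem Q _ hb, fun y => ?_⟩
  rw [germ_res, germ_res, hsa ⟨y.1, y.2.1⟩, htb ⟨y.1, y.2.2⟩]
  exact ⟨rfl, rfl⟩

/-- The differential on families of germs. -/
noncomputable def sheafifyD (U : Opens X) :
    (∀ x : U, StalkAlg Q x.1) →ₗ[K] ∀ x : U, StalkAlg Q x.1 :=
  LinearMap.pi fun x => (limD (atPoint Q x.1)).comp (LinearMap.proj x)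

/-- The graded model of the sections over `U` of the associated sheaf: families of germs that are
locally given by homogeneous sections. -/
noncomputable def sheafifyModel (U : Opens X) : GradedModel K (∀ x : U, StalkAlg Q x.1) where
  D := sheafifyDeg Q U
  one_mem x := ⟨U, le_rfl, x.2, 1, one_mem_deg _, fun y => (map_one _).symm⟩
  mul_mem hs ht x := by
    obtain ⟨V, hV, hxV, a, ha, b, hb, h⟩ := sheafifyDeg_pair Q hs ht x
    refine ⟨V, hV, hxV, a * b, mul_mem_deg _ ha hb, fun y => ?_⟩
    rw [map_mul, Pi.mul_apply, (h y).1, (h y).2]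
  eq_zero hn hs := by
    funext x
    obtain ⟨V, hV, hxV, a, ha, h⟩ := hs x
    refine (h ⟨x.1, hxV⟩).trans ?_
    rw [eq_zero_of_pos _ hn ha, map_zero]
    rfl
  mul_comm' hs ht := by
    funext x
    obtain ⟨V, hV, hxV, a, ha, b, hb, h⟩ := sheafifyDeg_pair Q hs ht x
    obtain ⟨h1, h2⟩ := h ⟨x.1, hxV⟩
    rw [Pi.mul_apply, Pi.smul_apply, Pi.mul_apply]
    refine (congrArg₂ (· * ·) h2 h1).trans (Eq.trans ?_
      (congrArg₂ (fun a b => _ • (a * b)) h1 h2).symm)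
    rw [← map_mul, ← map_mul, (sec Q V).mul_comm' _ _ a b ha hb]
    exact map_units_smul (germ Q ⟨x.1, hxV⟩).toLinearMap _ _
  mul_self' hn hs := by
    funext x
    obtain ⟨V, hV, hxV, a, ha, h⟩ := hs x
    have h1 := h ⟨x.1, hxV⟩
    refine (congrArg₂ (· * ·) h1 h1).trans ?_
    rw [← map_mul, (sec Q V).mul_self' _ a hn ha, map_zero]
    rfl
  d _ := sheafifyD Q U
  d_mem hs x := by
    obtain ⟨V, hV, hxV, a, ha, h⟩ := hs x
    refine ⟨V, hV, hxV, (sec Q V).d a, (sec Q V).d_mem _ a ha, fun y => ?_⟩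
    exact (congrArg (limD _) (h y)).trans (limD_germ Q y a)
  d_d hs := by
    funext x
    obtain ⟨V, hV, hxV, a, ha, h⟩ := hs x
    refine (congrArg (fun z => limD (atPoint Q x.1) (limD (atPoint Q x.1) z))
      (h ⟨x.1, hxV⟩)).trans ?_
    refine (congrArg (germ Q ⟨x.1, hxV⟩) ((sec Q V).d_d a)).trans ?_
    rw [map_zero]
    rfl
  leibniz {m n s t} hs ht := by
    funext x
    obtain ⟨V, hV, hxV, a, ha, b, hb, h⟩ := sheafifyDeg_pair Q hs ht x
    obtain ⟨h1, h2⟩ := h ⟨x.1, hxV⟩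
    have key : ∀ p q : StalkAlg Q x.1, p = germ Q ⟨x.1, hxV⟩ a → q = germ Q ⟨x.1, hxV⟩ b →
        limD (atPoint Q x.1) (p * q) = limD (atPoint Q x.1) p * q +
          m.negOnePow • (p * limD (atPoint Q x.1) q) := by
      rintro _ _ rfl rfl
      have hd : ∀ c, limD (atPoint Q x.1) (germ Q ⟨x.1, hxV⟩ c) =
        germ Q ⟨x.1, hxV⟩ ((sec Q V).d c) := fun _ => rfl
      rw [← map_mul, hd, hd, hd, (sec Q V).leibniz _ a b ha, map_add, map_mul]
      refine congrArg₂ (· + ·) rfl ?_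
      refine (map_units_smul (germ Q ⟨x.1, hxV⟩).toLinearMap _ _).trans ?_
      exact congrArg (fun z => _ • z) (map_mul (germ Q ⟨x.1, hxV⟩) _ _)
    exact key _ _ h1 h2

/-- The restriction of families of germs. -/
noncomputable def restrictGerms {U V : Opens X} (h : V ≤ U) :
    (∀ x : U, StalkAlg Q x.1) →ₐ[K] ∀ x : V, StalkAlg Q x.1 where
  toFun s x := s ⟨x.1, h x.2⟩
  map_one' := rfl
  map_mul' _ _ := rfl
  map_zero' := rfl
  map_add' _ _ := rfl
  commutes' _ := rfl

theorem restrictGerms_mem {U V : Opens X} (h : V ≤ U) {n : ℤ} {s : ∀ x : U, StalkAlg Q x.1}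
    (hs : s ∈ sheafifyDeg Q U n) : restrictGerms Q h s ∈ sheafifyDeg Q V n := by
  intro x
  obtain ⟨W, hW, hxW, a, ha, hsa⟩ := hs ⟨x.1, h x.2⟩
  refine ⟨V ⊓ W, inf_le_left, ⟨x.2, hxW⟩, res Q inf_le_right a, res_mem Q _ ha, fun y => ?_⟩
  rw [germ_res]
  exact hsa ⟨y.1, y.2.2⟩

/-- The restriction maps of the associated sheaf. -/
noncomputable def sheafifyRes {U V : Opens X} (h : V ≤ U) :
    (sheafifyModel Q U).toDGRing ⟶ (sheafifyModel Q V).toDGRing :=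
  (sheafifyModel Q U).map (sheafifyModel Q V) (restrictGerms Q h)
    (fun _ _ ha => restrictGerms_mem Q h ha) (fun _ _ _ => rfl)

theorem val_sheafifyRes {U V : Opens X} (h : V ≤ U) {n : ℤ}
    {a : (sheafifyModel Q U).toDGRing.carrier} (ha : a ∈ (sheafifyModel Q U).toDGRing.deg n) :
    (sheafifyModel Q V).val (Hom.toAlgHom (sheafifyRes Q h) a) =
      restrictGerms Q h ((sheafifyModel Q U).val a) :=
  GradedModel.val_map _ _ _ _ _ ha

/-- The sheaf associated to a presheaf of commutative DG rings. -/
noncomputable def sheafify : TopCat.Presheaf (DGRing.{u} K) X where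
  obj U := (sheafifyModel Q U.unop).toDGRing
  map f := sheafifyRes Q (leOfHom f.unop)
  map_id U := by
    apply hom_ext_deg
    intro n a ha
    refine (sheafifyModel Q U.unop).val_inj (n := n) (Hom.map_deg _ _ _ ha) ha ?_
    exact val_sheafifyRes Q _ ha
  map_comp f g := by
    apply hom_ext_deg
    intro n a ha
    have h1 := Hom.map_deg (sheafifyRes Q (leOfHom f.unop)) _ _ ha
    refine (sheafifyModel Q _).val_inj (n := n) (Hom.map_deg _ _ _ ha)
      (Hom.map_deg (sheafifyRes Q (leOfHom g.unop)) _ _ h1) ?_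
    refine (val_sheafifyRes Q _ ha).trans ?_
    refine Eq.trans ?_ (val_sheafifyRes Q _ h1).symm
    exact congrArg (restrictGerms Q (leOfHom g.unop)) (val_sheafifyRes Q _ ha).symm

/-- The family of germs of a section of the associated sheaf. -/
noncomputable def germs (U : Opens X) :
    (sec (sheafify Q) U).carrier →ₐ[K] ∀ x : U, StalkAlg Q x.1 := (sheafifyModel Q U).val

theorem germs_mem {U : Opens X} {n : ℤ} {a : (sec (sheafify Q) U).carrier}
    (ha : a ∈ (sec (sheafify Q) U).deg n) : germs Q U a ∈ sheafifyDeg Q U n :=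
  (sheafifyModel Q U).val_mem ha

theorem germs_inj {U : Opens X} {n : ℤ} {a b : (sec (sheafify Q) U).carrier}
    (ha : a ∈ (sec (sheafify Q) U).deg n) (hb : b ∈ (sec (sheafify Q) U).deg n)
    (h : germs Q U a = germs Q U b) : a = b := (sheafifyModel Q U).val_inj ha hb h

theorem exists_germs_eq {U : Opens X} {n : ℤ} {s : ∀ x : U, StalkAlg Q x.1}
    (hs : s ∈ sheafifyDeg Q U n) : ∃ a ∈ (sec (sheafify Q) U).deg n, germs Q U a = s :=
  (sheafifyModel Q U).exists_val_eq hs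

theorem germs_res {U V : Opens X} (h : V ≤ U) {n : ℤ} {a : (sec (sheafify Q) U).carrier}
    (ha : a ∈ (sec (sheafify Q) U).deg n) (x : V) :
    germs Q V (res (sheafify Q) h a) x = germs Q U a ⟨x.1, h x.2⟩ :=
  congrFun (val_sheafifyRes Q h ha) x

theorem hasGluing_sheafify : HasGluing (sheafify Q) where
  sep {U n a b} ha hb h := by
    refine germs_inj Q ha hb (funext fun x => ?_)
    obtain ⟨V, hV, hx, e⟩ := h x.1 x.2
    rw [← germs_res Q hV ha ⟨x.1, hx⟩, e, germs_res Q hV hb]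
  glue {U n} V hV hx s hs hc := by
    let t : ∀ x : U, StalkAlg Q x.1 := fun x => germs Q (V x) (s x) ⟨x.1, hx x⟩
    have ht : ∀ (x : U) (y : V x), t ⟨y.1, hV x y.2⟩ = germs Q (V x) (s x) y := by
      intro x y
      let y' : U := ⟨y.1, hV x y.2⟩
      have h1 := germs_res Q (inf_le_left : V x ⊓ V y' ≤ V x) (hs x) ⟨y.1, y.2, hx y'⟩
      have h2 := germs_res Q (inf_le_right : V x ⊓ V y' ≤ V y') (hs y') ⟨y.1, y.2, hx y'⟩
      rw [hc] at h1
      exact h2.symm.trans h1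
    have htm : t ∈ sheafifyDeg Q U n := by
      intro x
      obtain ⟨W, hW, hxW, a, ha, e⟩ := germs_mem Q (hs x) ⟨x.1, hx x⟩
      exact ⟨W, hW.trans (hV x), hxW, a, ha, fun y => (ht x ⟨y.1, hW y.2⟩).trans (e y)⟩
    obtain ⟨b, hb, hbt⟩ := exists_germs_eq Q htm
    refine ⟨b, hb, fun x => germs_inj Q (res_mem _ _ hb) (hs x) (funext fun y => ?_)⟩
    rw [germs_res Q _ hb, hbt, ht]

/-- The canonical morphism to the associated sheaf on sections. -/
noncomputable def toSheafifyApp (U : Opens X) : sec Q U ⟶ sec (sheafify Q) U :=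
  (sheafifyModel Q U).lift (fun _ => LinearMap.pi fun x => (germ Q x).toLinearMap)
    (fun _ a ha x => ⟨U, le_rfl, x.2, a, ha, fun _ => rfl⟩)
    (funext fun x => map_one (germ Q x)) (fun _ _ a b _ _ => funext fun x => map_mul (germ Q x) a b)
    (fun _ _ _ => rfl)

theorem germs_toSheafifyApp {U : Opens X} {n : ℤ} {a : (sec Q U).carrier}
    (ha : a ∈ (sec Q U).deg n) (x : U) :
    germs Q U (Hom.toAlgHom (toSheafifyApp Q U) a) x = germ Q x a :=
  congrFun (GradedModel.val_lift _ _ _ _ _ _ ha) x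

/-- The canonical morphism to the associated sheaf. -/
noncomputable def toSheafify : Q ⟶ sheafify Q where
  app U := toSheafifyApp Q U.unop
  naturality U V f := by
    apply hom_ext_deg
    intro n a ha
    have h : V.unop ≤ U.unop := leOfHom f.unop
    refine germs_inj Q (n := n) (Hom.map_deg (toSheafifyApp Q V.unop) _ _ (res_mem Q h ha))
      (res_mem (sheafify Q) h (Hom.map_deg (toSheafifyApp Q U.unop) _ _ ha)) (funext fun x => ?_)
    refine (germs_toSheafifyApp Q (res_mem Q h ha) x).trans ?_
    refine Eq.trans ?_ (germs_res Q h (Hom.map_deg (toSheafifyApp Q U.unop) _ _ ha) x).symm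
    rw [germs_toSheafifyApp Q ha]
    exact germ_res Q h x a

theorem germs_toSheafify {U : Opens X} {n : ℤ} {a : (sec Q U).carrier}
    (ha : a ∈ (sec Q U).deg n) (x : U) : germs Q U (ap (toSheafify Q) U a) x = germ Q x a :=
  germs_toSheafifyApp Q ha x

/-- A section of the associated sheaf is locally the image of a section of the presheaf. -/
theorem exists_toSheafify_eq {U : Opens X} {n : ℤ} {s : (sec (sheafify Q) U).carrier}
    (hs : s ∈ (sec (sheafify Q) U).deg n) {x : X} (hx : x ∈ U) :
    ∃ (V : Opens X) (h : V ≤ U), x ∈ V ∧ ∃ a ∈ (sec Q V).deg n,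
      ap (toSheafify Q) V a = res (sheafify Q) h s := by
  obtain ⟨V, hV, hxV, a, ha, e⟩ := germs_mem Q hs ⟨x, hx⟩
  refine ⟨V, hV, hxV, a, ha, germs_inj Q (ap_mem _ ha) (res_mem _ hV hs) (funext fun y => ?_)⟩
  rw [germs_toSheafify Q ha, germs_res Q hV hs, e]

/-- Sections with the same image in the associated sheaf agree locally. -/
theorem eq_of_toSheafify_eq {U : Opens X} {n : ℤ} {a b : (sec Q U).carrier}
    (ha : a ∈ (sec Q U).deg n) (hb : b ∈ (sec Q U).deg n)
    (h : ap (toSheafify Q) U a = ap (toSheafify Q) U b) {x : X} (hx : x ∈ U) :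
    ∃ (V : Opens X) (h : V ≤ U), x ∈ V ∧ res Q h a = res Q h b := by
  have h1 := germs_toSheafify Q ha ⟨x, hx⟩
  rw [h, germs_toSheafify Q hb] at h1
  obtain ⟨N, hN, _, hxN, e⟩ := eq_of_germ_eq Q hx hx h1.symm
  exact ⟨N, hN, hxN, e⟩

/-- A presheaf has the same local sections as its associated sheaf, hence the same local
cohomology. -/
theorem presheafQuasiIso_toSheafify : PresheafQuasiIso (toSheafify Q) := by
  rw [presheafQuasiIso_iff]
  intro U l m n hlm hmn e he e' he' hde hee x hx
  obtain ⟨V, hV, hxV, a, ha, hae⟩ := exists_toSheafify_eq Q he' hx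
  have h1 : ap (toSheafify Q) V ((sec Q V).d a) = ap (toSheafify Q) V (res Q hV e) := by
    rw [ap_d, hae, ap_res, hee, res_d]
  obtain ⟨W, hW, hxW, h2⟩ := eq_of_toSheafify_eq Q (n := n) (hmn ▸ (sec Q V).d_mem _ _ ha)
    (res_mem Q hV he) h1 hxV
  refine ⟨W, hW.trans hV, hxW, res Q hW a, res_mem Q _ ha, 0, zero_mem _, ?_, ?_⟩
  · rw [← res_d, h2, res_res]
  · rw [ap_res, hae, res_res, sub_self, map_zero]

variable {Q} {S : TopCat.Presheaf (DGRing.{u} K) X}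

/-- A morphism to a sheaf sends a family of germs to a unique section. -/
theorem exists_desc_section (hS : HasGluing S) (f : Q ⟶ S) {U : Opens X} {n : ℤ}
    {s : ∀ x : U, StalkAlg Q x.1} (hs : s ∈ sheafifyDeg Q U n) :
    ∃ b ∈ (sec S U).deg n, ∀ (V : Opens X) (hV : V ≤ U), ∀ a ∈ (sec Q V).deg n,
      (∀ y : V, s ⟨y.1, hV y.2⟩ = germ Q y a) → res S hV b = ap f V a := by
  choose V hV hx a ha hsa using hs
  have key : ∀ (x : U) (W : Opens X) (hW : W ≤ U), ∀ c ∈ (sec Q W).deg n,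
      (∀ y : W, s ⟨y.1, hW y.2⟩ = germ Q y c) →
      res S (inf_le_left : V x ⊓ W ≤ V x) (ap f _ (a x)) =
        res S (inf_le_right : V x ⊓ W ≤ W) (ap f _ c) := by
    intro x W hW c hc hsc
    refine hS.sep (n := n) (res_mem S _ (ap_mem f (ha x))) (res_mem S _ (ap_mem f hc)) ?_
    intro z hz
    obtain ⟨N, h1, h2, hzN, e⟩ := eq_of_germ_eq Q hz.1 hz.2
      (((hsa x ⟨z, hz.1⟩).symm.trans (hsc ⟨z, hz.2⟩)))
    refine ⟨N, le_inf h1 h2, hzN, ?_⟩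
    rw [res_res, res_res, ← ap_res f h1, ← ap_res f h2, e]
  obtain ⟨b, hb, hbs⟩ := hS.glue V hV hx (fun x => ap f _ (a x)) (fun x => ap_mem f (ha x))
    (fun x y => key x _ (hV y) _ (ha y) (hsa y))
  refine ⟨b, hb, fun W hW c hc hsc => ?_⟩
  refine hS.sep (n := n) (res_mem S _ hb) (ap_mem f hc) fun z hz => ?_
  refine ⟨V ⟨z, hW hz⟩ ⊓ W, inf_le_right, ⟨hx ⟨z, hW hz⟩, hz⟩, ?_⟩
  rw [← key ⟨z, hW hz⟩ W hW c hc hsc, ← hbs ⟨z, hW hz⟩, res_res, res_res]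

/-- The section of a sheaf `S` determined by a family of germs of `Q` and a morphism `Q ⟶ S`. -/
noncomputable def descSection (hS : HasGluing S) (f : Q ⟶ S) (U : Opens X) (n : ℤ)
    (s : sheafifyDeg Q U n) : (sec S U).carrier := (exists_desc_section hS f s.2).choose

theorem descSection_mem (hS : HasGluing S) (f : Q ⟶ S) (U : Opens X) (n : ℤ)
    (s : sheafifyDeg Q U n) : descSection hS f U n s ∈ (sec S U).deg n :=
  (exists_desc_section hS f s.2).choose_spec.1

theorem res_descSection (hS : HasGluing S) (f : Q ⟶ S) {U : Opens X} {n : ℤ}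
    (s : sheafifyDeg Q U n) {V : Opens X} (hV : V ≤ U) {a : (sec Q V).carrier}
    (ha : a ∈ (sec Q V).deg n) (h : ∀ y : V, s.1 ⟨y.1, hV y.2⟩ = germ Q y a) :
    res S hV (descSection hS f U n s) = ap f V a :=
  (exists_desc_section hS f s.2).choose_spec.2 V hV a ha h

theorem eq_descSection (hS : HasGluing S) (f : Q ⟶ S) {U : Opens X} {n : ℤ}
    (s : sheafifyDeg Q U n) {b : (sec S U).carrier} (hb : b ∈ (sec S U).deg n)
    (h : ∀ x : U, ∃ (V : Opens X) (hV : V ≤ U), x.1 ∈ V ∧ ∃ a ∈ (sec Q V).deg n,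
      (∀ y : V, s.1 ⟨y.1, hV y.2⟩ = germ Q y a) ∧ res S hV b = ap f V a) :
    descSection hS f U n s = b := by
  refine hS.sep (descSection_mem hS f U n s) hb fun x hx => ?_
  obtain ⟨V, hV, hxV, a, ha, h1, h2⟩ := h ⟨x, hx⟩
  exact ⟨V, hV, hxV, (res_descSection hS f s hV ha h1).trans h2.symm⟩

theorem descSection_add (hS : HasGluing S) (f : Q ⟶ S) {U : Opens X} {n : ℤ}
    (s t : sheafifyDeg Q U n) :
    descSection hS f U n (s + t) = descSection hS f U n s + descSection hS f U n t := by
  refine eq_descSection hS f _ (add_mem (descSection_mem hS f U n s)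
    (descSection_mem hS f U n t)) fun x => ?_
  obtain ⟨V, hV, hxV, a, ha, b, hb, h⟩ := sheafifyDeg_pair Q s.2 t.2 x
  refine ⟨V, hV, hxV, a + b, add_mem ha hb, fun y => ?_, ?_⟩
  · rw [map_add, ← (h y).1, ← (h y).2]
    rfl
  · rw [map_add, map_add, res_descSection hS f s hV ha (fun y => (h y).1),
      res_descSection hS f t hV hb (fun y => (h y).2)]

theorem descSection_smul (hS : HasGluing S) (f : Q ⟶ S) {U : Opens X} {n : ℤ} (r : K)
    (s : sheafifyDeg Q U n) : descSection hS f U n (r • s) = r • descSection hS f U n s := by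
  refine eq_descSection hS f _ (Submodule.smul_mem _ _ (descSection_mem hS f U n s)) fun x => ?_
  obtain ⟨V, hV, hxV, a, ha, h⟩ := s.2 x
  refine ⟨V, hV, hxV, r • a, Submodule.smul_mem _ _ ha, fun y => ?_, ?_⟩
  · rw [map_smul, ← h y]
    rfl
  · rw [map_smul, map_smul, res_descSection hS f s hV ha h]

theorem descSection_one (hS : HasGluing S) (f : Q ⟶ S) (U : Opens X) :
    descSection hS f U 0 ⟨1, (sheafifyModel Q U).one_mem⟩ = 1 :=
  eq_descSection hS f _ (one_mem_deg _) fun x =>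
    ⟨U, le_rfl, x.2, 1, one_mem_deg _, fun _ => (map_one _).symm, by rw [map_one, map_one]⟩

theorem descSection_mul (hS : HasGluing S) (f : Q ⟶ S) {U : Opens X} {m n : ℤ}
    (s : sheafifyDeg Q U m) (t : sheafifyDeg Q U n) :
    descSection hS f U (m + n) ⟨s.1 * t.1, (sheafifyModel Q U).mul_mem s.2 t.2⟩ =
      descSection hS f U m s * descSection hS f U n t := by
  refine eq_descSection hS f _ (mul_mem_deg _ (descSection_mem hS f U m s)
    (descSection_mem hS f U n t)) fun x => ?_
  obtain ⟨V, hV, hxV, a, ha, b, hb, h⟩ := sheafifyDeg_pair Q s.2 t.2 x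
  refine ⟨V, hV, hxV, a * b, mul_mem_deg _ ha hb, fun y => ?_, ?_⟩
  · rw [map_mul, ← (h y).1, ← (h y).2]
    rfl
  · rw [map_mul, map_mul, res_descSection hS f s hV ha (fun y => (h y).1),
      res_descSection hS f t hV hb (fun y => (h y).2)]

theorem descSection_d (hS : HasGluing S) (f : Q ⟶ S) {U : Opens X} {n : ℤ}
    (s : sheafifyDeg Q U n) :
    descSection hS f U (n + 1) ⟨sheafifyD Q U s.1, (sheafifyModel Q U).d_mem s.2⟩ =
      (sec S U).d (descSection hS f U n s) := by
  refine eq_descSection hS f _ ((sec S U).d_mem _ _ (descSection_mem hS f U n s)) fun x => ?_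
  obtain ⟨V, hV, hxV, a, ha, h⟩ := s.2 x
  refine ⟨V, hV, hxV, (sec Q V).d a, (sec Q V).d_mem _ _ ha, fun y => ?_, ?_⟩
  · exact (congrArg (limD (atPoint Q y.1)) (h y)).trans (limD_germ Q y a)
  · rw [res_d, ap_d, res_descSection hS f s hV ha h]

/-- The morphism from the associated sheaf on sections. -/
noncomputable def sheafifyDescApp (hS : HasGluing S) (f : Q ⟶ S) (U : Opens X) :
    sec (sheafify Q) U ⟶ sec S U :=
  (sheafifyModel Q U).descDeg
    (fun n =>
      { toFun := descSection hS f U n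
        map_add' := descSection_add hS f
        map_smul' := descSection_smul hS f })
    (descSection_mem hS f U) (descSection_one hS f U) (fun _ _ => descSection_mul hS f)
    (fun _ => descSection_d hS f)

theorem sheafifyDescApp_apply (hS : HasGluing S) (f : Q ⟶ S) {U : Opens X} {n : ℤ}
    {s : (sec (sheafify Q) U).carrier} (hs : s ∈ (sec (sheafify Q) U).deg n) :
    Hom.toAlgHom (sheafifyDescApp hS f U) s = descSection hS f U n ⟨_, germs_mem Q hs⟩ :=
  (sheafifyModel Q U).descDeg_apply _ _ _ _ _ hs

/-- The morphism from the associated sheaf induced by a morphism to a sheaf. -/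
noncomputable def sheafifyDesc (hS : HasGluing S) (f : Q ⟶ S) : sheafify Q ⟶ S where
  app U := sheafifyDescApp hS f U.unop
  naturality U V g := by
    apply hom_ext_deg
    intro n s hs
    have h : V.unop ≤ U.unop := leOfHom g.unop
    refine (sheafifyDescApp_apply hS f (res_mem (sheafify Q) h hs)).trans ?_
    refine Eq.trans ?_ (congrArg (res S h) (sheafifyDescApp_apply hS f hs).symm)
    refine eq_descSection hS f _ (res_mem S h (descSection_mem hS f _ _ _)) fun x => ?_
    obtain ⟨W, hW, hxW, a, ha, e⟩ := germs_mem Q hs ⟨x.1, h x.2⟩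
    refine ⟨V.unop ⊓ W, inf_le_left, ⟨x.2, hxW⟩, res Q inf_le_right a, res_mem Q _ ha,
      fun y => ?_, ?_⟩
    · refine (germs_res Q h hs ⟨y.1, y.2.1⟩).trans ((e ⟨y.1, y.2.2⟩).trans ?_)
      exact (germ_res Q inf_le_right y a).symm
    · rw [ap_res, ← res_descSection hS f ⟨_, germs_mem Q hs⟩ hW ha e, res_res, res_res]

theorem toSheafify_desc (hS : HasGluing S) (f : Q ⟶ S) :
    toSheafify Q ≫ sheafifyDesc hS f = f := by
  apply presheaf_hom_ext
  intro U n a ha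
  refine (sheafifyDescApp_apply hS f (ap_mem (toSheafify Q) ha)).trans ?_
  exact eq_descSection hS f _ (ap_mem f ha) fun x =>
    ⟨U, le_rfl, x.2, a, ha, fun y => germs_toSheafify Q ha y, res_self _ _ _⟩

theorem sheafify_hom_ext (hS : HasGluing S) {f g : sheafify Q ⟶ S}
    (h : toSheafify Q ≫ f = toSheafify Q ≫ g) : f = g := by
  apply presheaf_hom_ext
  intro U n s hs
  refine hS.sep (ap_mem f hs) (ap_mem g hs) fun x hx => ?_
  obtain ⟨V, hV, hxV, a, -, e⟩ := exists_toSheafify_eq Q hs hx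
  refine ⟨V, hV, hxV, ?_⟩
  rw [← ap_res, ← ap_res, ← e, ← ap_comp, h, ap_comp]

end Sheafification

end DGRing

/-! ### Free generators -/

namespace DGRing

variable {K : Type u} [CommRing K]

section Cell

/-- The data `(n, c, p)` for attaching to `E` a free generator of degree `n` with differential `c`.
The generator is present only if `p` holds: on an open set `V`, a cell attached over an open set `U`
has its generator exactly when `V ≤ U`. -/
structure CellData (E : DGRing K) where
  n : ℤ
  c : E.carrier
  p : Prop
  hn : n ≤ 0
  c_mem : c ∈ E.deg (n + 1)
  d_c : E.d c = 0

/-- The exponents `k` for which `genᵏ` is a nonzero element of the cell: an odd generator squares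
to zero. -/
def CellData.HasPower {E : DGRing K} (D : CellData E) (k : ℕ) : Prop :=
  k = 0 ∨ D.p ∧ (Even D.n ∨ k = 1)

/-- The commutative DG ring `E[gen]` obtained from `E` by freely adjoining a generator of degree
`n` with differential `c`, given by its universal property and by the coefficients of its elements
as polynomials in the generator. The coefficients of the differential are only described at and
above the degree of the polynomial, where the differential of the generator does not contribute. -/
structure Cell {E : DGRing K} (D : CellData E) where
  obj : DGRing K
  ι : E ⟶ obj
  gen : obj.carrier
  gen_mem : gen ∈ obj.deg D.n
  d_gen : D.p → obj.d gen = Hom.toAlgHom ι D.c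
  gen_eq_zero : ¬ D.p → gen = 0
  coeff : ℕ → obj.carrier →ₗ[K] E.carrier
  coeff_mem : ∀ {m : ℤ} {z : obj.carrier} (k : ℕ), z ∈ obj.deg m →
    coeff k z ∈ E.deg (m - k * D.n)
  coeff_eq_zero : ∀ {m : ℤ} {z : obj.carrier} {k : ℕ}, z ∈ obj.deg m → ¬ D.HasPower k →
    coeff k z = 0
  exists_bound : ∀ {m : ℤ} {z : obj.carrier}, z ∈ obj.deg m → ∃ N, ∀ k ≥ N, coeff k z = 0
  expand : ∀ {m : ℤ} {z : obj.carrier} {N : ℕ}, z ∈ obj.deg m → (∀ k ≥ N, coeff k z = 0) →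
    z = ∑ k ∈ Finset.range N, Hom.toAlgHom ι (coeff k z) * gen ^ k
  coeff_monomial : ∀ {j : ℤ} {b : E.carrier} {k : ℕ}, b ∈ E.deg j → D.HasPower k → ∀ i,
    coeff i (Hom.toAlgHom ι b * gen ^ k) = if i = k then b else 0
  coeff_d : ∀ {m : ℤ} {z : obj.carrier} {k : ℕ}, z ∈ obj.deg m → (∀ i > k, coeff i z = 0) →
    ∀ i ≥ k, coeff i (obj.d z) = E.d (coeff i z)
  exists_desc : ∀ {T : DGRing K} (φ : E ⟶ T) {t : T.carrier}, t ∈ T.deg D.n →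
    (D.p → T.d t = Hom.toAlgHom φ D.c) → (¬ D.p → t = 0) →
    ∃ ψ : obj ⟶ T, ι ≫ ψ = φ ∧ Hom.toAlgHom ψ gen = t

open Polynomial

theorem negOnePow_eq_of_even {m n : ℤ} (h : Even (m - n)) : m.negOnePow = n.negOnePow :=
  (Int.negOnePow_eq_iff m n).mpr h

theorem commute_of_even {E : DGRing K} {n : ℤ} (hn : Even n) {t : E.carrier} (ht : t ∈ E.deg n)
    (a : E.carrier) : Commute a t := by
  induction a using DirectSum.Decomposition.inductionOn E.deg with
  | zero => exact Commute.zero_left _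
  | @homogeneous m a =>
    have := E.mul_comm' n m t a ht a.2
    rwa [Int.negOnePow_even _ (hn.mul_right m), one_smul] at this
  | add a b ha hb => exact ha.add_left hb

/-- The application of a linear map to the coefficients of a polynomial. -/
noncomputable def coeffwise {R : Type u} [Ring R] [Algebra K R] (d : R →ₗ[K] R) :
    R[X] →ₗ[K] R[X] where
  toFun f := f.sum fun i a => monomial i (d a)
  map_add' f g := by
    rw [Polynomial.sum_add_index] <;> simp
  map_smul' r f := by
    rw [Polynomial.sum_smul_index']
    · simp only [map_smul, Polynomial.sum_def, Finset.smul_sum, RingHom.id_apply, smul_monomial]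
    · simp

theorem coeff_coeffwise {R : Type u} [Ring R] [Algebra K R] (d : R →ₗ[K] R) (f : R[X]) (k : ℕ) :
    (coeffwise d f).coeff k = d (f.coeff k) := by
  change (f.sum fun i a => monomial i (d a)).coeff k = _
  rw [Polynomial.sum_def, finsetSum_coeff]
  simp only [coeff_monomial]
  rw [Finset.sum_ite_eq' f.support k fun i => d (f.coeff i)]
  split_ifs with h
  · rfl
  · rw [notMem_support_iff.mp h, map_zero]

variable {E : DGRing K} (D : CellData E)

/-- The polynomials that are homogeneous of degree `m`, for a variable of degree `n` that is present
only if `p` holds. -/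
noncomputable def evenDeg (m : ℤ) : Submodule K E.carrier[X] where
  carrier := {f | ∀ k : ℕ, f.coeff k ∈ E.deg (m - k * D.n) ∧ (¬ (k = 0 ∨ D.p) → f.coeff k = 0)}
  zero_mem' k := ⟨by rw [coeff_zero]; exact zero_mem _, fun _ => coeff_zero k⟩
  add_mem' hf hg k := ⟨by rw [coeff_add]; exact add_mem (hf k).1 (hg k).1, fun h => by
    rw [coeff_add, (hf k).2 h, (hg k).2 h, add_zero]⟩
  smul_mem' r f hf k := ⟨by rw [coeff_smul]; exact Submodule.smul_mem _ _ (hf k).1, fun h => by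
    rw [coeff_smul, (hf k).2 h, smul_zero]⟩

/-- The differential of a polynomial of degree `m`: it is `d` on coefficients and sends the variable
to `c`. -/
noncomputable def evenD (m : ℤ) : E.carrier[X] →ₗ[K] E.carrier[X] :=
  coeffwise E.d + m.negOnePow • (LinearMap.mulRight K (C D.c)).comp (derivative.restrictScalars K)

theorem evenD_apply (m : ℤ) (f : E.carrier[X]) :
    evenD D m f = coeffwise E.d f + m.negOnePow • (derivative f * C D.c) := rfl

theorem coeff_units_smul {R : Type u} [Ring R] (s : ℤˣ) (f : R[X]) (k : ℕ) :
    (s • f).coeff k = s • f.coeff k := by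
  rcases Int.units_eq_one_or s with rfl | rfl <;> simp

theorem coeff_evenD (m : ℤ) (f : E.carrier[X]) (k : ℕ) :
    (evenD D m f).coeff k =
      E.d (f.coeff k) + m.negOnePow • (f.coeff (k + 1) * (k + 1) * D.c) := by
  rw [evenD_apply, coeff_add, coeff_coeffwise, coeff_units_smul, coeff_mul_C, coeff_derivative]

theorem C_c_mul (hn : Even D.n) {m : ℤ} {f : E.carrier[X]} (hf : f ∈ evenDeg D m) :
    C D.c * f = m.negOnePow • (f * C D.c) := by
  ext k
  rw [coeff_C_mul, coeff_units_smul, coeff_mul_C, E.mul_comm' _ _ _ _ (hf k).1 D.c_mem]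
  congr 1
  apply negOnePow_eq_of_even
  have : (m - k * D.n) * (D.n + 1) - m = (m - k * D.n - k) * D.n := by ring
  rw [this]
  exact hn.mul_left _

theorem coeffwise_mul (hn : Even D.n) {m : ℤ} {f : E.carrier[X]} (hf : f ∈ evenDeg D m)
    (g : E.carrier[X]) :
    coeffwise E.d (f * g) = coeffwise E.d f * g + m.negOnePow • (f * coeffwise E.d g) := by
  ext k
  rw [coeff_coeffwise, coeff_add, coeff_units_smul, coeff_mul, coeff_mul, coeff_mul, map_sum,
    Finset.smul_sum, ← Finset.sum_add_distrib]
  refine Finset.sum_congr rfl fun x _ => ?_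
  rw [E.leibniz _ _ _ (hf x.1).1, coeff_coeffwise, coeff_coeffwise]
  congr 2
  apply negOnePow_eq_of_even
  rw [show m - x.1 * D.n - m = -x.1 * D.n by ring]
  exact hn.mul_left _

theorem natCast_mem (k : ℕ) : (k : E.carrier) ∈ E.deg 0 := by
  rw [← nsmul_one]
  exact nsmul_mem (one_mem_deg E) k

theorem mem_deg_congr {m n : ℤ} (h : m = n) {a : E.carrier} (ha : a ∈ E.deg m) : a ∈ E.deg n :=
  h ▸ ha

/-- The graded model of polynomials in an even variable. -/
noncomputable def evenModel (hn : Even D.n) : GradedModel K E.carrier[X] where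
  D := evenDeg D
  one_mem k := by
    rw [coeff_one]
    split_ifs with h
    · subst h
      exact ⟨mem_deg_congr (by simp) (one_mem_deg E), fun h => (h (Or.inl rfl)).elim⟩
    · exact ⟨zero_mem _, fun _ => rfl⟩
  mul_mem {m m' f g} hf hg k := by
    rw [coeff_mul]
    constructor
    · refine sum_mem fun x hx => ?_
      have hx' : k = x.1 + x.2 := (Finset.HasAntidiagonal.mem_antidiagonal.mp hx).symm
      refine mem_deg_congr ?_ (mul_mem_deg _ (hf x.1).1 (hg x.2).1)
      rw [hx']
      push_cast
      ring
    · intro h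
      push Not at h
      refine Finset.sum_eq_zero fun x hx => ?_
      have hx' : x.1 + x.2 = k := Finset.HasAntidiagonal.mem_antidiagonal.mp hx
      by_cases h1 : x.1 = 0
      · rw [(hg x.2).2, mul_zero]
        rintro (h2 | h2)
        · omega
        · exact h.2 h2
      · rw [(hf x.1).2, zero_mul]
        rintro (h2 | h2)
        · exact h1 h2
        · exact h.2 h2
  eq_zero {m f} hm hf := by
    ext k
    refine eq_zero_of_pos E ?_ (hf k).1
    have := mul_nonpos_of_nonneg_of_nonpos (Int.natCast_nonneg k) D.hn
    omega
  mul_comm' {m m' f g} hf hg := by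
    ext k
    rw [coeff_units_smul, coeff_mul, coeff_mul, Finset.smul_sum,
      ← Finset.sum_equiv (Equiv.prodComm ℕ ℕ) (s := Finset.HasAntidiagonal.antidiagonal k)
        (t := Finset.HasAntidiagonal.antidiagonal k) (g := fun x => g.coeff x.1 * f.coeff x.2)
        (by simp [add_comm]) (fun _ _ => rfl)]
    refine Finset.sum_congr rfl fun x _ => ?_
    change g.coeff x.2 * f.coeff x.1 = _
    rw [E.mul_comm' _ _ _ _ (hf x.1).1 (hg x.2).1]
    congr 1
    apply negOnePow_eq_of_even
    have : (m - x.1 * D.n) * (m' - x.2 * D.n) - m * m' =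
      (-x.1 * m' - (m - x.1 * D.n) * x.2) * D.n := by ring
    rw [this]
    exact hn.mul_left _
  mul_self' {m f} hm hf := by
    have hodd : ∀ k : ℕ, Odd (m - k * D.n) := fun k => hm.sub_even (hn.mul_left _)
    ext k
    rw [coeff_mul, coeff_zero]
    refine Finset.sum_involution (fun x _ => x.swap) (fun x _ => ?_) (fun x _ hx => ?_)
      (fun x hx => Finset.HasAntidiagonal.swap_mem_antidiagonal.mpr hx) (fun x _ => x.swap_swap)
    · change f.coeff x.1 * f.coeff x.2 + f.coeff x.2 * f.coeff x.1 = 0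
      rw [E.mul_comm' _ _ _ _ (hf x.1).1 (hf x.2).1,
        Int.negOnePow_odd _ ((hodd x.1).mul (hodd x.2)), Units.neg_smul, one_smul, add_neg_cancel]
    · rintro h
      apply hx
      have : x.2 = x.1 := congrArg Prod.fst h
      rw [this]
      exact E.mul_self' _ _ (hodd _) (hf x.1).1
  d := evenD D
  d_mem {m f} hf k := by
    rw [coeff_evenD]
    constructor
    · refine add_mem (mem_deg_congr (by ring) (E.d_mem _ _ (hf k).1)) (units_smul_mem_deg _ _ ?_)
      have h1 : ((k : E.carrier) + 1) ∈ E.deg 0 := add_mem (natCast_mem k) (one_mem_deg E)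
      refine mem_deg_congr ?_ (mul_mem_deg _ (mul_mem_deg _ (hf (k + 1)).1 h1) D.c_mem)
      push_cast
      ring
    · intro h
      have h' : ¬ (k + 1 = 0 ∨ D.p) := by
        rintro (h1 | h1)
        · omega
        · exact h (Or.inr h1)
      rw [(hf k).2 h, (hf (k + 1)).2 h', map_zero, zero_mul, zero_mul, smul_zero, add_zero]
  d_d {m f} hf := by
    have hcc : D.c * D.c = 0 := E.mul_self' _ _ (hn.add_one) D.c_mem
    have h0 : ∀ u w : E.carrier, Commute u D.c → w * D.c * u * D.c = 0 := fun u w hu => by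
      rw [mul_assoc, hu.eq, mul_assoc w, ← mul_assoc D.c, hcc, zero_mul, mul_zero]
    ext k
    have h1 := h0 (k + 1) (f.coeff (k + 1 + 1) * ((k + 1 : ℕ) + 1))
      (by exact_mod_cast Nat.cast_commute (k + 1) D.c)
    have h2 : E.d (((k : E.carrier) + 1) * D.c) = 0 := by
      have : ((k : E.carrier) + 1) * D.c = (k + 1) • D.c := by
        rw [nsmul_eq_mul]
        push_cast
        rfl
      rw [this, map_nsmul, D.d_c, smul_zero]
    have h3 : E.d (m.negOnePow • (f.coeff (k + 1) * (k + 1) * D.c)) =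
        m.negOnePow • (E.d (f.coeff (k + 1)) * (k + 1) * D.c) := by
      rw [show E.d (m.negOnePow • (f.coeff (k + 1) * (k + 1) * D.c)) =
        m.negOnePow • E.d (f.coeff (k + 1) * (k + 1) * D.c) from map_units_smul _ _ _, mul_assoc,
        E.leibniz _ _ _ (hf (k + 1)).1, h2, mul_zero, smul_zero, add_zero, mul_assoc]
    rw [coeff_evenD, coeff_evenD, coeff_evenD, map_add, E.d_d, zero_add, coeff_zero, h3,
      Int.negOnePow_succ, Units.neg_smul, add_mul, add_mul, smul_mul_assoc, smul_mul_assoc, h1,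
      smul_zero, add_zero]
    exact add_neg_cancel _
  leibniz {m m' f g} hf hg := by
    rw [evenD_apply, evenD_apply, evenD_apply, coeffwise_mul D hn hf, derivative_mul, add_mul,
      add_mul, mul_add, smul_add, smul_add, smul_mul_assoc, mul_assoc _ (C D.c) g, C_c_mul D hn hg,
      mul_smul_comm, mul_smul_comm, smul_smul, smul_smul, Int.negOnePow_add, mul_assoc, mul_assoc]
    abel

end Cell

end DGRing

/-! ### Even generators -/

namespace DGRing

variable {K : Type u} [CommRing K] {E : DGRing K} (D : CellData E)

section EvenCell

open Polynomial

theorem d_one (T : DGRing K) : T.d 1 = 0 := by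
  have := T.leibniz 0 1 1 (one_mem_deg T)
  simpa using this

theorem d_pow_of_even {T : DGRing K} {n : ℤ} (hn : Even n) {t : T.carrier} (ht : t ∈ T.deg n)
    (k : ℕ) : T.d (t ^ (k + 1)) = (k + 1) * (t ^ k * T.d t) := by
  have h1 : ∀ b, T.d (t * b) = T.d t * b + t * T.d b := fun b => by
    rw [T.leibniz n t b ht, Int.negOnePow_even n hn, one_smul]
  have h2 : ∀ b, Commute b t := commute_of_even hn ht
  induction k with
  | zero => simp
  | succ k ih =>
    rw [pow_succ' t (k + 1), h1, ih, ← ((h2 (T.d t)).symm.pow_left (k + 1)).eq, ← mul_assoc t,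
      ← (h2 _).eq, mul_assoc _ t, ← mul_assoc t, ← pow_succ']
    push_cast
    noncomm_ring

open Classical in
/-- The variable of the polynomial ring if the generator is present, and zero otherwise. -/
noncomputable def evenVar : E.carrier[X] := if D.p then X else 0

theorem evenVar_mem : evenVar D ∈ evenDeg D D.n := by
  intro k
  rw [evenVar]
  split_ifs with hp
  · refine ⟨?_, fun h => (h (Or.inr hp)).elim⟩
    rw [coeff_X]
    split_ifs with h
    · subst h
      exact mem_deg_congr (by simp) (one_mem_deg E)
    · exact zero_mem _
  · rw [coeff_zero]
    exact ⟨zero_mem _, fun _ => rfl⟩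

/-- The inclusion of constant polynomials. -/
noncomputable def evenConst (hn : Even D.n) : E ⟶ (evenModel D hn).toDGRing :=
  (evenModel D hn).lift (fun _ => (CAlgHom : E.carrier →ₐ[K] E.carrier[X]).toLinearMap)
    (fun m a ha k => by
      change (C a).coeff k ∈ _ ∧ _
      rw [coeff_C]
      split_ifs with h
      · subst h
        exact ⟨mem_deg_congr (by simp) ha, fun h => (h (Or.inl rfl)).elim⟩
      · exact ⟨zero_mem _, fun _ => (coeff_C.trans (if_neg h))⟩)
    C_1 (fun _ _ a b _ _ => C_mul) (fun m a _ => by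
      ext k
      change (C (E.d a)).coeff k = (evenD D m (C a)).coeff k
      rw [coeff_evenD, coeff_C, coeff_C, coeff_C, if_neg k.succ_ne_zero]
      split_ifs <;> simp)

theorem val_evenConst (hn : Even D.n) {m : ℤ} {a : E.carrier} (ha : a ∈ E.deg m) :
    (evenModel D hn).val (Hom.toAlgHom (evenConst D hn) a) = C a :=
  (evenModel D hn).val_lift _ _ _ _ _ ha

/-- The homogeneous element given by the variable. -/
noncomputable def evenGen (hn : Even D.n) : (evenModel D hn).toDGRing.carrier :=
  (evenModel D hn).homog D.n ⟨evenVar D, evenVar_mem D⟩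

theorem evenGen_mem (hn : Even D.n) : evenGen D hn ∈ (evenModel D hn).toDGRing.deg D.n :=
  (evenModel D hn).elt_mem _ _

theorem val_evenGen (hn : Even D.n) : (evenModel D hn).val (evenGen D hn) = evenVar D :=
  (evenModel D hn).val_homog _ _

theorem monomial_mem_deg {T : DGRing K} {m n : ℤ} {k : ℕ} {a t : T.carrier}
    (ha : a ∈ T.deg (m - k * n)) (ht : t ∈ T.deg n) : a * t ^ k ∈ T.deg m := by
  refine mem_deg_congr ?_ (mul_mem_deg _ ha (SetLike.pow_mem_graded k ht))
  rw [nsmul_eq_mul]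
  ring

theorem val_evenMonomial (hn : Even D.n) {m : ℤ} {a : E.carrier} {k : ℕ} (ha : a ∈ E.deg m)
    (h : D.HasPower k ∨ a = 0) :
    (evenModel D hn).val (Hom.toAlgHom (evenConst D hn) a * evenGen D hn ^ k) = monomial k a := by
  rw [map_mul, map_pow, val_evenConst D hn ha, val_evenGen]
  rcases h with (rfl | ⟨hp, -⟩) | rfl
  · simp
  · rw [evenVar, if_pos hp, C_mul_X_pow_eq_monomial]
  · simp

theorem val_mem_evenDeg (hn : Even D.n) {m : ℤ} {z : (evenModel D hn).toDGRing.carrier}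
    (hz : z ∈ (evenModel D hn).toDGRing.deg m) : (evenModel D hn).val z ∈ evenDeg D m :=
  (evenModel D hn).val_mem hz

theorem val_d_even (hn : Even D.n) {m : ℤ} {z : (evenModel D hn).toDGRing.carrier}
    (hz : z ∈ (evenModel D hn).toDGRing.deg m) :
    (evenModel D hn).val ((evenModel D hn).toDGRing.d z) = evenD D m ((evenModel D hn).val z) :=
  (evenModel D hn).val_d hz

/-- The evaluation of polynomials at a homogeneous element of even degree. -/
noncomputable def evenEval {T : DGRing K} {n : ℤ} (hn : Even n) (φ : E ⟶ T) {t : T.carrier}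
    (ht : t ∈ T.deg n) : E.carrier[X] →ₐ[K] T.carrier :=
  eval₂AlgHom (Hom.toAlgHom φ) t fun _ => commute_of_even hn ht _

/-- The evaluation of polynomials at `t` commutes with the differentials if `dt` is the image of `c`. -/
theorem eval₂_evenD (hn : Even D.n) {T : DGRing K} (φ : E ⟶ T) {t : T.carrier}
    (ht : t ∈ T.deg D.n) (hdt : D.p → T.d t = Hom.toAlgHom φ D.c) {m : ℤ} {f : E.carrier[X]}
    (hf : f ∈ evenDeg D m) :
    evenEval hn φ ht (evenD D m f) =
      T.d (evenEval hn φ ht f) := by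
  have hmon : ∀ (k : ℕ) (a : E.carrier),
      evenEval hn φ ht (monomial k a) =
        Hom.toAlgHom φ a * t ^ k := fun k a => eval₂_monomial _ _
  have hcw : ∀ (k : ℕ) (a : E.carrier), coeffwise E.d (monomial k a) = monomial k (E.d a) := by
    intro k a
    ext i
    rw [coeff_coeffwise, coeff_monomial, coeff_monomial]
    split_ifs <;> simp
  rw [f.as_sum_support, map_sum, map_sum, map_sum, map_sum]
  refine Finset.sum_congr rfl fun k hk => ?_
  have hk0 : f.coeff k ≠ 0 := mem_support_iff.mp hk
  have ha := (hf k).1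
  have hor : k = 0 ∨ D.p := by_contra fun h => hk0 ((hf k).2 h)
  have hφ : Hom.toAlgHom φ (f.coeff k) ∈ T.deg (m - k * D.n) := Hom.map_deg φ _ _ ha
  rw [evenD_apply, hcw, map_add, hmon, hmon, T.leibniz _ _ _ hφ, Hom.map_d φ]
  refine congrArg _ ?_
  have hsm : ∀ (s : ℤˣ) (g : E.carrier[X]),
      evenEval hn φ ht (s • g) =
        s • evenEval hn φ ht g :=
    map_units_smul (evenEval hn φ ht).toLinearMap
  have hsign : (m - k * D.n).negOnePow = m.negOnePow :=
    negOnePow_eq_of_even (by rw [sub_sub_cancel_left]; exact (hn.mul_left _).neg)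
  have hC : evenEval hn φ ht (C D.c) =
      Hom.toAlgHom φ D.c := eval₂_C _ _
  rw [hsm, map_mul, derivative_monomial, hmon, hC, hsign]
  refine congrArg _ ?_
  cases k with
  | zero =>
    simp [d_one]
  | succ k =>
    rw [d_pow_of_even hn ht, hdt (hor.resolve_left k.succ_ne_zero), map_mul, map_natCast]
    push_cast
    simp only [mul_assoc]

/-- The homomorphism out of the cell that sends the generator to `t`. -/
noncomputable def evenDesc (hn : Even D.n) {T : DGRing K} (φ : E ⟶ T) {t : T.carrier}
    (ht : t ∈ T.deg D.n) (hdt : D.p → T.d t = Hom.toAlgHom φ D.c) :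
    (evenModel D hn).toDGRing ⟶ T :=
  (evenModel D hn).desc (fun _ => (evenEval hn φ ht).toLinearMap)
    (fun m f hf => by
      change eval₂ _ _ f ∈ _
      rw [eval₂_eq_sum, Polynomial.sum_def]
      exact sum_mem fun k _ => monomial_mem_deg (Hom.map_deg φ _ _ (hf k).1) ht)
    (map_one (evenEval hn φ ht)) (fun _ _ a b _ _ => map_mul (evenEval hn φ ht) a b)
    (fun _ _ hf => eval₂_evenD D hn φ ht hdt hf)

theorem evenDesc_apply (hn : Even D.n) {T : DGRing K} (φ : E ⟶ T) {t : T.carrier}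
    (ht : t ∈ T.deg D.n) (hdt : D.p → T.d t = Hom.toAlgHom φ D.c) {m : ℤ}
    {z : (evenModel D hn).toDGRing.carrier} (hz : z ∈ (evenModel D hn).toDGRing.deg m) :
    Hom.toAlgHom (evenDesc D hn φ ht hdt) z = evenEval hn φ ht ((evenModel D hn).val z) :=
  (evenModel D hn).desc_apply _ _ _ _ _ hz

/-- The cell with an even generator. -/
noncomputable def evenCell (hn : Even D.n) : Cell D where
  obj := (evenModel D hn).toDGRing
  ι := evenConst D hn
  gen := evenGen D hn
  gen_mem := evenGen_mem D hn
  d_gen hp := by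
    refine (evenModel D hn).val_inj ((evenModel D hn).toDGRing.d_mem _ _ (evenGen_mem D hn))
      (Hom.map_deg (evenConst D hn) _ _ D.c_mem) ?_
    rw [val_d_even D hn (evenGen_mem D hn), val_evenConst D hn D.c_mem, val_evenGen, evenVar,
      if_pos hp]
    ext k
    rw [coeff_evenD, coeff_X, coeff_X, coeff_C, Int.negOnePow_even _ hn]
    rcases k with _ | k
    · simp
    · rw [if_neg k.succ_ne_zero, if_neg (by omega : ¬ 1 = k + 1 + 1)]
      split_ifs <;> simp [d_one]
  gen_eq_zero hp := by
    refine (evenModel D hn).val_inj (evenGen_mem D hn) (zero_mem _) ?_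
    rw [val_evenGen, evenVar, if_neg hp, map_zero]
  coeff k := ((lcoeff E.carrier k).restrictScalars K).comp (evenModel D hn).val.toLinearMap
  coeff_mem k hz := (val_mem_evenDeg D hn hz k).1
  coeff_eq_zero {m z k} hz hk := (val_mem_evenDeg D hn hz k).2 fun h =>
    hk (h.imp_right fun hp => ⟨hp, Or.inl hn⟩)
  exists_bound {m z} _ := ⟨((evenModel D hn).val z).natDegree + 1, fun k hk =>
    coeff_eq_zero_of_natDegree_lt hk⟩
  expand {m z N} hz hN := by
    have hz' := val_mem_evenDeg D hn hz
    refine (evenModel D hn).val_inj hz (sum_mem fun k _ => monomial_mem_deg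
      (Hom.map_deg (evenConst D hn) _ _ (hz' k).1) (evenGen_mem D hn)) ?_
    rw [map_sum]
    refine Eq.trans ?_ (Finset.sum_congr rfl fun k _ => (val_evenMonomial D hn (hz' k).1 ?_).symm)
    · ext i
      rw [finsetSum_coeff]
      simp only [Polynomial.coeff_monomial]
      rw [Finset.sum_ite_eq' _ i fun k => ((evenModel D hn).val z).coeff k]
      split_ifs with h
      · rfl
      · exact hN i (by simpa using h)
    · by_contra hcon
      push Not at hcon
      exact hcon.2 ((hz' k).2 fun h => hcon.1 (h.imp_right fun hp => ⟨hp, Or.inl hn⟩))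
  coeff_monomial {j b k} hb hk i := by
    refine (congrArg (Polynomial.coeff · i) (val_evenMonomial D hn hb (Or.inl hk))).trans ?_
    rw [Polynomial.coeff_monomial]
    simp only [eq_comm]
  coeff_d {m z k} hz h i hi := by
    refine (congrArg (Polynomial.coeff · i) (val_d_even D hn hz)).trans ?_
    rw [coeff_evenD, show ((evenModel D hn).val z).coeff (i + 1) = 0 from h (i + 1) (by omega),
      zero_mul, zero_mul, smul_zero, add_zero]
    rfl
  exists_desc {T} φ t ht hdt ht0 := by
    refine ⟨evenDesc D hn φ ht hdt, ?_, ?_⟩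
    · apply hom_ext_deg
      intro m a ha
      refine (evenDesc_apply D hn φ ht hdt (Hom.map_deg (evenConst D hn) _ _ ha)).trans ?_
      rw [val_evenConst D hn ha]
      exact eval₂_C _ _
    · refine (evenDesc_apply D hn φ ht hdt (evenGen_mem D hn)).trans ?_
      rw [val_evenGen, evenVar]
      split_ifs with hp
      · exact eval₂_X _ _
      · rw [map_zero, ht0 hp]

end EvenCell

end DGRing

/-! ### Odd generators -/

namespace DGRing

variable {K : Type u} [CommRing K] {E : DGRing K} (D : CellData E)

section OddCell

/-- The upper triangular matrix that stands for the element `a + b * gen` of degree `m`, for an odd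
generator. The sign on the diagonal encodes the commutation of the generator with `a`. -/
def oddMat {R : Type u} [Ring R] (m : ℤ) (a b : R) : Matrix (Fin 2) (Fin 2) R :=
  !![a, b; 0, m.negOnePow • a]

theorem oddMat_ext {R : Type u} [Ring R] {m m' : ℤ} (h : m = m') {a a' b b' : R} (ha : a = a')
    (hb : b = b') : oddMat m a b = oddMat m' a' b' := by
  subst h ha hb
  rfl

/-- The multiplication of `a + b * gen` and `a' + b' * gen`: the generator passes `a'` with the sign
`(-1) ^ m'`, and `gen ^ 2 = 0`. -/
theorem oddMat_mul {R : Type u} [Ring R] (m m' : ℤ) (a b a' b' : R) :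
    oddMat m a b * oddMat m' a' b' =
      oddMat (m + m') (a * a') (a * b' + m'.negOnePow • (b * a')) := by
  rw [oddMat, oddMat, oddMat, Matrix.mul_fin_two, Int.negOnePow_add]
  rcases Int.units_eq_one_or m.negOnePow with hs | hs <;>
  rcases Int.units_eq_one_or m'.negOnePow with hs' | hs' <;> rw [hs, hs'] <;> simp

theorem oddMat_add {R : Type u} [Ring R] (m : ℤ) (a b a' b' : R) :
    oddMat m a b + oddMat m a' b' = oddMat m (a + a') (b + b') := by
  ext i j
  fin_cases i <;> fin_cases j <;> simp [oddMat]

theorem oddMat_smul {R : Type u} [Ring R] [Algebra K R] (r : K) (m : ℤ) (a b : R) :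
    r • oddMat m a b = oddMat m (r • a) (r • b) := by
  ext i j
  fin_cases i <;> fin_cases j <;> simp [oddMat]
  exact map_units_smul (LinearMap.lsmul K R r) _ _

theorem oddMat_zero {R : Type u} [Ring R] (m : ℤ) : oddMat m (0 : R) 0 = 0 := by
  ext i j
  fin_cases i <;> fin_cases j <;> simp [oddMat]

theorem units_smul_oddMat {R : Type u} [Ring R] (s : ℤˣ) (m : ℤ) (a b : R) :
    s • oddMat m a b = oddMat m (s • a) (s • b) := by
  ext i j
  fin_cases i <;> fin_cases j <;> simp [oddMat, smul_comm s]

/-- The homogeneous elements `a + b * gen` of degree `m`. -/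
def oddDeg (m : ℤ) : Submodule K (Matrix (Fin 2) (Fin 2) E.carrier) where
  carrier := {M | ∃ a ∈ E.deg m, ∃ b ∈ E.deg (m - D.n), (¬ D.p → b = 0) ∧ M = oddMat m a b}
  zero_mem' := ⟨0, zero_mem _, 0, zero_mem _, fun _ => rfl, (oddMat_zero m).symm⟩
  add_mem' := by
    rintro _ _ ⟨a, ha, b, hb, hp, rfl⟩ ⟨a', ha', b', hb', hp', rfl⟩
    exact ⟨_, add_mem ha ha', _, add_mem hb hb', fun h => by rw [hp h, hp' h, add_zero],
      oddMat_add _ _ _ _ _⟩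
  smul_mem' := by
    rintro r _ ⟨a, ha, b, hb, hp, rfl⟩
    exact ⟨_, Submodule.smul_mem _ r ha, _, Submodule.smul_mem _ r hb,
      fun h => by rw [hp h, smul_zero], oddMat_smul _ _ _ _⟩

/-- The differential of an element `a + b * gen` of degree `m`, for an odd generator. -/
def oddD (m : ℤ) : Matrix (Fin 2) (Fin 2) E.carrier →ₗ[K] Matrix (Fin 2) (Fin 2) E.carrier where
  toFun M := oddMat (m + 1) (E.d (M 0 0) - m.negOnePow • (M 0 1 * D.c)) (E.d (M 0 1))
  map_add' M N := by
    rw [oddMat_add]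
    refine oddMat_ext rfl ?_ (map_add E.d _ _)
    rw [Matrix.add_apply, Matrix.add_apply, map_add, add_mul, smul_add]
    abel
  map_smul' r M := by
    rw [RingHom.id_apply, oddMat_smul]
    refine oddMat_ext rfl ?_ (map_smul E.d _ _)
    rw [Matrix.smul_apply, Matrix.smul_apply, map_smul, smul_mul_assoc, smul_sub]
    exact congrArg _ (map_units_smul (LinearMap.lsmul K E.carrier r) _ _).symm

theorem oddD_oddMat (m : ℤ) (a b : E.carrier) :
    oddD D m (oddMat m a b) = oddMat (m + 1) (E.d a - m.negOnePow • (b * D.c)) (E.d b) := rfl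

variable {D}

theorem sub_odd_negOnePow {n : ℤ} (hn : Odd n) (m : ℤ) : (m - n).negOnePow = - m.negOnePow := by
  rw [Int.negOnePow_sub, Int.negOnePow_odd n hn, mul_neg, mul_one]

theorem c_comm (hn : Odd D.n) (a : E.carrier) : a * D.c = D.c * a :=
  (commute_of_even hn.add_one D.c_mem a).eq

variable (D)

/-- The graded model of polynomials in an odd variable. -/
def oddModel (hn : Odd D.n) : GradedModel K (Matrix (Fin 2) (Fin 2) E.carrier) where
  D := oddDeg D
  one_mem := ⟨1, one_mem_deg E, 0, zero_mem _, fun _ => rfl, by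
    ext i j
    fin_cases i <;> fin_cases j <;> simp [oddMat]⟩
  mul_mem := by
    rintro m m' _ _ ⟨a, ha, b, hb, hp, rfl⟩ ⟨a', ha', b', hb', hp', rfl⟩
    exact ⟨_, mul_mem_deg _ ha ha', _, add_mem (mem_deg_congr (by ring) (mul_mem_deg _ ha hb'))
      (units_smul_mem_deg _ _ (mem_deg_congr (by ring) (mul_mem_deg _ hb ha'))),
      fun h => by rw [hp h, hp' h, mul_zero, zero_mul, smul_zero, add_zero], oddMat_mul _ _ _ _ _ _⟩
  eq_zero := by
    rintro m _ hm ⟨a, ha, b, hb, -, rfl⟩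
    rw [eq_zero_of_pos E hm ha, eq_zero_of_pos E (by have := D.hn; omega) hb, oddMat_zero]
  mul_comm' := by
    rintro m m' _ _ ⟨a, ha, b, hb, -, rfl⟩ ⟨a', ha', b', hb', -, rfl⟩
    rw [oddMat_mul, oddMat_mul, units_smul_oddMat]
    refine oddMat_ext (add_comm _ _) (E.mul_comm' _ _ _ _ ha ha') ?_
    rw [E.mul_comm' _ _ _ _ hb ha', E.mul_comm' _ _ _ _ ha hb', sub_mul, mul_sub,
      Int.negOnePow_sub, Int.negOnePow_sub, smul_add, smul_smul, smul_smul, add_comm]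
    have h1 : (D.n * m').negOnePow = m'.negOnePow := negOnePow_eq_of_even (by
      rw [show D.n * m' - m' = (D.n - 1) * m' by ring]
      exact (hn.sub_odd odd_one).mul_right _)
    have h2 : (m * D.n).negOnePow = m.negOnePow := negOnePow_eq_of_even (by
      rw [show m * D.n - m = m * (D.n - 1) by ring]
      exact (hn.sub_odd odd_one).mul_left _)
    rw [h1, h2, mul_comm m.negOnePow, mul_assoc, ← Int.negOnePow_add,
      Int.negOnePow_even _ (Even.add_self m), mul_one]
  mul_self' := by
    rintro m _ hm ⟨a, ha, b, hb, -, rfl⟩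
    rw [oddMat_mul, E.mul_self' _ _ hm ha, Int.negOnePow_odd m hm,
      (commute_of_even (hm.sub_odd hn) hb a).eq, Units.neg_smul, one_smul, add_neg_cancel,
      oddMat_zero]
  d := oddD D
  d_mem := by
    rintro m _ ⟨a, ha, b, hb, hp, rfl⟩
    exact ⟨_, sub_mem (E.d_mem _ _ ha) (units_smul_mem_deg _ _
      (mem_deg_congr (by ring) (mul_mem_deg _ hb D.c_mem))), _,
      mem_deg_congr (by ring) (E.d_mem _ _ hb), fun h => by rw [hp h, map_zero],
      oddD_oddMat D _ _ _⟩
  d_d := by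
    rintro m _ ⟨a, ha, b, hb, hp, rfl⟩
    have h1 : E.d (m.negOnePow • (b * D.c)) = m.negOnePow • (E.d b * D.c) := by
      refine (map_units_smul E.d _ _).trans ?_
      rw [E.leibniz _ _ _ hb, D.d_c, mul_zero, smul_zero, add_zero]
    rw [oddD_oddMat, oddD_oddMat, map_sub, E.d_d, E.d_d, h1, Int.negOnePow_succ, Units.neg_smul,
      zero_sub, sub_neg_eq_add, neg_add_cancel, oddMat_zero]
  leibniz := by
    rintro m m' _ _ ⟨a, ha, b, hb, -, rfl⟩ ⟨a', ha', b', hb', -, rfl⟩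
    have h1 : E.d (m'.negOnePow • (b * a')) = m'.negOnePow • E.d (b * a') := map_units_smul _ _ _
    rw [oddMat_mul, oddD_oddMat, oddD_oddMat, oddD_oddMat, oddMat_mul, oddMat_mul,
      oddMat_ext (add_right_comm m 1 m') rfl rfl, oddMat_ext (add_assoc m m' 1).symm rfl rfl,
      units_smul_oddMat, oddMat_add, map_add, h1, E.leibniz _ _ _ ha, E.leibniz _ _ _ hb,
      E.leibniz _ _ _ ha, sub_odd_negOnePow hn, Int.negOnePow_succ, Int.negOnePow_add]
    have h2 : a' * D.c = D.c * a' := c_comm hn a'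
    have h3 : b' * D.c = D.c * b' := c_comm hn b'
    refine oddMat_ext rfl ?_ ?_
    · rcases Int.units_eq_one_or m.negOnePow with hs | hs <;>
      rcases Int.units_eq_one_or m'.negOnePow with hs' | hs' <;> rw [hs, hs'] <;>
      simp only [one_smul, Units.neg_smul, mul_one, mul_neg, neg_neg, add_mul, sub_mul, mul_sub,
        neg_mul, mul_assoc, h2] <;> abel
    · rcases Int.units_eq_one_or m.negOnePow with hs | hs <;>
      rcases Int.units_eq_one_or m'.negOnePow with hs' | hs' <;> rw [hs, hs'] <;>
      simp only [one_smul, Units.neg_smul, mul_neg, neg_neg, sub_mul, mul_sub, neg_mul, mul_assoc,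
        h3, smul_neg, smul_add] <;> abel

/-- The inclusion of constants. -/
noncomputable def oddConst (hn : Odd D.n) : E ⟶ (oddModel D hn).toDGRing :=
  (oddModel D hn).lift
    (fun m =>
      { toFun := fun a => oddMat m a 0
        map_add' := fun a b => by rw [oddMat_add, add_zero]
        map_smul' := fun r a => by rw [RingHom.id_apply, oddMat_smul, smul_zero] })
    (fun m a ha => ⟨a, ha, 0, zero_mem _, fun _ => rfl, rfl⟩)
    (by
      ext i j
      fin_cases i <;> fin_cases j <;> simp [oddMat])
    (fun m m' a b _ _ => by
      refine Eq.trans ?_ (oddMat_mul m m' a 0 b 0).symm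
      exact oddMat_ext rfl rfl (by rw [mul_zero, zero_mul, smul_zero, add_zero]))
    (fun m a _ => by
      refine Eq.trans ?_ (oddD_oddMat D m a 0).symm
      exact oddMat_ext rfl (by rw [zero_mul, smul_zero, sub_zero]) (map_zero _).symm)

theorem val_oddConst (hn : Odd D.n) {m : ℤ} {a : E.carrier} (ha : a ∈ E.deg m) :
    (oddModel D hn).val (Hom.toAlgHom (oddConst D hn) a) = oddMat m a 0 :=
  (oddModel D hn).val_lift _ _ _ _ _ ha

open Classical in
theorem oddVar_mem : oddMat D.n (0 : E.carrier) (if D.p then 1 else 0) ∈ oddDeg D D.n := by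
  refine ⟨0, zero_mem _, _, ?_, fun h => if_neg h, rfl⟩
  split_ifs
  · exact mem_deg_congr (by simp) (one_mem_deg E)
  · exact zero_mem _

/-- The homogeneous element given by the variable if it is present, and zero otherwise. -/
noncomputable def oddGen (hn : Odd D.n) : (oddModel D hn).toDGRing.carrier :=
  (oddModel D hn).homog D.n ⟨_, oddVar_mem D⟩

theorem oddGen_mem (hn : Odd D.n) : oddGen D hn ∈ (oddModel D hn).toDGRing.deg D.n :=
  (oddModel D hn).elt_mem _ _

open Classical in
theorem val_oddGen (hn : Odd D.n) :
    (oddModel D hn).val (oddGen D hn) = oddMat D.n (0 : E.carrier) (if D.p then 1 else 0) :=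
  (oddModel D hn).val_homog _ _

theorem oddGen_pow (hn : Odd D.n) (k : ℕ) : oddGen D hn ^ (k + 2) = 0 := by
  rw [pow_add, pow_two, (oddModel D hn).toDGRing.mul_self' _ _ hn (oddGen_mem D hn), mul_zero]

open Classical in
theorem val_oddConst_mul_gen (hn : Odd D.n) {m : ℤ} {b : E.carrier} (hb : b ∈ E.deg m) :
    (oddModel D hn).val (Hom.toAlgHom (oddConst D hn) b * oddGen D hn) =
      oddMat (m + D.n) 0 (if D.p then b else 0) := by
  rw [map_mul, val_oddConst D hn hb, val_oddGen, oddMat_mul]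
  refine oddMat_ext rfl (mul_zero _) ?_
  split_ifs <;> simp

/-- The coefficient of `gen ^ k` in an element of the cell with an odd generator. -/
def oddCoeff : ℕ → Matrix (Fin 2) (Fin 2) E.carrier →ₗ[K] E.carrier
  | 0 => { toFun := fun M => M 0 0, map_add' := fun _ _ => rfl, map_smul' := fun _ _ => rfl }
  | 1 => { toFun := fun M => M 0 1, map_add' := fun _ _ => rfl, map_smul' := fun _ _ => rfl }
  | _ + 2 => 0

theorem oddCoeff_zero (m : ℤ) (a b : E.carrier) : oddCoeff 0 (oddMat m a b) = a := rfl

theorem val_mem_oddDeg (hn : Odd D.n) {m : ℤ} {z : (oddModel D hn).toDGRing.carrier}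
    (hz : z ∈ (oddModel D hn).toDGRing.deg m) : (oddModel D hn).val z ∈ oddDeg D m :=
  (oddModel D hn).val_mem hz

theorem val_d_odd (hn : Odd D.n) {m : ℤ} {z : (oddModel D hn).toDGRing.carrier}
    (hz : z ∈ (oddModel D hn).toDGRing.deg m) :
    (oddModel D hn).val ((oddModel D hn).toDGRing.d z) = oddD D m ((oddModel D hn).val z) :=
  (oddModel D hn).val_d hz

/-- The evaluation of polynomials at a homogeneous element of odd degree. -/
def oddEval {T : DGRing K} (φ : E ⟶ T) (t : T.carrier) :
    Matrix (Fin 2) (Fin 2) E.carrier →ₗ[K] T.carrier where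
  toFun M := Hom.toAlgHom φ (M 0 0) + Hom.toAlgHom φ (M 0 1) * t
  map_add' M N := by
    rw [Matrix.add_apply, Matrix.add_apply, map_add, map_add, add_mul]
    abel
  map_smul' r M := by
    rw [Matrix.smul_apply, Matrix.smul_apply, map_smul, map_smul, smul_mul_assoc, ← smul_add]
    rfl

theorem oddEval_oddMat {T : DGRing K} (φ : E ⟶ T) (t : T.carrier) (m : ℤ) (a b : E.carrier) :
    oddEval φ t (oddMat m a b) = Hom.toAlgHom φ a + Hom.toAlgHom φ b * t := rfl

/-- The homomorphism out of the cell that sends the generator to `t`. -/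
noncomputable def oddDesc (hn : Odd D.n) {T : DGRing K} (φ : E ⟶ T) {t : T.carrier}
    (ht : t ∈ T.deg D.n) (hdt : D.p → T.d t = Hom.toAlgHom φ D.c) :
    (oddModel D hn).toDGRing ⟶ T :=
  (oddModel D hn).desc (fun _ => oddEval φ t)
    (by
      rintro m _ ⟨a, ha, b, hb, -, rfl⟩
      rw [oddEval_oddMat]
      exact add_mem (Hom.map_deg φ _ _ ha)
        (mem_deg_congr (by ring) (mul_mem_deg _ (Hom.map_deg φ _ _ hb) ht)))
    (by
      change Hom.toAlgHom φ 1 + Hom.toAlgHom φ 0 * t = 1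
      rw [map_one, map_zero, zero_mul, add_zero])
    (by
      rintro m m' _ _ ⟨a, ha, b, hb, -, rfl⟩ ⟨a', ha', b', hb', -, rfl⟩
      have hs : ∀ (s : ℤˣ) (e : E.carrier), Hom.toAlgHom φ (s • e) = s • Hom.toAlgHom φ e :=
        map_units_smul (Hom.toAlgHom φ).toLinearMap
      have h1 : t * Hom.toAlgHom φ a' = m'.negOnePow • (Hom.toAlgHom φ a' * t) := by
        rw [T.mul_comm' _ _ _ _ (Hom.map_deg φ _ _ ha') ht]
        congr 1
        apply negOnePow_eq_of_even
        rw [show m' * D.n - m' = m' * (D.n - 1) by ring]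
        exact (hn.sub_odd odd_one).mul_left _
      have h2 : t * (Hom.toAlgHom φ b' * t) = 0 := by
        rw [← mul_assoc, T.mul_comm' _ _ _ _ (Hom.map_deg φ _ _ hb') ht, smul_mul_assoc, mul_assoc,
          T.mul_self' _ _ hn ht, mul_zero, smul_zero]
      rw [oddMat_mul, oddEval_oddMat, oddEval_oddMat, oddEval_oddMat, map_add, hs]
      simp only [map_mul, add_mul, mul_add, mul_assoc, h1, h2, mul_zero, add_zero, smul_mul_assoc,
        mul_smul_comm]
      abel)
    (by
      rintro m _ ⟨a, ha, b, hb, hp, rfl⟩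
      have hs : ∀ (s : ℤˣ) (e : E.carrier), Hom.toAlgHom φ (s • e) = s • Hom.toAlgHom φ e :=
        map_units_smul (Hom.toAlgHom φ).toLinearMap
      change oddEval φ t (oddD D m (oddMat m a b)) = _
      rw [oddD_oddMat, oddEval_oddMat, oddEval_oddMat, map_sub, hs, map_mul, map_add,
        T.leibniz _ _ _ (Hom.map_deg φ _ _ hb), Hom.map_d, Hom.map_d, sub_odd_negOnePow hn]
      by_cases h : D.p
      · rw [hdt h, Units.neg_smul]
        abel
      · rw [hp h, map_zero]
        simp)

theorem oddDesc_apply (hn : Odd D.n) {T : DGRing K} (φ : E ⟶ T) {t : T.carrier}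
    (ht : t ∈ T.deg D.n) (hdt : D.p → T.d t = Hom.toAlgHom φ D.c) {m : ℤ}
    {z : (oddModel D hn).toDGRing.carrier} (hz : z ∈ (oddModel D hn).toDGRing.deg m) :
    Hom.toAlgHom (oddDesc D hn φ ht hdt) z = oddEval φ t ((oddModel D hn).val z) :=
  (oddModel D hn).desc_apply _ _ _ _ _ hz

theorem exists_val_eq_oddMat (hn : Odd D.n) {m : ℤ} {z : (oddModel D hn).toDGRing.carrier}
    (hz : z ∈ (oddModel D hn).toDGRing.deg m) :
    ∃ a ∈ E.deg m, ∃ b ∈ E.deg (m - D.n), (¬ D.p → b = 0) ∧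
      (oddModel D hn).val z = oddMat m a b := val_mem_oddDeg D hn hz

/-- The cell with an odd generator. -/
noncomputable def oddCell (hn : Odd D.n) : Cell D where
  obj := (oddModel D hn).toDGRing
  ι := oddConst D hn
  gen := oddGen D hn
  gen_mem := oddGen_mem D hn
  d_gen hp := by
    refine (oddModel D hn).val_inj ((oddModel D hn).toDGRing.d_mem _ _ (oddGen_mem D hn))
      (Hom.map_deg (oddConst D hn) _ _ D.c_mem) ?_
    rw [val_d_odd D hn (oddGen_mem D hn), val_oddConst D hn D.c_mem, val_oddGen, oddD_oddMat,
      if_pos hp, Int.negOnePow_odd _ hn]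
    exact oddMat_ext rfl (by simp) (d_one E)
  gen_eq_zero hp := by
    refine (oddModel D hn).val_inj (oddGen_mem D hn) (zero_mem _) ?_
    rw [val_oddGen, if_neg hp, map_zero, oddMat_zero]
  coeff k := (oddCoeff k).comp (oddModel D hn).val.toLinearMap
  coeff_mem {m z} k hz := by
    obtain ⟨a, ha, b, hb, -, e⟩ := exists_val_eq_oddMat D hn hz
    refine Set.mem_of_eq_of_mem (congrArg (oddCoeff k) e) ?_
    rcases k with _ | _ | k
    · exact mem_deg_congr (by simp) ha
    · exact mem_deg_congr (by simp) hb
    · exact zero_mem _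
  coeff_eq_zero {m z k} hz hk := by
    obtain ⟨a, ha, b, hb, hp, e⟩ := exists_val_eq_oddMat D hn hz
    refine (congrArg (oddCoeff k) e).trans ?_
    rcases k with _ | _ | k
    · exact (hk (Or.inl rfl)).elim
    · exact hp fun h => hk (Or.inr ⟨h, Or.inr rfl⟩)
    · rfl
  exists_bound {m z} _ := ⟨2, fun k hk => by
    obtain ⟨k, rfl⟩ := Nat.exists_eq_add_of_le' hk
    rfl⟩
  expand {m z N} hz hN := by
    obtain ⟨a, ha, b, hb, hp, e⟩ := exists_val_eq_oddMat D hn hz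
    have h0 : oddCoeff 0 ((oddModel D hn).val z) = a := congrArg (oddCoeff 0) e
    have h1 : oddCoeff 1 ((oddModel D hn).val z) = b := congrArg (oddCoeff 1) e
    have hsum : ∑ k ∈ Finset.range N, Hom.toAlgHom (oddConst D hn)
        (oddCoeff k ((oddModel D hn).val z)) * oddGen D hn ^ k =
        ∑ k ∈ Finset.range (N + 2), Hom.toAlgHom (oddConst D hn)
        (oddCoeff k ((oddModel D hn).val z)) * oddGen D hn ^ k := by
      refine Finset.sum_subset (Finset.range_mono (by omega)) fun k _ hk => ?_
      rw [show oddCoeff k ((oddModel D hn).val z) = 0 from hN k (by simpa using hk), map_zero,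
        zero_mul]
    refine Eq.trans ?_ hsum.symm
    rw [Finset.sum_range_succ', Finset.sum_range_succ', Finset.sum_eq_zero fun k _ => by
      rw [oddGen_pow, mul_zero], zero_add, h0, zero_add, h1, pow_zero, mul_one, pow_one]
    refine (oddModel D hn).val_inj hz (add_mem (mem_deg_congr (by ring) (mul_mem_deg _
      (Hom.map_deg (oddConst D hn) _ _ hb) (oddGen_mem D hn)))
      (Hom.map_deg (oddConst D hn) _ _ ha)) ?_
    rw [e, map_add, val_oddConst_mul_gen D hn hb, val_oddConst D hn ha, sub_add_cancel, oddMat_add]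
    refine oddMat_ext rfl (zero_add _).symm ?_
    split_ifs with h
    · rw [add_zero]
    · rw [hp h, add_zero]
  coeff_monomial {j b k} hb hk i := by
    rcases hk with rfl | ⟨hp, hk⟩
    · refine (congrArg (fun z => oddCoeff i ((oddModel D hn).val z)) ?_ :
        oddCoeff i ((oddModel D hn).val _) = oddCoeff i ((oddModel D hn).val
          (Hom.toAlgHom (oddConst D hn) b))).trans ?_
      · rw [pow_zero, mul_one]
      · rw [val_oddConst D hn hb]
        rcases i with _ | _ | i <;> rfl
    · obtain rfl := hk.resolve_left (Int.not_even_iff_odd.mpr hn)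
      refine (congrArg (fun z => oddCoeff i ((oddModel D hn).val z)) ?_ :
        oddCoeff i ((oddModel D hn).val _) = oddCoeff i ((oddModel D hn).val
          (Hom.toAlgHom (oddConst D hn) b * oddGen D hn))).trans ?_
      · rw [pow_one]
      · rw [val_oddConst_mul_gen D hn hb, if_pos hp]
        rcases i with _ | _ | i <;> rfl
  coeff_d {m z k} hz h i hi := by
    refine (congrArg (oddCoeff i) (val_d_odd D hn hz)).trans ?_
    obtain ⟨a, ha, b, hb, -, e⟩ := exists_val_eq_oddMat D hn hz
    change _ = E.d (oddCoeff i ((oddModel D hn).val z))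
    rw [e, oddD_oddMat]
    rcases i with _ | _ | i
    · have hb0 : b = 0 := (congrArg (oddCoeff 1) e).symm.trans (h 1 (by omega))
      rw [oddCoeff_zero, oddCoeff_zero, hb0, zero_mul, smul_zero, sub_zero]
    · rfl
    · exact (map_zero _).symm
  exists_desc {T} φ t ht hdt ht0 := by
    refine ⟨oddDesc D hn φ ht hdt, ?_, ?_⟩
    · apply hom_ext_deg
      intro m a ha
      refine (oddDesc_apply D hn φ ht hdt (Hom.map_deg (oddConst D hn) _ _ ha)).trans ?_
      rw [val_oddConst D hn ha, oddEval_oddMat, map_zero, zero_mul, add_zero]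
    · refine (oddDesc_apply D hn φ ht hdt (oddGen_mem D hn)).trans ?_
      rw [val_oddGen, oddEval_oddMat, map_zero, zero_add]
      split_ifs with hp
      · rw [map_one, one_mul]
      · rw [map_zero, zero_mul, ht0 hp]

end OddCell

open Classical in
/-- The cell given by a cell datum. -/
noncomputable def cell (D : CellData E) : Cell D :=
  if hn : Even D.n then evenCell D hn else oddCell D (Int.not_even_iff_odd.mp hn)

end DGRing

/-! ### Attaching a cell to a presheaf -/

/-- A square is a pushout if morphisms out of its corner exist and are unique. -/
theorem isPushout_of_exists {C : Type*} [Category C] {W X Y Z : C} {f : W ⟶ X} {g : W ⟶ Y}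
    {h : X ⟶ Z} {i : Y ⟶ Z} (w : f ≫ h = g ≫ i)
    (exists_desc : ∀ {T : C} (a : X ⟶ T) (b : Y ⟶ T), f ≫ a = g ≫ b → ∃ c, h ≫ c = a ∧ i ≫ c = b)
    (hom_ext : ∀ {T : C} (c c' : Z ⟶ T), h ≫ c = h ≫ c' → i ≫ c = i ≫ c' → c = c') :
    IsPushout f g h i := by
  choose desc h1 h2 using fun (s : PushoutCocone f g) => exists_desc s.inl s.inr s.condition
  exact ⟨⟨w⟩, ⟨PushoutCocone.IsColimit.mk w desc h1 h2 fun s m hm1 hm2 =>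
    hom_ext _ _ (hm1.trans (h1 s).symm) (hm2.trans (h2 s).symm)⟩⟩

namespace DGRing

variable {K : Type u} [CommRing K]

namespace Cell

variable {E : DGRing K} {D : CellData E} (C : Cell D)

theorem hom_ext {T : DGRing K} {f g : C.obj ⟶ T} (h : C.ι ≫ f = C.ι ≫ g)
    (hgen : Hom.toAlgHom f C.gen = Hom.toAlgHom g C.gen) : f = g := by
  apply hom_ext_deg
  intro m z hz
  obtain ⟨N, hN⟩ := C.exists_bound hz
  rw [C.expand hz hN, map_sum, map_sum]
  refine Finset.sum_congr rfl fun k _ => ?_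
  rw [map_mul, map_mul, map_pow, map_pow, hgen]
  exact congrArg (· * _) (congrArg (fun φ => Hom.toAlgHom φ (C.coeff k z)) h)

theorem eq_zero_of_coeff {m : ℤ} {z : C.obj.carrier} (hz : z ∈ C.obj.deg m)
    (h : ∀ k, C.coeff k z = 0) : z = 0 := by
  rw [C.expand hz (N := 0) fun k _ => h k, Finset.range_zero, Finset.sum_empty]

/-- A homomorphism of cells that maps the generator to the generator acts on the coefficients. -/
theorem coeff_map {E' : DGRing K} {D' : CellData E'} (C' : Cell D') {φ : E ⟶ E'}
    {ψ : C.obj ⟶ C'.obj} (hn : D'.n = D.n) (hp : D.p → D'.p) (hι : C.ι ≫ ψ = φ ≫ C'.ι)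
    (hgen : D.p → Hom.toAlgHom ψ C.gen = C'.gen) {m : ℤ} {z : C.obj.carrier}
    (hz : z ∈ C.obj.deg m) (i : ℕ) :
    C'.coeff i (Hom.toAlgHom ψ z) = Hom.toAlgHom φ (C.coeff i z) := by
  obtain ⟨N, hN⟩ := C.exists_bound hz
  have hterm : ∀ k, C'.coeff i (Hom.toAlgHom ψ (Hom.toAlgHom C.ι (C.coeff k z) * C.gen ^ k)) =
      if i = k then Hom.toAlgHom φ (C.coeff k z) else 0 := by
    intro k
    have h1 : Hom.toAlgHom ψ (Hom.toAlgHom C.ι (C.coeff k z)) =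
        Hom.toAlgHom C'.ι (Hom.toAlgHom φ (C.coeff k z)) :=
      congrArg (fun f => Hom.toAlgHom f (C.coeff k z)) hι
    rw [map_mul, map_pow, h1]
    by_cases hk : D.HasPower k
    · have hk' : D'.HasPower k := by
        rcases hk with hk | ⟨h, hk⟩
        · exact Or.inl hk
        · exact Or.inr ⟨hp h, by rwa [hn]⟩
      rw [← C'.coeff_monomial (Hom.map_deg φ _ _ (C.coeff_mem k hz)) hk' i]
      rcases hk with rfl | ⟨h, -⟩
      · rw [pow_zero, pow_zero]
      · rw [hgen h]
    · rw [C.coeff_eq_zero hz hk, map_zero, map_zero, zero_mul, map_zero, ite_self]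
  conv_lhs => rw [C.expand hz hN]
  rw [map_sum, map_sum, Finset.sum_congr rfl fun k _ => hterm k, Finset.sum_ite_eq]
  split_ifs with h
  · rfl
  · rw [hN i (by simpa using h), map_zero]

end Cell

variable {X : TopCat.{u}}

/-- The data for attaching to a presheaf `Q` a free generator of degree `n` over the open set `U`,
with differential `c`. -/
structure PresheafCellData (Q : TopCat.Presheaf (DGRing.{u} K) X) where
  U : Opens X
  n : ℤ
  c : (sec Q U).carrier
  hn : n ≤ 0
  c_mem : c ∈ (sec Q U).deg (n + 1)
  d_c : (sec Q U).d c = 0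

namespace PresheafCellData

variable {Q Q' : TopCat.Presheaf (DGRing.{u} K) X} (D : PresheafCellData Q)

open Classical in
/-- The cell that is attached to the sections over `V`: its generator is present if `V ≤ U`. -/
noncomputable def onOpen (V : Opens X) : CellData (sec Q V) where
  n := D.n
  c := if h : V ≤ D.U then res Q h D.c else 0
  p := V ≤ D.U
  hn := D.hn
  c_mem := by
    split_ifs with h
    · exact res_mem Q h D.c_mem
    · exact zero_mem _
  d_c := by
    split_ifs with h
    · rw [← res_d, D.d_c, map_zero]
    · exact map_zero _

theorem onOpen_c {V : Opens X} (h : V ≤ D.U) : (D.onOpen V).c = res Q h D.c := dif_pos h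

theorem exists_restrict {V W : Opens X} (h : W ≤ V) :
    ∃ ψ : (cell (D.onOpen V)).obj ⟶ (cell (D.onOpen W)).obj,
      (cell (D.onOpen V)).ι ≫ ψ = Q.map (homOfLE h).op ≫ (cell (D.onOpen W)).ι ∧
      (V ≤ D.U → Hom.toAlgHom ψ (cell (D.onOpen V)).gen = (cell (D.onOpen W)).gen) := by
  by_cases hV : V ≤ D.U
  · obtain ⟨ψ, h1, h2⟩ := (cell (D.onOpen V)).exists_desc
      (Q.map (homOfLE h).op ≫ (cell (D.onOpen W)).ι) (cell (D.onOpen W)).gen_mem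
      (fun _ => by
        rw [(cell (D.onOpen W)).d_gen (h.trans hV), onOpen_c D hV, onOpen_c D (h.trans hV),
          ← res_res Q hV h]
        rfl)
      (fun h' => (h' hV).elim)
    exact ⟨ψ, h1, fun _ => h2⟩
  · obtain ⟨ψ, h1, -⟩ := (cell (D.onOpen V)).exists_desc
      (Q.map (homOfLE h).op ≫ (cell (D.onOpen W)).ι) (zero_mem _) (fun h' => (hV h').elim)
      (fun _ => rfl)
    exact ⟨ψ, h1, fun h' => (hV h').elim⟩

/-- The restriction maps of the presheaf with the cell attached. -/
noncomputable def restrict {V W : Opens X} (h : W ≤ V) :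
    (cell (D.onOpen V)).obj ⟶ (cell (D.onOpen W)).obj := (D.exists_restrict h).choose

theorem ι_restrict {V W : Opens X} (h : W ≤ V) :
    (cell (D.onOpen V)).ι ≫ D.restrict h = Q.map (homOfLE h).op ≫ (cell (D.onOpen W)).ι :=
  (D.exists_restrict h).choose_spec.1

theorem restrict_gen {V W : Opens X} (h : W ≤ V) (hV : V ≤ D.U) :
    Hom.toAlgHom (D.restrict h) (cell (D.onOpen V)).gen = (cell (D.onOpen W)).gen :=
  (D.exists_restrict h).choose_spec.2 hV

/-- Morphisms out of the cell over `V` agree if they agree on `Q` and on the generator, if it is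
present. -/
theorem onOpen_hom_ext {V : Opens X} {T : DGRing K} {f g : (cell (D.onOpen V)).obj ⟶ T}
    (h : (cell (D.onOpen V)).ι ≫ f = (cell (D.onOpen V)).ι ≫ g)
    (hgen : V ≤ D.U → Hom.toAlgHom f (cell (D.onOpen V)).gen =
      Hom.toAlgHom g (cell (D.onOpen V)).gen) : f = g := by
  refine (cell (D.onOpen V)).hom_ext h ?_
  by_cases hV : V ≤ D.U
  · exact hgen hV
  · rw [(cell (D.onOpen V)).gen_eq_zero hV, map_zero, map_zero]

/-- The presheaf obtained from `Q` by attaching a cell. -/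
noncomputable def attach : TopCat.Presheaf (DGRing.{u} K) X where
  obj V := (cell (D.onOpen V.unop)).obj
  map f := D.restrict (leOfHom f.unop)
  map_id V := by
    refine D.onOpen_hom_ext ?_ fun hV => D.restrict_gen _ hV
    rw [ι_restrict, Category.comp_id]
    exact (congrArg (· ≫ _) (Q.map_id V)).trans (Category.id_comp _)
  map_comp {V W Z} f g := by
    refine D.onOpen_hom_ext ?_ fun hV => ?_
    · rw [ι_restrict, ← Category.assoc, ι_restrict, Category.assoc, ι_restrict, ← Category.assoc,
        ← Q.map_comp]
      rfl
    · refine (D.restrict_gen _ hV).trans ?_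
      refine ((congrArg _ (D.restrict_gen _ hV)).trans (D.restrict_gen _ ?_)).symm
      exact (leOfHom f.unop).trans hV

/-- The inclusion of `Q`. -/
noncomputable def incl : Q ⟶ D.attach where
  app V := (cell (D.onOpen V.unop)).ι
  naturality _ _ f := (D.ι_restrict (leOfHom f.unop)).symm

/-- The generator over `V`. -/
noncomputable def gen (V : Opens X) : (sec D.attach V).carrier := (cell (D.onOpen V)).gen

theorem gen_mem (V : Opens X) : D.gen V ∈ (sec D.attach V).deg D.n := (cell (D.onOpen V)).gen_mem

theorem res_gen {V W : Opens X} (h : W ≤ V) (hV : V ≤ D.U) :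
    res D.attach h (D.gen V) = D.gen W := D.restrict_gen h hV

theorem d_gen : (sec D.attach D.U).d (D.gen D.U) = ap D.incl D.U D.c := by
  refine ((cell (D.onOpen D.U)).d_gen le_rfl).trans ?_
  rw [D.onOpen_c le_rfl, res_self]
  rfl

theorem hom_ext {T : TopCat.Presheaf (DGRing.{u} K) X} {f g : D.attach ⟶ T}
    (h : D.incl ≫ f = D.incl ≫ g) (hgen : ap f D.U (D.gen D.U) = ap g D.U (D.gen D.U)) :
    f = g := by
  apply NatTrans.ext
  funext V
  refine D.onOpen_hom_ext (congrArg (fun φ => NatTrans.app φ V) h) fun hV => ?_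
  change ap f V.unop (D.gen V.unop) = ap g V.unop (D.gen V.unop)
  rw [← D.res_gen hV le_rfl, ap_res, ap_res, hgen]

theorem exists_descApp {T : TopCat.Presheaf (DGRing.{u} K) X} (φ : Q ⟶ T) {t : (sec T D.U).carrier}
    (ht : t ∈ (sec T D.U).deg D.n) (hdt : (sec T D.U).d t = ap φ D.U D.c) (V : Opens X) :
    ∃ ψ : (cell (D.onOpen V)).obj ⟶ sec T V, (cell (D.onOpen V)).ι ≫ ψ = φ.app (op V) ∧
      ∀ h : V ≤ D.U, Hom.toAlgHom ψ (cell (D.onOpen V)).gen = res T h t := by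
  by_cases hV : V ≤ D.U
  · obtain ⟨ψ, h1, h2⟩ := (cell (D.onOpen V)).exists_desc (φ.app (op V)) (res_mem T hV ht)
      (fun _ => by
        rw [onOpen_c D hV, ← res_d, hdt]
        exact (ap_res φ hV D.c).symm)
      (fun h' => (h' hV).elim)
    exact ⟨ψ, h1, fun _ => h2⟩
  · obtain ⟨ψ, h1, -⟩ := (cell (D.onOpen V)).exists_desc (φ.app (op V)) (zero_mem _)
      (fun h' => (hV h').elim) (fun _ => rfl)
    exact ⟨ψ, h1, fun h' => (hV h').elim⟩

/-- A morphism out of the presheaf with a cell attached is given by a morphism out of `Q` and a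
section `t` of degree `n` over `U` with `dt = c`. -/
theorem exists_desc {T : TopCat.Presheaf (DGRing.{u} K) X} (φ : Q ⟶ T) {t : (sec T D.U).carrier}
    (ht : t ∈ (sec T D.U).deg D.n) (hdt : (sec T D.U).d t = ap φ D.U D.c) :
    ∃ ψ : D.attach ⟶ T, D.incl ≫ ψ = φ ∧ ap ψ D.U (D.gen D.U) = t := by
  choose ψ h1 h2 using D.exists_descApp φ ht hdt
  refine ⟨⟨fun V => ψ V.unop, fun V W f => ?_⟩, NatTrans.ext (funext fun V => h1 V.unop), ?_⟩
  · have h : W.unop ≤ V.unop := leOfHom f.unop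
    refine D.onOpen_hom_ext ?_ fun hV => ?_
    · change (cell (D.onOpen V.unop)).ι ≫ D.restrict h ≫ ψ W.unop =
        (cell (D.onOpen V.unop)).ι ≫ ψ V.unop ≫ T.map f
      rw [← Category.assoc, ι_restrict, Category.assoc, h1, ← Category.assoc, h1]
      exact φ.naturality f
    · refine (congrArg (Hom.toAlgHom (ψ W.unop)) (D.restrict_gen h hV)).trans ?_
      rw [h2 W.unop (h.trans hV), ← res_res T hV h, ← h2 V.unop hV]
      rfl
  · exact (h2 D.U le_rfl).trans (res_self _ _ _)

/-- The coefficients of the sections of the presheaf with the cell attached, as polynomials in the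
generator. -/
noncomputable def coeff (V : Opens X) (k : ℕ) : (sec D.attach V).carrier →ₗ[K] (sec Q V).carrier :=
  (cell (D.onOpen V)).coeff k

theorem coeff_res {V W : Opens X} (h : W ≤ V) {m : ℤ} {z : (sec D.attach V).carrier}
    (hz : z ∈ (sec D.attach V).deg m) (k : ℕ) :
    D.coeff W k (res D.attach h z) = res Q h (D.coeff V k z) :=
  (cell (D.onOpen V)).coeff_map (cell (D.onOpen W)) rfl h.trans (D.ι_restrict h)
    (D.restrict_gen h) hz k

/-- The cell attached to `Q'` that corresponds to a cell attached to `Q` under a morphism. -/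
noncomputable def map (f : Q ⟶ Q') : PresheafCellData Q' where
  U := D.U
  n := D.n
  c := ap f D.U D.c
  hn := D.hn
  c_mem := ap_mem f D.c_mem
  d_c := by rw [← ap_d, D.d_c, map_zero]

theorem exists_attachMap (f : Q ⟶ Q') :
    ∃ ψ : D.attach ⟶ (D.map f).attach, D.incl ≫ ψ = f ≫ (D.map f).incl ∧
      ap ψ D.U (D.gen D.U) = (D.map f).gen D.U :=
  D.exists_desc _ ((D.map f).gen_mem D.U) (D.map f).d_gen

/-- The morphism between the presheaves with cells attached that is induced by a morphism. -/
noncomputable def attachMap (f : Q ⟶ Q') : D.attach ⟶ (D.map f).attach :=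
  (D.exists_attachMap f).choose

theorem incl_attachMap (f : Q ⟶ Q') : D.incl ≫ D.attachMap f = f ≫ (D.map f).incl :=
  (D.exists_attachMap f).choose_spec.1

theorem attachMap_gen (f : Q ⟶ Q') {V : Opens X} (hV : V ≤ D.U) :
    ap (D.attachMap f) V (D.gen V) = (D.map f).gen V := by
  have h : ap (D.attachMap f) D.U (D.gen D.U) = (D.map f).gen D.U :=
    (D.exists_attachMap f).choose_spec.2
  rw [← D.res_gen hV le_rfl, ap_res, h]
  exact (D.map f).res_gen hV le_rfl

theorem coeff_attachMap (f : Q ⟶ Q') {V : Opens X} {m : ℤ} {z : (sec D.attach V).carrier}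
    (hz : z ∈ (sec D.attach V).deg m) (k : ℕ) :
    (D.map f).coeff V k (ap (D.attachMap f) V z) = ap f V (D.coeff V k z) :=
  (cell (D.onOpen V)).coeff_map (cell ((D.map f).onOpen V)) (φ := f.app (op V))
    (ψ := (D.attachMap f).app (op V)) rfl id
    (congrArg (fun φ => NatTrans.app φ (op V)) (D.incl_attachMap f))
    (fun hV => D.attachMap_gen f hV) hz k

/-- Attaching cells is compatible with base change. -/
theorem isPushout_attach (f : Q ⟶ Q') :
    IsPushout D.incl f (D.attachMap f) (D.map f).incl := by
  refine isPushout_of_exists (D.incl_attachMap f) (fun a b h => ?_) (fun c c' h1 h2 => ?_)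
  · have hd : (sec _ D.U).d (ap a D.U (D.gen D.U)) = ap b D.U (ap f D.U D.c) := by
      rw [← ap_d, D.d_gen, ← ap_comp, h]
      rfl
    obtain ⟨ψ, h1, h2⟩ := (D.map f).exists_desc b (ap_mem a (D.gen_mem D.U)) hd
    refine ⟨ψ, D.hom_ext ?_ ?_, h1⟩
    · rw [← Category.assoc, D.incl_attachMap, Category.assoc, h1, h]
    · rw [ap_comp, D.attachMap_gen f le_rfl]
      exact h2
  · refine (D.map f).hom_ext h2 ?_
    refine (congrArg (ap c D.U) (D.attachMap_gen f le_rfl).symm).trans ?_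
    refine Eq.trans ?_ (congrArg (ap c' D.U) (D.attachMap_gen f le_rfl))
    rw [← ap_comp, h1, ap_comp]

theorem coeff_mem {V : Opens X} {m : ℤ} {z : (sec D.attach V).carrier} (k : ℕ)
    (hz : z ∈ (sec D.attach V).deg m) : D.coeff V k z ∈ (sec Q V).deg (m - k * D.n) :=
  (cell (D.onOpen V)).coeff_mem k hz

theorem coeff_eq_zero {V : Opens X} {m : ℤ} {z : (sec D.attach V).carrier} {k : ℕ}
    (hz : z ∈ (sec D.attach V).deg m) (h : ¬ (D.onOpen V).HasPower k) : D.coeff V k z = 0 :=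
  (cell (D.onOpen V)).coeff_eq_zero hz h

theorem exists_bound {V : Opens X} {m : ℤ} {z : (sec D.attach V).carrier}
    (hz : z ∈ (sec D.attach V).deg m) : ∃ N, ∀ k ≥ N, D.coeff V k z = 0 :=
  (cell (D.onOpen V)).exists_bound hz

theorem eq_zero_of_coeff {V : Opens X} {m : ℤ} {z : (sec D.attach V).carrier}
    (hz : z ∈ (sec D.attach V).deg m) (h : ∀ k, D.coeff V k z = 0) : z = 0 :=
  (cell (D.onOpen V)).eq_zero_of_coeff hz h

theorem coeff_monomial {V : Opens X} {j : ℤ} {b : (sec Q V).carrier} {k : ℕ}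
    (hb : b ∈ (sec Q V).deg j) (hk : (D.onOpen V).HasPower k) (i : ℕ) :
    D.coeff V i (ap D.incl V b * D.gen V ^ k) = if i = k then b else 0 :=
  (cell (D.onOpen V)).coeff_monomial hb hk i

theorem coeff_d {V : Opens X} {m : ℤ} {z : (sec D.attach V).carrier} {k : ℕ}
    (hz : z ∈ (sec D.attach V).deg m) (h : ∀ i > k, D.coeff V i z = 0) {i : ℕ} (hi : k ≤ i) :
    D.coeff V i ((sec D.attach V).d z) = (sec Q V).d (D.coeff V i z) :=
  (cell (D.onOpen V)).coeff_d hz h i hi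

theorem monomial_mem {V : Opens X} {m : ℤ} {k : ℕ} {b : (sec Q V).carrier}
    (hb : b ∈ (sec Q V).deg (m - k * D.n)) :
    ap D.incl V b * D.gen V ^ k ∈ (sec D.attach V).deg m :=
  monomial_mem_deg (ap_mem D.incl hb) (D.gen_mem V)

theorem coeff_d_monomial {V : Opens X} {m : ℤ} {k : ℕ} {b : (sec Q V).carrier}
    (hb : b ∈ (sec Q V).deg (m - k * D.n)) (hk : (D.onOpen V).HasPower k) {i : ℕ} (hi : k ≤ i) :
    D.coeff V i ((sec D.attach V).d (ap D.incl V b * D.gen V ^ k)) =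
      if i = k then (sec Q V).d b else 0 := by
  rw [D.coeff_d (D.monomial_mem hb) (fun j hj => by
    rw [D.coeff_monomial hb hk, if_neg (ne_of_gt hj)]) hi, D.coeff_monomial hb hk]
  split_ifs
  · rfl
  · exact map_zero _

theorem hasPower_mono {V W : Opens X} (h : W ≤ V) {k : ℕ} (hk : (D.onOpen V).HasPower k) :
    (D.onOpen W).HasPower k := hk.imp_right fun hk => ⟨h.trans hk.1, hk.2⟩

/-- The solution of `da = e`, `f a - e' = da'` proceeds by induction on the degree of `e` and `e'`
in the generator: the leading coefficients of `e` and `e'` form a cocycle of the cone of `f`, so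
that they can be removed locally. -/
theorem attachMap_step {f : Q ⟶ Q'} (hf : LocallyConeAcyclic f) (N : ℕ) :
    ∀ ⦃V : Opens X⦄ ⦃l m n : ℤ⦄, l + 1 = m → m + 1 = n →
    ∀ e ∈ (sec D.attach V).deg n, ∀ e' ∈ (sec (D.map f).attach V).deg m,
      (∀ k ≥ N, D.coeff V k e = 0) → (∀ k ≥ N, (D.map f).coeff V k e' = 0) →
      (sec D.attach V).d e = 0 → ap (D.attachMap f) V e = (sec (D.map f).attach V).d e' →
      ∀ x ∈ V, ∃ (W : Opens X) (h : W ≤ V), x ∈ W ∧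
        ∃ a ∈ (sec D.attach W).deg m, ∃ a' ∈ (sec (D.map f).attach W).deg l,
          (sec D.attach W).d a = res D.attach h e ∧
          ap (D.attachMap f) W a - res (D.map f).attach h e' = (sec (D.map f).attach W).d a' := by
  induction N with
  | zero =>
    intro V l m n _ _ e he e' he' hN hN' _ _ x hx
    have h1 : e = 0 := D.eq_zero_of_coeff he fun k => hN k k.zero_le
    have h2 : e' = 0 := (D.map f).eq_zero_of_coeff he' fun k => hN' k k.zero_le
    refine ⟨V, le_rfl, hx, 0, zero_mem _, 0, zero_mem _, ?_, ?_⟩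
    · rw [h1, map_zero, map_zero]
    · rw [h2, map_zero, map_zero, map_zero, sub_zero]
  | succ N ih =>
    intro V l m n hlm hmn e he e' he' hN hN' hde hfe x hx
    by_cases hpow : (D.onOpen V).HasPower N
    · have hdp : (sec Q V).d (D.coeff V N e) = 0 := by
        rw [← D.coeff_d he (fun i hi => hN i hi) le_rfl, hde, map_zero]
      have hfp : ap f V (D.coeff V N e) = (sec Q' V).d ((D.map f).coeff V N e') := by
        rw [← D.coeff_attachMap f he, hfe, (D.map f).coeff_d he' (fun i hi => hN' i hi) le_rfl]
      obtain ⟨W, hW, hxW, b, hb, b', hb', hdb, hfb⟩ := hf (n := n - N * D.n)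
        (m := m - N * D.n) (l := l - N * D.n) (by omega) (by omega) _ (D.coeff_mem N he) _
        ((D.map f).coeff_mem N he') hdp hfp x hx
      have hpowW := D.hasPower_mono hW hpow
      have hpowW' : ((D.map f).onOpen W).HasPower N := hpowW
      have hb'' : b' ∈ (sec Q' W).deg (l - N * (D.map f).n) := hb'
      -- subtract the coboundary of `(b * gen ^ N, b' * gen ^ N)`, which has the same leading coefficients
      set a₀ := ap D.incl W b * D.gen W ^ N with ha₀
      set a₀' := ap (D.map f).incl W b' * (D.map f).gen W ^ N with ha₀'
      have hma : a₀ ∈ (sec D.attach W).deg m := D.monomial_mem hb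
      have hma' : a₀' ∈ (sec (D.map f).attach W).deg l := (D.map f).monomial_mem hb'
      have hda : (sec D.attach W).d a₀ ∈ (sec D.attach W).deg n :=
        mem_deg_congr hmn ((sec D.attach W).d_mem _ _ hma)
      have hda' : (sec (D.map f).attach W).d a₀' ∈ (sec (D.map f).attach W).deg m :=
        mem_deg_congr hlm ((sec (D.map f).attach W).d_mem _ _ hma')
      have hfa := ap_mem (D.attachMap f) hma
      obtain ⟨Z, hZ, hxZ, a₁, ha₁, a₁', ha₁', hd1, hf1⟩ := ih hlm hmn
        (res D.attach hW e - (sec D.attach W).d a₀) (sub_mem (res_mem _ hW he) hda)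
        (res (D.map f).attach hW e' - ap (D.attachMap f) W a₀ + (sec (D.map f).attach W).d a₀')
        (add_mem (sub_mem (res_mem _ hW he') hfa) hda')
        (fun k hk => by
          rw [map_sub, D.coeff_res hW he, D.coeff_d_monomial hb hpowW hk]
          split_ifs with h
          · rw [h, hdb, sub_self]
          · rw [hN k (by omega), map_zero, sub_zero])
        (fun k hk => by
          rw [map_add, map_sub, (D.map f).coeff_res hW he', D.coeff_attachMap f hma,
            D.coeff_monomial hb hpowW, (D.map f).coeff_d_monomial hb' hpowW' hk]
          split_ifs with h
          · rw [h, ← hfb]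
            abel
          · rw [hN' k (by omega), map_zero, map_zero, sub_zero, add_zero])
        (by rw [map_sub, ← res_d, hde, (sec D.attach W).d_d, map_zero, sub_zero])
        (by rw [map_sub, ap_res, hfe, ap_d, map_add, map_sub, res_d,
            (sec (D.map f).attach W).d_d, add_zero]) x hxW
      refine ⟨Z, hZ.trans hW, hxZ, res D.attach hZ a₀ + a₁, add_mem (res_mem _ hZ hma) ha₁,
        res (D.map f).attach hZ a₀' + a₁', add_mem (res_mem _ hZ hma') ha₁', ?_, ?_⟩
      · rw [map_add, hd1, map_sub, res_res, ← res_d]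
        abel
      · rw [map_add, map_add, ← hf1, ap_res, ← res_d, map_add, map_sub, res_res]
        abel
    -- `gen ^ N` vanishes, so that `N` also bounds the degrees
    · refine ih hlm hmn e he e' he' (fun k hk => ?_) (fun k hk => ?_) hde hfe x hx
      · rcases hk.eq_or_lt with rfl | hk
        · exact D.coeff_eq_zero he hpow
        · exact hN k hk
      · rcases hk.eq_or_lt with rfl | hk
        · exact (D.map f).coeff_eq_zero he' hpow
        · exact hN' k hk

/-- Attaching corresponding cells preserves quasi-isomorphisms. -/
theorem presheafQuasiIso_attachMap {f : Q ⟶ Q'} (hf : PresheafQuasiIso f) :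
    PresheafQuasiIso (D.attachMap f) := by
  rw [presheafQuasiIso_iff] at hf ⊢
  intro V l m n hlm hmn e he e' he'
  obtain ⟨N, hN⟩ := D.exists_bound he
  obtain ⟨N', hN'⟩ := (D.map f).exists_bound he'
  exact D.attachMap_step hf (max N N') hlm hmn e he e' he'
    (fun k hk => hN k ((le_max_left _ _).trans hk))
    (fun k hk => hN' k ((le_max_right _ _).trans hk))

end PresheafCellData

end DGRing

/-! ### h-cofibrations -/

/-- The morphisms `i` that admit pushouts along every morphism, and along which cobase change
preserves the weak equivalences `W`. -/
def CategoryTheory.MorphismProperty.hCofibrations {C : Type*} [Category C]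
    (W : MorphismProperty C) : MorphismProperty C := fun X Q i =>
  ∀ ⦃E : C⦄ (g : X ⟶ E), ∃ (Z : C) (k : Q ⟶ Z) (j : E ⟶ Z), IsPushout i g k j ∧ (W g → W k)

namespace CategoryTheory.MorphismProperty

variable {C : Type*} [Category C] {W : MorphismProperty C}

theorem hCofibrations_comp {X Y Z : C}
    {i : X ⟶ Y} {j : Y ⟶ Z} (hi : W.hCofibrations i) (hj : W.hCofibrations j) :
    W.hCofibrations (i ≫ j) := by
  intro E g
  obtain ⟨Z₁, k₁, j₁, sq₁, h₁⟩ := hi g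
  obtain ⟨Z₂, k₂, j₂, sq₂, h₂⟩ := hj k₁
  exact ⟨Z₂, k₂, j₁ ≫ j₂, sq₁.paste_horiz sq₂, fun hg => h₂ (h₁ hg)⟩

theorem hCofibrations_id (W : MorphismProperty C) (X : C) :
    W.hCofibrations (𝟙 X) := fun E g => ⟨E, g, 𝟙 E, IsPushout.of_horiz_isIso ⟨by simp⟩, id⟩

end CategoryTheory.MorphismProperty

namespace DGRing

variable {K : Type u} [CommRing K] {X : TopCat.{u}}

section Presheaf

/-- The quasi-isomorphisms between presheaves of commutative DG rings. -/
def presheafW (K : Type u) [CommRing K] (X : TopCat.{u}) :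
    MorphismProperty (TopCat.Presheaf (DGRing.{u} K) X) := fun _ _ f => PresheafQuasiIso f

/-- The cobase change of the attachment of a cell is the attachment of the corresponding cell. -/
theorem hCofibrations_incl {Q : TopCat.Presheaf (DGRing.{u} K) X} (D : PresheafCellData Q) :
    (presheafW K X).hCofibrations D.incl := fun _ g =>
  ⟨_, _, _, D.isPushout_attach g, D.presheafQuasiIso_attachMap⟩

theorem ap_ι_map {J : Type*} [Preorder J] {F : J ⥤ TopCat.Presheaf (DGRing.{u} K) X}
    {c : Cocone F} {i j : J} (h : i ≤ j) {U : Opens X} (a : (sec (F.obj i) U).carrier) :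
    ap (c.ι.app j) U (ap (F.map (homOfLE h)) U a) = ap (c.ι.app i) U a := by
  rw [← ap_comp, c.w]

section Colimit

variable {J : Type u} [Preorder J] [IsDirectedOrder J] [Nonempty J]
  {F G : J ⥤ TopCat.Presheaf (DGRing.{u} K) X}

instance : HasColimitsOfShape J (TopCat.Presheaf (DGRing.{u} K) X) :=
  inferInstanceAs (HasColimitsOfShape J ((Opens X)ᵒᵖ ⥤ DGRing.{u} K))

/-- The sections of a directed colimit of presheaves are a directed colimit. -/
noncomputable def isColimitSections {c : Cocone F} (hc : IsColimit c) (U : Opens X) :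
    IsColimit (((evaluation (Opens X)ᵒᵖ (DGRing.{u} K)).obj (op U)).mapCocone c) :=
  isColimitOfPreserves ((evaluation (Opens X)ᵒᵖ (DGRing.{u} K)).obj (op U)) hc

theorem exists_section_of_isColimit {c : Cocone F} (hc : IsColimit c) {U : Opens X} {n : ℤ}
    {x : (sec c.pt U).carrier} (hx : x ∈ (sec c.pt U).deg n) :
    ∃ j, ∃ a ∈ (sec (F.obj j) U).deg n, ap (c.ι.app j) U a = x :=
  exists_of_isColimit (isColimitSections hc U) hx

theorem section_eq_of_isColimit {c : Cocone F} (hc : IsColimit c) {U : Opens X} {i : J} {n : ℤ}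
    {a b : (sec (F.obj i) U).carrier} (ha : a ∈ (sec (F.obj i) U).deg n)
    (hb : b ∈ (sec (F.obj i) U).deg n) (h : ap (c.ι.app i) U a = ap (c.ι.app i) U b) :
    ∃ j, ∃ hij : i ≤ j, ap (F.map (homOfLE hij)) U a = ap (F.map (homOfLE hij)) U b :=
  eq_of_isColimit (isColimitSections hc U) ha hb h

/-- Directed colimits of quasi-isomorphisms are quasi-isomorphisms. -/
theorem presheafQuasiIso_of_isColimit (α : F ⟶ G) (hα : ∀ j, PresheafQuasiIso (α.app j))
    {c : Cocone F} (hc : IsColimit c) {c' : Cocone G} (hc' : IsColimit c') {f : c.pt ⟶ c'.pt}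
    (hf : ∀ j, c.ι.app j ≫ f = α.app j ≫ c'.ι.app j) : PresheafQuasiIso f := by
  rw [presheafQuasiIso_iff]
  intro U l m n hlm hmn e he e' he' hde hfe x hx
  have hf' : ∀ (j : J) (V : Opens X) (a : (sec (F.obj j) V).carrier),
      ap f V (ap (c.ι.app j) V a) = ap (c'.ι.app j) V (ap (α.app j) V a) := fun j V a => by
    rw [← ap_comp, hf, ap_comp]
  -- lift `e` and `e'` to some stage
  obtain ⟨j₁, a, ha, rfl⟩ := exists_section_of_isColimit hc he
  obtain ⟨j₂, a', ha', rfl⟩ := exists_section_of_isColimit hc' he'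
  obtain ⟨j, h₁, h₂⟩ := exists_ge_ge j₁ j₂
  rw [← ap_ι_map h₁] at hde hfe
  rw [← ap_ι_map h₂] at hfe
  have hb := ap_mem (F.map (homOfLE h₁)) ha
  have hb' := ap_mem (G.map (homOfLE h₂)) ha'
  rw [← ap_ι_map (c := c) h₁, ← ap_ι_map (c := c') h₂]
  generalize ap (F.map (homOfLE h₁)) U a = b at *
  generalize ap (G.map (homOfLE h₂)) U a' = b' at *
  -- the equations between them hold at a later stage
  rw [← ap_d, ← map_zero (ap (c.ι.app j) U)] at hde
  rw [hf', ← ap_d] at hfe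
  obtain ⟨j₃, h₃, e₃⟩ := section_eq_of_isColimit hc ((sec (F.obj j) U).d_mem _ _ hb) (zero_mem _)
    hde
  obtain ⟨j₄, h₄, e₄⟩ := section_eq_of_isColimit hc' (ap_mem (α.app j) hb)
    (mem_deg_congr hmn ((sec (G.obj j) U).d_mem _ _ hb')) hfe
  obtain ⟨i, h₅, h₆⟩ := exists_ge_ge j₃ j₄
  have hi : j ≤ i := h₃.trans h₅
  have e₅ : (sec (F.obj i) U).d (ap (F.map (homOfLE hi)) U b) = 0 := by
    rw [← ap_d, show homOfLE hi = homOfLE h₃ ≫ homOfLE h₅ from rfl, F.map_comp, ap_comp, e₃,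
      map_zero, map_zero]
  have e₆ : ap (α.app i) U (ap (F.map (homOfLE hi)) U b) =
      (sec (G.obj i) U).d (ap (G.map (homOfLE hi)) U b') := by
    rw [← ap_comp, α.naturality, ap_comp, ← ap_d,
      show homOfLE hi = homOfLE h₄ ≫ homOfLE h₆ from rfl, G.map_comp, ap_comp, e₄, ap_comp]
  obtain ⟨V, hV, hxV, z, hz, z', hz', hdz, hdz'⟩ := (presheafQuasiIso_iff _).mp (hα i) hlm hmn _
    (ap_mem _ hb) _ (ap_mem _ hb') e₅ e₆ x hx
  refine ⟨V, hV, hxV, ap (c.ι.app i) V z, ap_mem _ hz, ap (c'.ι.app i) V z', ap_mem _ hz', ?_, ?_⟩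
  · rw [← ap_d, hdz, ap_res, ap_ι_map]
  · rw [hf', ← ap_d, ← hdz', map_sub, ap_res, ap_ι_map]

/-- A directed colimit of h-cofibrations with a common source is an h-cofibration. -/
theorem hCofibrations_of_isColimit {Q : TopCat.Presheaf (DGRing.{u} K) X}
    (a : (Functor.const J).obj Q ⟶ F) (ha : ∀ j, (presheafW K X).hCofibrations (a.app j))
    {c : Cocone F} (hc : IsColimit c) (j₀ : J) :
    (presheafW K X).hCofibrations (a.app j₀ ≫ c.ι.app j₀) := by
  intro E g
  choose Z k i sq hW using fun j => ha j g
  have hnat : ∀ {j j' : J} (φ : j ⟶ j'), a.app j ≫ F.map φ = a.app j' := fun φ =>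
    (a.naturality φ).symm.trans (Category.id_comp _)
  let G : J ⥤ TopCat.Presheaf (DGRing.{u} K) X :=
    { obj := Z
      map := fun {j j'} φ => (sq j).desc (F.map φ ≫ k j') (i j') (by
        rw [← Category.assoc, hnat]
        exact (sq j').w)
      map_id := fun j => (sq j).hom_ext (by simp) (by simp)
      map_comp := fun {j j' j''} φ ψ => (sq j).hom_ext (by simp) (by simp) }
  let α : F ⟶ G := { app := k, naturality := fun j j' φ => ((sq j).inl_desc _ _ _).symm }
  have hi : ∀ {j j' : J} (φ : j ⟶ j'), i j ≫ G.map φ = i j' := fun {j _} _ => (sq j).inr_desc _ _ _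
  have hi' : ∀ j, i j ≫ colimit.ι G j = i j₀ ≫ colimit.ι G j₀ := by
    intro j
    obtain ⟨j', h, h'⟩ := exists_ge_ge j j₀
    rw [← colimit.w G (homOfLE h), ← colimit.w G (homOfLE h'), ← Category.assoc, ← Category.assoc,
      hi, hi]
  have hac : ∀ j, a.app j ≫ c.ι.app j = a.app j₀ ≫ c.ι.app j₀ := by
    intro j
    obtain ⟨j', h, h'⟩ := exists_ge_ge j j₀
    rw [← c.w (homOfLE h), ← c.w (homOfLE h'), ← Category.assoc, ← Category.assoc, hnat, hnat]
  let f : c.pt ⟶ colimit G := hc.desc ((Cocone.precompose α).obj (colimit.cocone G))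
  have hf : ∀ j, c.ι.app j ≫ f = k j ≫ colimit.ι G j := fun j => hc.fac _ j
  refine ⟨colimit G, f, i j₀ ≫ colimit.ι G j₀, isPushout_of_exists ?_ ?_ ?_, fun hg => ?_⟩
  · rw [Category.assoc, hf, ← Category.assoc, ← Category.assoc]
    exact congrArg (· ≫ _) (sq j₀).w
  · intro T b b' h
    have hb : ∀ j, a.app j ≫ c.ι.app j ≫ b = g ≫ b' := fun j => by
      rw [← Category.assoc, hac, h]
    let s : Cocone G :=
      { pt := T
        ι :=
          { app := fun j => (sq j).desc (c.ι.app j ≫ b) b' (hb j)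
            naturality := fun j j' φ => (sq j).hom_ext
              (by
                rw [← Category.assoc,
                  show k j ≫ G.map φ = F.map φ ≫ k j' from (sq j).inl_desc _ _ _]
                simp)
              (by
                rw [← Category.assoc, hi]
                simp) } }
    refine ⟨colimit.desc G s, hc.hom_ext fun j => ?_, ?_⟩
    · rw [← Category.assoc, hf, Category.assoc, colimit.ι_desc]
      exact (sq j).inl_desc _ _ _
    · rw [Category.assoc, colimit.ι_desc]
      exact (sq j₀).inr_desc _ _ _
  · intro T b b' h h'
    refine colimit.hom_ext fun j => (sq j).hom_ext ?_ ?_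
    · rw [← Category.assoc, ← Category.assoc, ← hf, Category.assoc, Category.assoc, h]
    · rw [← Category.assoc, ← Category.assoc, hi', h']
  · exact presheafQuasiIso_of_isColimit α (fun j => hW j hg) hc (colimit.isColimit G) hf

end Colimit

end Presheaf

end DGRing

/-! ### Factorizations -/

namespace DGRing

variable {K : Type u} [CommRing K] {X : TopCat.{u}} {Q : TopCat.Presheaf (DGRing.{u} K) X}

section FiniteFamilies

variable {G : Type u} (D : G → PresheafCellData Q)

/-- A presheaf obtained from `Q` by attaching the cells `D g` for `g` in a finite set `S`. The
values of `gen` outside of `S` are irrelevant. -/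
structure FiniteAttachment (S : Finset G) where
  obj : TopCat.Presheaf (DGRing.{u} K) X
  ι : Q ⟶ obj
  hι : (presheafW K X).hCofibrations ι
  gen : ∀ g, (sec obj (D g).U).carrier
  gen_mem : ∀ g ∈ S, gen g ∈ (sec obj (D g).U).deg (D g).n
  d_gen : ∀ g ∈ S, (sec obj (D g).U).d (gen g) = ap ι (D g).U (D g).c
  exists_desc : ∀ {T : TopCat.Presheaf (DGRing.{u} K) X} (φ : Q ⟶ T)
    (t : ∀ g, (sec T (D g).U).carrier), (∀ g ∈ S, t g ∈ (sec T (D g).U).deg (D g).n) →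
    (∀ g ∈ S, (sec T (D g).U).d (t g) = ap φ (D g).U (D g).c) →
    ∃ ψ : obj ⟶ T, ι ≫ ψ = φ ∧ ∀ g ∈ S, ap ψ (D g).U (gen g) = t g
  hom_ext : ∀ {T : TopCat.Presheaf (DGRing.{u} K) X} {ψ ψ' : obj ⟶ T}, ι ≫ ψ = ι ≫ ψ' →
    (∀ g ∈ S, ap ψ (D g).U (gen g) = ap ψ' (D g).U (gen g)) → ψ = ψ'

/-- No cells attached. -/
def FiniteAttachment.empty : FiniteAttachment D ∅ where
  obj := Q
  ι := 𝟙 Q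
  hι := MorphismProperty.hCofibrations_id _ _
  gen _ := 0
  gen_mem _ h := (Finset.notMem_empty _ h).elim
  d_gen _ h := (Finset.notMem_empty _ h).elim
  exists_desc φ _ _ _ := ⟨φ, Category.id_comp _, fun _ h => (Finset.notMem_empty _ h).elim⟩
  hom_ext h _ := by simpa using h

open Classical in
/-- One more cell attached. -/
noncomputable def FiniteAttachment.insert {S : Finset G} (A : FiniteAttachment D S) {g₀ : G}
    (hg₀ : g₀ ∉ S) : FiniteAttachment D (insert g₀ S) :=
  let D' := (D g₀).map A.ι
  let x : ∀ g, (sec D'.attach (D g).U).carrier :=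
    Function.update (fun g => ap D'.incl (D g).U (A.gen g)) g₀ (D'.gen (D g₀).U)
  have hx₀ : x g₀ = D'.gen (D g₀).U := Function.update_self _ _ _
  have hx : ∀ g ∈ S, x g = ap D'.incl (D g).U (A.gen g) := fun g hg =>
    Function.update_of_ne (ne_of_mem_of_not_mem hg hg₀) _ _
  { obj := D'.attach
    ι := A.ι ≫ D'.incl
    hι := MorphismProperty.hCofibrations_comp A.hι (hCofibrations_incl D')
    gen := x
    gen_mem := fun g hg => by
      rcases Finset.mem_insert.mp hg with rfl | hg
      · rw [hx₀]
        exact D'.gen_mem _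
      · rw [hx g hg]
        exact ap_mem _ (A.gen_mem g hg)
    d_gen := fun g hg => by
      rcases Finset.mem_insert.mp hg with rfl | hg
      · rw [hx₀]
        exact D'.d_gen
      · rw [hx g hg, ← ap_d, A.d_gen g hg]
        rfl
    exists_desc := fun φ t ht hdt => by
      obtain ⟨ψ, h1, h2⟩ := A.exists_desc φ t (fun g hg => ht g (Finset.mem_insert_of_mem hg))
        (fun g hg => hdt g (Finset.mem_insert_of_mem hg))
      have hd : (sec _ (D g₀).U).d (t g₀) = ap ψ (D g₀).U (ap A.ι (D g₀).U (D g₀).c) := by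
        rw [hdt g₀ (Finset.mem_insert_self _ _), ← h1, ap_comp]
      obtain ⟨ψ', h3, h4⟩ := D'.exists_desc ψ (ht g₀ (Finset.mem_insert_self _ _)) hd
      refine ⟨ψ', by rw [Category.assoc, h3, h1], fun g hg => ?_⟩
      rcases Finset.mem_insert.mp hg with rfl | hg
      · rw [hx₀]
        exact h4
      · rw [hx g hg, ← ap_comp, h3, h2 g hg]
    hom_ext := fun {T ψ ψ'} h h' => by
      refine D'.hom_ext (A.hom_ext (by rwa [Category.assoc, Category.assoc] at h) fun g hg => ?_) ?_
      · rw [ap_comp, ap_comp, ← hx g hg]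
        exact h' g (Finset.mem_insert_of_mem hg)
      · have := h' g₀ (Finset.mem_insert_self _ _)
        rw [hx₀] at this
        exact this }

theorem nonempty_finiteAttachment (S : Finset G) : Nonempty (FiniteAttachment D S) := by
  classical
  induction S using Finset.induction_on with
  | empty => exact ⟨.empty D⟩
  | insert g S hg ih => exact ⟨by convert ih.some.insert D hg⟩

/-- A chosen finite attachment. -/
noncomputable def finiteAttachment (S : Finset G) : FiniteAttachment D S :=
  (nonempty_finiteAttachment D S).some

theorem exists_transition {S T : Finset G} (h : S ≤ T) :
    ∃ ψ : (finiteAttachment D S).obj ⟶ (finiteAttachment D T).obj,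
      (finiteAttachment D S).ι ≫ ψ = (finiteAttachment D T).ι ∧
      ∀ g ∈ S, ap ψ (D g).U ((finiteAttachment D S).gen g) = (finiteAttachment D T).gen g :=
  (finiteAttachment D S).exists_desc _ _ (fun g hg => (finiteAttachment D T).gen_mem g (h hg))
    (fun g hg => (finiteAttachment D T).d_gen g (h hg))

/-- The transition morphisms between the finite attachments. -/
noncomputable def attachTransition {S T : Finset G} (h : S ≤ T) :
    (finiteAttachment D S).obj ⟶ (finiteAttachment D T).obj := (exists_transition D h).choose

theorem ι_attachTransition {S T : Finset G} (h : S ≤ T) :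
    (finiteAttachment D S).ι ≫ attachTransition D h = (finiteAttachment D T).ι :=
  (exists_transition D h).choose_spec.1

theorem attachTransition_gen {S T : Finset G} (h : S ≤ T) {g : G} (hg : g ∈ S) :
    ap (attachTransition D h) (D g).U ((finiteAttachment D S).gen g) =
      (finiteAttachment D T).gen g :=
  (exists_transition D h).choose_spec.2 g hg

/-- The directed system of the finite attachments. -/
noncomputable def attachmentSystem : Finset G ⥤ TopCat.Presheaf (DGRing.{u} K) X where
  obj S := (finiteAttachment D S).obj
  map f := attachTransition D (leOfHom f)
  map_id S := by
    refine (finiteAttachment D S).hom_ext ?_ fun g hg => ?_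
    · rw [ι_attachTransition, Category.comp_id]
    · rw [attachTransition_gen D _ hg, ap_id]
  map_comp f f' := by
    refine (finiteAttachment D _).hom_ext ?_ fun g hg => ?_
    · rw [ι_attachTransition, ← Category.assoc, ι_attachTransition, ι_attachTransition]
    · rw [attachTransition_gen D _ hg, ap_comp, attachTransition_gen D _ hg,
        attachTransition_gen D _ (leOfHom f hg)]

/-- The inclusions of `Q` into the finite attachments. -/
noncomputable def attachmentIncl : (Functor.const (Finset G)).obj Q ⟶ attachmentSystem D where
  app S := (finiteAttachment D S).ι
  naturality _ _ f := (Category.id_comp _).trans (ι_attachTransition D (leOfHom f)).symm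

/-- A family of cells can be attached by an h-cofibration, over any presheaf `Y` over which the
differentials of the generators become boundaries. -/
theorem exists_attachment {Y : TopCat.Presheaf (DGRing.{u} K) X} (p : Q ⟶ Y)
    (y : ∀ g, (sec Y (D g).U).carrier) (hy : ∀ g, y g ∈ (sec Y (D g).U).deg (D g).n)
    (hdy : ∀ g, (sec Y (D g).U).d (y g) = ap p (D g).U (D g).c) :
    ∃ (T : TopCat.Presheaf (DGRing.{u} K) X) (i : Q ⟶ T) (q : T ⟶ Y),
      (presheafW K X).hCofibrations i ∧ i ≫ q = p ∧
      ∀ g, ∃ x ∈ (sec T (D g).U).deg (D g).n, (sec T (D g).U).d x = ap i (D g).U (D g).c ∧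
        ap q (D g).U x = y g := by
  have hdesc := fun S => (finiteAttachment D S).exists_desc p y (fun g _ => hy g) (fun g _ => hdy g)
  choose ψ h1 h2 using hdesc
  let s : Cocone (attachmentSystem D) :=
    { pt := Y
      ι :=
        { app := ψ
          naturality := fun S T f => by
            refine (finiteAttachment D S).hom_ext ?_ fun g hg => ?_
            · change _ ≫ attachTransition D (leOfHom f) ≫ ψ T = _ ≫ ψ S ≫ 𝟙 Y
              rw [← Category.assoc, ι_attachTransition, h1, Category.comp_id, h1]
            · change ap (ψ T) _ (ap (attachTransition D (leOfHom f)) _ _) = ap (ψ S) _ _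
              rw [attachTransition_gen D _ hg, h2 T g (leOfHom f hg), h2 S g hg] } }
  have hs : ∀ S, colimit.ι (attachmentSystem D) S ≫ colimit.desc _ s = ψ S :=
    fun S => colimit.ι_desc s S
  have hι : ∀ S, (attachmentIncl D).app S ≫ colimit.ι (attachmentSystem D) S =
      (attachmentIncl D).app ∅ ≫ colimit.ι (attachmentSystem D) ∅ := fun S => by
    have hw : (attachmentIncl D).app ∅ ≫ (attachmentSystem D).map (homOfLE S.empty_subset) =
      (attachmentIncl D).app S := ι_attachTransition D S.empty_subset
    rw [← hw, Category.assoc, colimit.w]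
  refine ⟨colimit (attachmentSystem D), (attachmentIncl D).app ∅ ≫ colimit.ι _ ∅,
    colimit.desc _ s, ?_, ?_, fun g => ?_⟩
  · exact hCofibrations_of_isColimit (attachmentIncl D) (fun S => (finiteAttachment D S).hι)
      (colimit.isColimit _) ∅
  · rw [Category.assoc, hs]
    exact h1 ∅
  · have hg : g ∈ ({g} : Finset G) := Finset.mem_singleton_self g
    let x : (sec ((attachmentSystem D).obj {g}) (D g).U).carrier := (finiteAttachment D {g}).gen g
    have hx : x ∈ (sec ((attachmentSystem D).obj {g}) (D g).U).deg (D g).n :=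
      (finiteAttachment D {g}).gen_mem g hg
    have hdx : (sec ((attachmentSystem D).obj {g}) (D g).U).d x =
      ap ((attachmentIncl D).app {g}) (D g).U (D g).c := (finiteAttachment D {g}).d_gen g hg
    refine ⟨ap (colimit.ι (attachmentSystem D) {g}) _ x, ap_mem _ hx, ?_, ?_⟩
    · rw [← hι {g}, ← ap_d, hdx]
      rfl
    · rw [← ap_comp, hs]
      exact h2 {g} g hg

end FiniteFamilies

section Factorization

variable {Y : TopCat.Presheaf (DGRing.{u} K) X}

/-- The lifting problems for `p` against the generating cofibrations: a section `c` of `Q` and a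
section `y` of `Y` with `dc = 0` and `p c = dy`. -/
structure LiftingProblem (p : Q ⟶ Y) extends PresheafCellData Q where
  y : (sec Y U).carrier
  y_mem : y ∈ (sec Y U).deg n
  d_y : (sec Y U).d y = ap p U c

/-- The morphism `q` solves the lifting problems of `p` after `i`. -/
def SolvesAfter {T : TopCat.Presheaf (DGRing.{u} K) X} (p : Q ⟶ Y) (i : Q ⟶ T) (q : T ⟶ Y) : Prop :=
  ∀ P : LiftingProblem p, ∃ x ∈ (sec T P.U).deg P.n, (sec T P.U).d x = ap i P.U P.c ∧
    ap q P.U x = P.y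

/-- All lifting problems of `p` are solved by attaching one cell for each of them. -/
theorem exists_solvesAfter (p : Q ⟶ Y) :
    ∃ (T : TopCat.Presheaf (DGRing.{u} K) X) (i : Q ⟶ T) (q : T ⟶ Y),
      (presheafW K X).hCofibrations i ∧ i ≫ q = p ∧ SolvesAfter p i q :=
  exists_attachment (fun P : LiftingProblem p => P.toPresheafCellData) p (fun P => P.y)
    (fun P => P.y_mem) (fun P => P.d_y)

/-- The step of the construction of a factorization: the lifting problems are solved by attaching
cells. -/
noncomputable def attachStep (Q : Over Y) : Over Y :=
  Over.mk (exists_solvesAfter Q.hom).choose_spec.choose_spec.choose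

/-- The inclusion of a step into the next one. -/
noncomputable def toAttachStep (Q : Over Y) : Q ⟶ attachStep Q :=
  Over.homMk (exists_solvesAfter Q.hom).choose_spec.choose
    (exists_solvesAfter Q.hom).choose_spec.choose_spec.choose_spec.2.1

theorem hCofibrations_toAttachStep (Q : Over Y) :
    (presheafW K X).hCofibrations (toAttachStep Q).left :=
  (exists_solvesAfter Q.hom).choose_spec.choose_spec.choose_spec.1

theorem solvesAfter_attachStep (Q : Over Y) :
    SolvesAfter Q.hom (toAttachStep Q).left (attachStep Q).hom :=
  (exists_solvesAfter Q.hom).choose_spec.choose_spec.choose_spec.2.2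

/-- The steps of the construction of a factorization. -/
noncomputable def attachSteps (Q : Over Y) : ℕ → Over Y
  | 0 => Q
  | k + 1 => attachStep (attachSteps Q k)

/-- The sequence of the steps. -/
noncomputable def attachSequence (Q : Over Y) : ℕ ⥤ Over Y :=
  Functor.ofSequence (X := attachSteps Q) fun k => toAttachStep (attachSteps Q k)

theorem attachSequence_map_succ (Q : Over Y) (k : ℕ) :
    (attachSequence Q).map (homOfLE (Nat.le_add_right k 1)) = toAttachStep (attachSteps Q k) :=
  Functor.ofSequence_map_homOfLE_succ _ k

theorem hCofibrations_attachSequence (Q : Over Y) (k : ℕ) :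
    (presheafW K X).hCofibrations ((attachSequence Q).map (homOfLE k.zero_le)).left := by
  induction k with
  | zero =>
    have : homOfLE (Nat.zero_le 0) = 𝟙 0 := rfl
    rw [this, CategoryTheory.Functor.map_id]
    exact MorphismProperty.hCofibrations_id _ _
  | succ k ih =>
    have : homOfLE (k + 1).zero_le = homOfLE k.zero_le ≫ homOfLE (Nat.le_add_right k 1) := rfl
    rw [this, Functor.map_comp, Over.comp_left, attachSequence_map_succ]
    exact MorphismProperty.hCofibrations_comp ih (hCofibrations_toAttachStep _)

/-- The sequence of the steps, indexed in the universe of the base. -/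
noncomputable def attachTower (Q : Over Y) : ULift.{u} ℕ ⥤ TopCat.Presheaf (DGRing.{u} K) X :=
  (show Monotone (ULift.down : ULift.{u} ℕ → ℕ) from fun _ _ h => h).functor ⋙ attachSequence Q ⋙
    Over.forget Y

/-- The right lifting property against the generating cofibrations. -/
def HasCellLifting {T : TopCat.Presheaf (DGRing.{u} K) X} (q : T ⟶ Y) : Prop :=
  SolvesAfter q (𝟙 T) q

/-- Every morphism is an h-cofibration followed by a morphism with the right lifting property
against the generating cofibrations. -/
theorem exists_factorization (p : Q ⟶ Y) :
    ∃ (T : TopCat.Presheaf (DGRing.{u} K) X) (i : Q ⟶ T) (q : T ⟶ Y),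
      (presheafW K X).hCofibrations i ∧ i ≫ q = p ∧ HasCellLifting q := by
  let P : Over Y := Over.mk p
  let F := attachTower P
  have hle : ∀ {j k : ULift.{u} ℕ}, (j ⟶ k) → j.down ≤ k.down := fun {j k} f =>
    show j ≤ k from leOfHom f
  let s : Cocone F :=
    { pt := Y
      ι :=
        { app := fun k => (attachSteps P k.down).hom
          naturality := fun j k f => (Over.w ((attachSequence P).map (homOfLE (hle f)))).trans
            (Category.comp_id _).symm } }
  let a : (Functor.const (ULift.{u} ℕ)).obj Q ⟶ F :=
    { app := fun k => ((attachSequence P).map (homOfLE k.down.zero_le)).left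
      naturality := fun j k f => by
        refine (Category.id_comp _).trans ?_
        refine Eq.trans ?_ (congrArg CommaMorphism.left
          ((attachSequence P).map_comp (homOfLE j.down.zero_le) (homOfLE (hle f))))
        rfl }
  have hs : ∀ k, colimit.ι F k ≫ colimit.desc F s = (attachSteps P k.down).hom :=
    fun k => colimit.ι_desc s k
  refine ⟨colimit F, a.app ⟨0⟩ ≫ colimit.ι F ⟨0⟩, colimit.desc F s, ?_, ?_, ?_⟩
  · exact hCofibrations_of_isColimit a (fun k => hCofibrations_attachSequence P k.down)
      (colimit.isColimit F) ⟨0⟩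
  · rw [Category.assoc, hs]
    exact Over.w ((attachSequence P).map (homOfLE (Nat.zero_le 0)))
  · intro L
    -- the section `c` and the equation `dc = 0` come from some stage; the next one has a solution
    obtain ⟨j, c, hc, hcL⟩ := exists_section_of_isColimit (colimit.isColimit F) L.c_mem
    have hcL' : ap (colimit.ι F j) L.U c = L.c := hcL
    have hdc : ap (colimit.ι F j) L.U ((sec (F.obj j) L.U).d c) = ap (colimit.ι F j) L.U 0 := by
      rw [ap_d, hcL', L.d_c, map_zero]
    obtain ⟨k, hjk, e⟩ := section_eq_of_isColimit (colimit.isColimit F)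
      ((sec (F.obj j) L.U).d_mem _ _ hc) (zero_mem _) hdc
    let c' : (sec (F.obj k) L.U).carrier := ap (F.map (homOfLE hjk)) L.U c
    have hc'L : ap (colimit.ι F k) L.U c' = L.c := by
      rw [← hcL', ← ap_comp, colimit.w]
    let L' : LiftingProblem (attachSteps P k.down).hom :=
      { U := L.U
        n := L.n
        c := c'
        hn := L.hn
        c_mem := ap_mem _ hc
        d_c := by
          refine (ap_d (F.map (homOfLE hjk)) c).symm.trans (e.trans (map_zero _))
        y := L.y
        y_mem := L.y_mem
        d_y := by
          rw [L.d_y, ← hc'L, ← ap_comp, hs]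
          rfl }
    obtain ⟨x, hx, hdx, hqx⟩ := solvesAfter_attachStep (attachSteps P k.down) L'
    have hk : k ≤ (⟨k.down + 1⟩ : ULift.{u} ℕ) := Nat.le_add_right k.down 1
    have hstep : F.map (homOfLE hk) = (toAttachStep (attachSteps P k.down)).left :=
      congrArg CommaMorphism.left (attachSequence_map_succ P k.down)
    refine ⟨ap (colimit.ι F ⟨k.down + 1⟩) L.U x, ap_mem (colimit.ι F ⟨k.down + 1⟩) hx, ?_, ?_⟩
    · refine (ap_d (colimit.ι F ⟨k.down + 1⟩) x).symm.trans ?_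
      refine (congrArg (ap (colimit.ι F ⟨k.down + 1⟩) L.U) hdx).trans ?_
      rw [← hstep]
      refine (ap_comp (F.map (homOfLE hk)) (colimit.ι F ⟨k.down + 1⟩) c').symm.trans ?_
      rw [colimit.w]
      exact hc'L
    · refine (ap_comp (colimit.ι F ⟨k.down + 1⟩) (colimit.desc F s) x).symm.trans ?_
      rw [hs]
      exact hqx

variable {T : TopCat.Presheaf (DGRing.{u} K) X} {q : T ⟶ Y}

/-- In positive degrees, where no cells are attached, the lifting problems are trivial. -/
theorem HasCellLifting.exists_lift (hq : HasCellLifting q) {U : Opens X} {n : ℤ}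
    {c : (sec T U).carrier} (hc : c ∈ (sec T U).deg (n + 1)) (hdc : (sec T U).d c = 0)
    {y : (sec Y U).carrier} (hy : y ∈ (sec Y U).deg n) (hdy : (sec Y U).d y = ap q U c) :
    ∃ x ∈ (sec T U).deg n, (sec T U).d x = c ∧ ap q U x = y := by
  by_cases hn : n ≤ 0
  · exact hq ⟨⟨U, n, c, hn, hc, hdc⟩, y, hy, hdy⟩
  · refine ⟨0, zero_mem _, ?_, ?_⟩
    · rw [map_zero, eq_zero_of_pos _ (by omega) hc]
    · rw [map_zero, eq_zero_of_pos _ (by omega) hy]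

/-- The right lifting property is the acyclicity of the mapping cone, with a solution over the same
open set and without error term. -/
theorem HasCellLifting.presheafQuasiIso (hq : HasCellLifting q) : PresheafQuasiIso q := by
  rw [presheafQuasiIso_iff]
  intro U l m n hlm hmn e he e' he' hde hqe x hx
  subst hmn
  obtain ⟨a, ha, hda, hqa⟩ := hq.exists_lift he hde he' hqe.symm
  refine ⟨U, le_rfl, hx, a, ha, 0, zero_mem _, ?_, ?_⟩
  · rw [hda, res_self]
  · rw [hqa, res_self, sub_self, map_zero]

/-- Surjectivity on sections needs two lifts: the first one lifts `dy` to a cocycle, the second one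
lifts `y` to a section whose differential is that cocycle. -/
theorem HasCellLifting.surjective (hq : HasCellLifting q) {U : Opens X} {n : ℤ}
    {y : (sec Y U).carrier} (hy : y ∈ (sec Y U).deg n) : ∃ x ∈ (sec T U).deg n, ap q U x = y := by
  obtain ⟨c, hc, hdc, hqc⟩ := hq.exists_lift (n := n + 1) (c := 0) (zero_mem _) (map_zero _)
    ((sec Y U).d_mem n y hy) (by rw [(sec Y U).d_d, map_zero])
  obtain ⟨x, hx, -, hqx⟩ := hq.exists_lift hc hdc hy hqc.symm
  exact ⟨x, hx, hqx⟩

end Factorization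

end DGRing

/-! ### Fibre products -/

namespace DGRing

variable {K : Type u} [CommRing K]

section FiberProduct

variable {A B C : DGRing K} (f : A ⟶ C) (g : B ⟶ C)

/-- The graded model of the fibre product: pairs of elements with the same image. -/
def fiberModel : GradedModel K (A.carrier × B.carrier) where
  D n :=
    { carrier := {x | x.1 ∈ A.deg n ∧ x.2 ∈ B.deg n ∧ Hom.toAlgHom f x.1 = Hom.toAlgHom g x.2}
      zero_mem' := ⟨zero_mem _, zero_mem _, (map_zero _).trans (map_zero _).symm⟩
      add_mem' := fun hx hy => ⟨add_mem hx.1 hy.1, add_mem hx.2.1 hy.2.1,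
        (map_add _ _ _).trans ((congrArg₂ _ hx.2.2 hy.2.2).trans (map_add _ _ _).symm)⟩
      smul_mem' := fun r _ hx => ⟨Submodule.smul_mem _ r hx.1, Submodule.smul_mem _ r hx.2.1,
        (map_smul _ _ _).trans ((congrArg _ hx.2.2).trans (map_smul _ _ _).symm)⟩ }
  one_mem := ⟨one_mem_deg A, one_mem_deg B, (map_one _).trans (map_one _).symm⟩
  mul_mem hx hy := ⟨mul_mem_deg A hx.1 hy.1, mul_mem_deg B hx.2.1 hy.2.1,
    (map_mul _ _ _).trans ((congrArg₂ _ hx.2.2 hy.2.2).trans (map_mul _ _ _).symm)⟩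
  eq_zero hn hx := Prod.ext (eq_zero_of_pos A hn hx.1) (eq_zero_of_pos B hn hx.2.1)
  mul_comm' hx hy := Prod.ext (A.mul_comm' _ _ _ _ hx.1 hy.1) (B.mul_comm' _ _ _ _ hx.2.1 hy.2.1)
  mul_self' hn hx := Prod.ext (A.mul_self' _ _ hn hx.1) (B.mul_self' _ _ hn hx.2.1)
  d _ := A.d.prodMap B.d
  d_mem hx := ⟨A.d_mem _ _ hx.1, B.d_mem _ _ hx.2.1,
    (Hom.map_d f _).trans ((congrArg C.d hx.2.2).trans (Hom.map_d g _).symm)⟩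
  d_d _ := Prod.ext (A.d_d _) (B.d_d _)
  leibniz hx _ := Prod.ext (A.leibniz _ _ _ hx.1) (B.leibniz _ _ _ hx.2.1)

/-- The fibre product of commutative DG rings. -/
noncomputable def fiberProduct : DGRing K := (fiberModel f g).toDGRing

/-- The first projection. -/
noncomputable def fiberFst : fiberProduct f g ⟶ A :=
  (fiberModel f g).desc (fun _ => LinearMap.fst K _ _) (fun _ _ h => h.1) rfl
    (fun _ _ _ _ _ _ => rfl) (fun _ _ _ => rfl)

/-- The second projection. -/
noncomputable def fiberSnd : fiberProduct f g ⟶ B :=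
  (fiberModel f g).desc (fun _ => LinearMap.snd K _ _) (fun _ _ h => h.2.1) rfl
    (fun _ _ _ _ _ _ => rfl) (fun _ _ _ => rfl)

variable {f g}

theorem fiberFst_apply {n : ℤ} {z : (fiberProduct f g).carrier}
    (hz : z ∈ (fiberProduct f g).deg n) :
    Hom.toAlgHom (fiberFst f g) z = ((fiberModel f g).val z).1 :=
  (fiberModel f g).desc_apply _ _ _ _ _ hz

theorem fiberSnd_apply {n : ℤ} {z : (fiberProduct f g).carrier}
    (hz : z ∈ (fiberProduct f g).deg n) :
    Hom.toAlgHom (fiberSnd f g) z = ((fiberModel f g).val z).2 :=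
  (fiberModel f g).desc_apply _ _ _ _ _ hz

theorem fiber_ext {n : ℤ} {z w : (fiberProduct f g).carrier} (hz : z ∈ (fiberProduct f g).deg n)
    (hw : w ∈ (fiberProduct f g).deg n)
    (h₁ : Hom.toAlgHom (fiberFst f g) z = Hom.toAlgHom (fiberFst f g) w)
    (h₂ : Hom.toAlgHom (fiberSnd f g) z = Hom.toAlgHom (fiberSnd f g) w) : z = w := by
  rw [fiberFst_apply hz, fiberFst_apply hw] at h₁
  rw [fiberSnd_apply hz, fiberSnd_apply hw] at h₂
  exact (fiberModel f g).val_inj hz hw (Prod.ext h₁ h₂)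

theorem fiber_hom_ext {T : DGRing K} {a b : T ⟶ fiberProduct f g}
    (h₁ : a ≫ fiberFst f g = b ≫ fiberFst f g) (h₂ : a ≫ fiberSnd f g = b ≫ fiberSnd f g) :
    a = b :=
  hom_ext_deg fun n x hx => fiber_ext (Hom.map_deg a n x hx) (Hom.map_deg b n x hx)
    (congrArg (fun φ => Hom.toAlgHom φ x) h₁) (congrArg (fun φ => Hom.toAlgHom φ x) h₂)

theorem exists_fiber {n : ℤ} {a : A.carrier} {b : B.carrier} (ha : a ∈ A.deg n) (hb : b ∈ B.deg n)
    (h : Hom.toAlgHom f a = Hom.toAlgHom g b) :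
    ∃ z ∈ (fiberProduct f g).deg n, Hom.toAlgHom (fiberFst f g) z = a ∧
      Hom.toAlgHom (fiberSnd f g) z = b := by
  obtain ⟨z, hz, e⟩ := (fiberModel f g).exists_val_eq (a := (a, b)) (n := n) ⟨ha, hb, h⟩
  refine ⟨z, hz, (fiberFst_apply hz).trans (congrArg Prod.fst e),
    (fiberSnd_apply hz).trans (congrArg Prod.snd e)⟩

theorem fiber_condition : fiberFst f g ≫ f = fiberSnd f g ≫ g :=
  hom_ext_deg fun n z hz => by
    change Hom.toAlgHom f (Hom.toAlgHom (fiberFst f g) z) =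
      Hom.toAlgHom g (Hom.toAlgHom (fiberSnd f g) z)
    rw [fiberFst_apply hz, fiberSnd_apply hz]
    exact ((fiberModel f g).val_mem hz).2.2

theorem exists_fiberLift {T : DGRing K} (a : T ⟶ A) (b : T ⟶ B) (h : a ≫ f = b ≫ g) :
    ∃ c : T ⟶ fiberProduct f g, c ≫ fiberFst f g = a ∧ c ≫ fiberSnd f g = b := by
  let L := (fiberModel f g).lift
    (fun _ => ((Hom.toAlgHom a).prod (Hom.toAlgHom b)).toLinearMap)
    (fun n x hx => ⟨Hom.map_deg a n x hx, Hom.map_deg b n x hx,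
      congrArg (fun φ => Hom.toAlgHom φ x) h⟩)
    (map_one ((Hom.toAlgHom a).prod (Hom.toAlgHom b)))
    (fun _ _ x y _ _ => map_mul ((Hom.toAlgHom a).prod (Hom.toAlgHom b)) x y)
    (fun n x _ => Prod.ext (Hom.map_d a x) (Hom.map_d b x))
  have hL : ∀ (n : ℤ) (x : T.carrier), x ∈ T.deg n →
      (fiberModel f g).val (Hom.toAlgHom L x) = (Hom.toAlgHom a x, Hom.toAlgHom b x) :=
    fun n x hx => (fiberModel f g).val_lift _ _ _ _ _ hx
  refine ⟨L, hom_ext_deg fun n x hx => ?_, hom_ext_deg fun n x hx => ?_⟩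
  · exact (fiberFst_apply (Hom.map_deg L n x hx)).trans (congrArg Prod.fst (hL n x hx))
  · exact (fiberSnd_apply (Hom.map_deg L n x hx)).trans (congrArg Prod.snd (hL n x hx))

end FiberProduct

variable {X : TopCat.{u}}

section PresheafFiberProduct

variable {A B C : TopCat.Presheaf (DGRing.{u} K) X} (f : A ⟶ C) (g : B ⟶ C)

theorem exists_fiberRes {U V : (Opens X)ᵒᵖ} (φ : U ⟶ V) :
    ∃ c : fiberProduct (f.app U) (g.app U) ⟶ fiberProduct (f.app V) (g.app V),
      c ≫ fiberFst (f.app V) (g.app V) = fiberFst (f.app U) (g.app U) ≫ A.map φ ∧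
      c ≫ fiberSnd (f.app V) (g.app V) = fiberSnd (f.app U) (g.app U) ≫ B.map φ :=
  exists_fiberLift _ _ (by
    rw [Category.assoc, Category.assoc, f.naturality, g.naturality, ← Category.assoc,
      fiber_condition, Category.assoc])

/-- The fibre product of presheaves of commutative DG rings. -/
noncomputable def presheafFiber : TopCat.Presheaf (DGRing.{u} K) X where
  obj U := fiberProduct (f.app U) (g.app U)
  map φ := (exists_fiberRes f g φ).choose
  map_id U := fiber_hom_ext
    (by rw [(exists_fiberRes f g _).choose_spec.1, A.map_id, Category.comp_id, Category.id_comp])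
    (by rw [(exists_fiberRes f g _).choose_spec.2, B.map_id, Category.comp_id, Category.id_comp])
  map_comp φ ψ := fiber_hom_ext
    (by
      rw [(exists_fiberRes f g _).choose_spec.1, Category.assoc,
        (exists_fiberRes f g ψ).choose_spec.1, ← Category.assoc,
        (exists_fiberRes f g φ).choose_spec.1, A.map_comp, Category.assoc])
    (by
      rw [(exists_fiberRes f g _).choose_spec.2, Category.assoc,
        (exists_fiberRes f g ψ).choose_spec.2, ← Category.assoc,
        (exists_fiberRes f g φ).choose_spec.2, B.map_comp, Category.assoc])

/-- The first projection. -/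
noncomputable def presheafFst : presheafFiber f g ⟶ A where
  app U := fiberFst (f.app U) (g.app U)
  naturality _ _ φ := (exists_fiberRes f g φ).choose_spec.1

/-- The second projection. -/
noncomputable def presheafSnd : presheafFiber f g ⟶ B where
  app U := fiberSnd (f.app U) (g.app U)
  naturality _ _ φ := (exists_fiberRes f g φ).choose_spec.2

variable {f g}

theorem presheafFiber_condition : presheafFst f g ≫ f = presheafSnd f g ≫ g :=
  NatTrans.ext (funext fun _ => fiber_condition)

theorem ap_presheafFiber_condition {U : Opens X} (z : (sec (presheafFiber f g) U).carrier) :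
    ap f U (ap (presheafFst f g) U z) = ap g U (ap (presheafSnd f g) U z) := by
  rw [← ap_comp, presheafFiber_condition, ap_comp]

theorem presheafFiber_ext {U : Opens X} {n : ℤ} {z w : (sec (presheafFiber f g) U).carrier}
    (hz : z ∈ (sec (presheafFiber f g) U).deg n) (hw : w ∈ (sec (presheafFiber f g) U).deg n)
    (h₁ : ap (presheafFst f g) U z = ap (presheafFst f g) U w)
    (h₂ : ap (presheafSnd f g) U z = ap (presheafSnd f g) U w) : z = w :=
  fiber_ext hz hw h₁ h₂

theorem exists_presheafFiber {U : Opens X} {n : ℤ} {a : (sec A U).carrier} {b : (sec B U).carrier}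
    (ha : a ∈ (sec A U).deg n) (hb : b ∈ (sec B U).deg n) (h : ap f U a = ap g U b) :
    ∃ z ∈ (sec (presheafFiber f g) U).deg n, ap (presheafFst f g) U z = a ∧
      ap (presheafSnd f g) U z = b :=
  exists_fiber ha hb h

theorem isPullback_presheafFiber : IsPullback (presheafFst f g) (presheafSnd f g) f g := by
  have H : ∀ s : PullbackCone f g, ∃ c : s.pt ⟶ presheafFiber f g,
      c ≫ presheafFst f g = s.fst ∧ c ≫ presheafSnd f g = s.snd := by
    intro s
    have hU : ∀ U, ∃ c : s.pt.obj U ⟶ (presheafFiber f g).obj U,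
        c ≫ (presheafFst f g).app U = s.fst.app U ∧ c ≫ (presheafSnd f g).app U = s.snd.app U :=
      fun U => exists_fiberLift (s.fst.app U) (s.snd.app U)
        (congrArg (fun φ => NatTrans.app φ U) s.condition)
    choose c h₁ h₂ using hU
    refine ⟨⟨c, fun U V φ => ?_⟩, NatTrans.ext (funext h₁), NatTrans.ext (funext h₂)⟩
    refine fiber_hom_ext (f := f.app V) (g := g.app V) ?_ ?_
    · change (s.pt.map φ ≫ c V) ≫ (presheafFst f g).app V =
        (c U ≫ (presheafFiber f g).map φ) ≫ (presheafFst f g).app V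
      rw [Category.assoc, h₁, Category.assoc, (presheafFst f g).naturality, ← Category.assoc, h₁,
        s.fst.naturality]
    · change (s.pt.map φ ≫ c V) ≫ (presheafSnd f g).app V =
        (c U ≫ (presheafFiber f g).map φ) ≫ (presheafSnd f g).app V
      rw [Category.assoc, h₂, Category.assoc, (presheafSnd f g).naturality, ← Category.assoc, h₂,
        s.snd.naturality]
  choose c h₁ h₂ using H
  refine ⟨⟨presheafFiber_condition⟩, ⟨PullbackCone.IsLimit.mk _ c h₁ h₂ fun s m hm₁ hm₂ => ?_⟩⟩
  refine NatTrans.ext (funext fun U => fiber_hom_ext ?_ ?_)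
  · exact congrArg (fun φ => NatTrans.app φ U) (hm₁.trans (h₁ s).symm)
  · exact congrArg (fun φ => NatTrans.app φ U) (hm₂.trans (h₂ s).symm)

/-- The fibre product of sheaves is a sheaf. -/
theorem hasGluing_presheafFiber (hA : HasGluing A) (hB : HasGluing B) (hC : HasGluing C) :
    HasGluing (presheafFiber f g) where
  sep {U n z w} hz hw h := by
    refine presheafFiber_ext hz hw (hA.sep (ap_mem _ hz) (ap_mem _ hw) fun x hx => ?_)
      (hB.sep (ap_mem _ hz) (ap_mem _ hw) fun x hx => ?_) <;>
    · obtain ⟨V, hV, hxV, e⟩ := h x hx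
      exact ⟨V, hV, hxV, by rw [← ap_res, ← ap_res, e]⟩
  glue {U n} V hV hx s hs hc := by
    obtain ⟨a, ha, hsa⟩ := hA.glue V hV hx (fun x => ap (presheafFst f g) _ (s x))
      (fun x => ap_mem _ (hs x)) (fun x y => by rw [← ap_res, ← ap_res, hc])
    obtain ⟨b, hb, hsb⟩ := hB.glue V hV hx (fun x => ap (presheafSnd f g) _ (s x))
      (fun x => ap_mem _ (hs x)) (fun x y => by rw [← ap_res, ← ap_res, hc])
    have hab : ap f U a = ap g U b := hC.sep (ap_mem f ha) (ap_mem g hb) fun x hxU =>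
      ⟨V ⟨x, hxU⟩, hV _, hx ⟨x, hxU⟩, by
        rw [← ap_res, ← ap_res, hsa, hsb, ap_presheafFiber_condition]⟩
    obtain ⟨z, hz, h₁, h₂⟩ := exists_presheafFiber ha hb hab
    refine ⟨z, hz, fun x => presheafFiber_ext (res_mem _ _ hz) (hs x) ?_ ?_⟩
    · rw [ap_res, h₁, hsa]
    · rw [ap_res, h₂, hsb]

/-- The surjectivity of a morphism on homogeneous sections over every open set. -/
def SectionwiseSurjective (f : A ⟶ B) : Prop :=
  ∀ (U : Opens X) (n : ℤ), ∀ b ∈ (sec B U).deg n, ∃ a ∈ (sec A U).deg n, ap f U a = b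

theorem sectionwiseSurjective_presheafFst (hg : SectionwiseSurjective g) :
    SectionwiseSurjective (presheafFst f g) := by
  intro U n a ha
  obtain ⟨b, hb, h⟩ := hg U n _ (ap_mem f ha)
  obtain ⟨z, hz, h₁, -⟩ := exists_presheafFiber ha hb h.symm
  exact ⟨z, hz, h₁⟩

/-- The base change of a surjective quasi-isomorphism is a quasi-isomorphism. -/
theorem presheafQuasiIso_presheafFst (hg : SectionwiseSurjective g) (hW : PresheafQuasiIso g) :
    PresheafQuasiIso (presheafFst f g) := by
  rw [presheafQuasiIso_iff] at hW ⊢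
  intro U l m n hlm hmn e he e' he' hde hfe x hx
  obtain ⟨y, hy, hgy⟩ := hg U m _ (ap_mem f he')
  -- `e.2 - dy` is a cocycle of the kernel of `g`, hence locally a boundary in the kernel
  have hdy : (sec B U).d y ∈ (sec B U).deg n := mem_deg_congr hmn ((sec B U).d_mem _ _ hy)
  obtain ⟨V, hV, hxV, b, hb, c, hc, hdb, hgb⟩ := hW hlm hmn
    (ap (presheafSnd f g) U e - (sec B U).d y) (sub_mem (ap_mem _ he) hdy) 0 (zero_mem _)
    (by rw [map_sub, ← ap_d, hde, map_zero, (sec B U).d_d, sub_zero])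
    (by rw [map_sub, ← ap_presheafFiber_condition, hfe, ap_d, ap_d, hgy, sub_self, map_zero]) x hx
  obtain ⟨y', hy', hgy'⟩ := hg V l c hc
  have hdy' : (sec B V).d y' ∈ (sec B V).deg m := mem_deg_congr hlm ((sec B V).d_mem _ _ hy')
  rw [map_zero, sub_zero] at hgb
  obtain ⟨z, hz, h₁, h₂⟩ := exists_presheafFiber (f := f) (g := g) (res_mem A hV he')
    (add_mem (res_mem B hV hy) (sub_mem hb hdy')) (by
      rw [ap_res, map_add, map_sub, ap_res, hgy, hgb, ap_d, hgy', sub_self, add_zero])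
  refine ⟨V, hV, hxV, z, hz, 0, zero_mem _, presheafFiber_ext
    (mem_deg_congr hmn ((sec (presheafFiber f g) V).d_mem _ _ hz)) (res_mem _ hV he) ?_ ?_, ?_⟩
  · rw [ap_d, h₁, ap_res, hfe, res_d]
  · rw [ap_d, h₂, ap_res, map_add, map_sub, hdb, (sec B V).d_d, map_sub, res_d]
    abel
  · rw [h₁, sub_self, map_zero]

end PresheafFiberProduct

end DGRing

/-! ### Quasi-homotopy in a category with trivial fibrations -/

namespace CategoryTheory.MorphismProperty

variable {C : Type*} [Category C]

/-- The properties of the weak equivalences `W` and the trivial fibrations `F` of a category that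
make left homotopy up to trivial fibrations a congruence. -/
structure IsTrivialFibrationStructure (W F : MorphismProperty C) : Prop where
  id_W : ∀ X, W (𝟙 X)
  comp_W : ∀ {X Y Z : C} {f : X ⟶ Y} {g : Y ⟶ Z}, W f → W g → W (f ≫ g)
  of_comp_left : ∀ {X Y Z : C} {f : X ⟶ Y} {g : Y ⟶ Z}, W f → W (f ≫ g) → W g
  of_comp_right : ∀ {X Y Z : C} {f : X ⟶ Y} {g : Y ⟶ Z}, W g → W (f ≫ g) → W f
  F_le_W : ∀ {X Y : C} {f : X ⟶ Y}, F f → W f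
  comp_F : ∀ {X Y Z : C} {f : X ⟶ Y} {g : Y ⟶ Z}, F f → F g → F (f ≫ g)
  F_of_section : ∀ {X Y : C} {p : X ⟶ Y} (s : Y ⟶ X), W p → s ≫ p = 𝟙 Y → F p
  exists_isPullback : ∀ {Y B D : C} {p : Y ⟶ B}, F p → ∀ g : D ⟶ B,
    ∃ (P : C) (r : P ⟶ D) (l : P ⟶ Y), IsPullback r l g p ∧ F r
  exists_factorization : ∀ {X Y : C} (f : X ⟶ Y),
    ∃ (Q : C) (i : X ⟶ Q) (p : Q ⟶ Y), W.hCofibrations i ∧ F p ∧ i ≫ p = f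

/-- Two morphisms `f₀` and `f₁` are left homotopic if they extend to a cylinder: an object `Z` with
two sections of a weak equivalence `ε : Z ⟶ B`. The cylinder is not required to receive a map from
a coproduct. -/
def LeftHomotopic (W : MorphismProperty C) {B D : C} (f₀ f₁ : B ⟶ D) : Prop :=
  ∃ (Z : C) (i₀ i₁ : B ⟶ Z) (ε : Z ⟶ B) (φ : Z ⟶ D),
    W ε ∧ i₀ ≫ ε = 𝟙 B ∧ i₁ ≫ ε = 𝟙 B ∧ i₀ ≫ φ = f₀ ∧ i₁ ≫ φ = f₁

/-- Two morphisms are quasi-homotopic with respect to `W'` if they become left homotopic after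
precomposition with some morphism in `W'`. -/
def QuasiHomotopic (W W' : MorphismProperty C) {B D : C} (f₀ f₁ : B ⟶ D) : Prop :=
  ∃ (P : C) (p : P ⟶ B), W' p ∧ W.LeftHomotopic (p ≫ f₀) (p ≫ f₁)

theorem LeftHomotopic.symm {W : MorphismProperty C} {B D : C} {f₀ f₁ : B ⟶ D}
    (h : W.LeftHomotopic f₀ f₁) : W.LeftHomotopic f₁ f₀ := by
  obtain ⟨Z, i₀, i₁, ε, φ, hε, h₀, h₁, h₂, h₃⟩ := h
  exact ⟨Z, i₁, i₀, ε, φ, hε, h₁, h₀, h₃, h₂⟩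

theorem LeftHomotopic.postcomp {W : MorphismProperty C} {B D D' : C} {f₀ f₁ : B ⟶ D}
    (h : W.LeftHomotopic f₀ f₁) (g : D ⟶ D') : W.LeftHomotopic (f₀ ≫ g) (f₁ ≫ g) := by
  obtain ⟨Z, i₀, i₁, ε, φ, hε, h₀, h₁, rfl, rfl⟩ := h
  exact ⟨Z, i₀, i₁, ε, φ ≫ g, hε, h₀, h₁, (Category.assoc _ _ _).symm, (Category.assoc _ _ _).symm⟩

theorem QuasiHomotopic.postcomp {W F : MorphismProperty C} {B D D' : C} {f₀ f₁ : B ⟶ D}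
    (h : W.QuasiHomotopic F f₀ f₁) (g : D ⟶ D') : W.QuasiHomotopic F (f₀ ≫ g) (f₁ ≫ g) := by
  obtain ⟨P, p, hp, h⟩ := h
  refine ⟨P, p, hp, ?_⟩
  rw [← Category.assoc, ← Category.assoc]
  exact h.postcomp g

namespace IsTrivialFibrationStructure

variable {W F : MorphismProperty C} (H : IsTrivialFibrationStructure W F)

include H

theorem id_F (X : C) : F (𝟙 X) := H.F_of_section (𝟙 X) (H.id_W X) (Category.id_comp _)

theorem W_of_section {X Y : C} {p : X ⟶ Y} {s : Y ⟶ X} (hp : W p) (h : s ≫ p = 𝟙 Y) : W s :=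
  H.of_comp_right hp (h ▸ H.id_W Y)

theorem leftHomotopic_refl {B D : C} (f : B ⟶ D) : W.LeftHomotopic f f :=
  ⟨B, 𝟙 B, 𝟙 B, 𝟙 B, f, H.id_W B, Category.comp_id _, Category.comp_id _, Category.id_comp _,
    Category.id_comp _⟩

/-- The weak equivalence of a cylinder has a section, so it is a trivial fibration, and the cylinder
can be pulled back. -/
theorem leftHomotopic_precomp {B D P : C} {f₀ f₁ : B ⟶ D} (h : W.LeftHomotopic f₀ f₁) (l : P ⟶ B) :
    W.LeftHomotopic (l ≫ f₀) (l ≫ f₁) := by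
  obtain ⟨Z, i₀, i₁, ε, φ, hε, h₀, h₁, rfl, rfl⟩ := h
  obtain ⟨Z', r, l', sq, hr⟩ := H.exists_isPullback (H.F_of_section i₀ hε h₀) l
  refine ⟨Z', sq.lift (𝟙 P) (l ≫ i₀) (by simp [h₀]), sq.lift (𝟙 P) (l ≫ i₁) (by simp [h₁]), r,
    l' ≫ φ, H.F_le_W hr, sq.lift_fst _ _ _, sq.lift_fst _ _ _, ?_, ?_⟩
  · rw [← Category.assoc, sq.lift_snd, Category.assoc]
  · rw [← Category.assoc, sq.lift_snd, Category.assoc]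

/-- A homotopy on `P` can be given by an object `E` that is weakly equivalent to the target of a
trivial fibration `P ⟶ B`: the base change of `E` to `P` is a cylinder. -/
theorem leftHomotopic_of_weak {P B E D : C} {p : P ⟶ B} (hp : F p) {j₀ j₁ : P ⟶ E} {ε : E ⟶ B}
    (hε : W ε) (h₀ : j₀ ≫ ε = p) (h₁ : j₁ ≫ ε = p) (φ : E ⟶ D) :
    W.LeftHomotopic (j₀ ≫ φ) (j₁ ≫ φ) := by
  obtain ⟨Z, r, l, sq, hr⟩ := H.exists_isPullback hp ε
  have hl : W l := H.of_comp_right (H.F_le_W hp) (sq.w ▸ H.comp_W (H.F_le_W hr) hε)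
  refine ⟨Z, sq.lift j₀ (𝟙 P) (by simp [h₀]), sq.lift j₁ (𝟙 P) (by simp [h₁]), l, r ≫ φ, hl,
    sq.lift_snd _ _ _, sq.lift_snd _ _ _, ?_, ?_⟩
  · rw [← Category.assoc, sq.lift_fst]
  · rw [← Category.assoc, sq.lift_fst]

/-- To compose two homotopies, the end `i₁` of the first cylinder is replaced by an h-cofibration
`P ⟶ Q`, and the second cylinder is attached to `Q` along it. The other end `i₀` lifts to `Q` only
after base change along the trivial fibration from `Q` to the first cylinder. -/
theorem exists_leftHomotopic_trans {P D : C} {f₀ f₁ f₂ : P ⟶ D} (h : W.LeftHomotopic f₀ f₁)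
    (h' : W.LeftHomotopic f₁ f₂) :
    ∃ (P' : C) (r : P' ⟶ P), F r ∧ W.LeftHomotopic (r ≫ f₀) (r ≫ f₂) := by
  obtain ⟨Z, i₀, i₁, ε, φ, hε, h₀, h₁, rfl, hφ⟩ := h
  obtain ⟨Z', i₀', i₁', ε', φ', hε', h₀', h₁', hφ', rfl⟩ := h'
  obtain ⟨Q, i, p, hi, hp, hip⟩ := H.exists_factorization i₁
  obtain ⟨E, k, j, sq, hk⟩ := hi i₀'
  have hk := hk (H.W_of_section hε' h₀')
  let εE : E ⟶ P := sq.desc (p ≫ ε) ε' (by rw [← Category.assoc, hip, h₁, h₀'])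
  have hkε : k ≫ εE = p ≫ ε := sq.inl_desc _ _ _
  have hjε : j ≫ εE = ε' := sq.inr_desc _ _ _
  have hεE : W εE := H.of_comp_left hk (hkε ▸ H.comp_W (H.F_le_W hp) hε)
  let φE : E ⟶ D := sq.desc (p ≫ φ) φ' (by rw [← Category.assoc, hip, hφ, hφ'])
  have hkφ : k ≫ φE = p ≫ φ := sq.inl_desc _ _ _
  have hjφ : j ≫ φE = φ' := sq.inr_desc _ _ _
  obtain ⟨P', r, l, sq', hr⟩ := H.exists_isPullback hp i₀
  refine ⟨P', r, hr, ?_⟩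
  have := H.leftHomotopic_of_weak hr (j₀ := l ≫ k) (j₁ := r ≫ i₁' ≫ j) hεE
    (by rw [Category.assoc, hkε, ← Category.assoc, ← sq'.w, Category.assoc, h₀, Category.comp_id])
    (by rw [Category.assoc, Category.assoc, hjε, h₁', Category.comp_id]) φE
  rwa [Category.assoc, hkφ, ← Category.assoc, ← sq'.w, Category.assoc, Category.assoc,
    Category.assoc, hjφ] at this

/-- A weak equivalence before a homotopy can be replaced by a trivial fibration: factor it as an
h-cofibration `B' ⟶ Q` and a trivial fibration `Q ⟶ B`, and glue a copy of `Q` to each end of the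
cylinder on `B'`. -/
theorem quasiHomotopic_of_W {B D : C} {f₀ f₁ : B ⟶ D} (h : W.QuasiHomotopic W f₀ f₁) :
    W.QuasiHomotopic F f₀ f₁ := by
  obtain ⟨B', ψ, hψ, Z, i₀, i₁, ε, φ, hε, h₀, h₁, hφ₀, hφ₁⟩ := h
  obtain ⟨Q, i, p, hi, hp, hip⟩ := H.exists_factorization ψ
  have hiW : W i := H.of_comp_right (H.F_le_W hp) (hip ▸ hψ)
  have hi₀ : W i₀ := H.W_of_section hε h₀
  have hi₁ : W i₁ := H.W_of_section hε h₁
  obtain ⟨E₁, k₁, j₁, sq₁, hk₁⟩ := hi i₀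
  have hj₁ : W j₁ := H.of_comp_left hi₀ (sq₁.w ▸ H.comp_W hiW (hk₁ hi₀))
  obtain ⟨E₂, k₂, j₂, sq₂, hk₂⟩ := hi (i₁ ≫ j₁)
  have hk₂ := hk₂ (H.comp_W hi₁ hj₁)
  let ε₁ : E₁ ⟶ B := sq₁.desc p (ε ≫ ψ) (by rw [hip, ← Category.assoc, h₀, Category.id_comp])
  have hkε₁ : k₁ ≫ ε₁ = p := sq₁.inl_desc _ _ _
  have hjε₁ : j₁ ≫ ε₁ = ε ≫ ψ := sq₁.inr_desc _ _ _
  let ε₂ : E₂ ⟶ B := sq₂.desc p ε₁ (by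
    rw [hip, Category.assoc, hjε₁, ← Category.assoc, h₁, Category.id_comp])
  have hkε₂ : k₂ ≫ ε₂ = p := sq₂.inl_desc _ _ _
  have hjε₂ : j₂ ≫ ε₂ = ε₁ := sq₂.inr_desc _ _ _
  let φ₁ : E₁ ⟶ D := sq₁.desc (p ≫ f₀) φ (by rw [← Category.assoc, hip, hφ₀])
  have hkφ₁ : k₁ ≫ φ₁ = p ≫ f₀ := sq₁.inl_desc _ _ _
  have hjφ₁ : j₁ ≫ φ₁ = φ := sq₁.inr_desc _ _ _
  let φ₂ : E₂ ⟶ D := sq₂.desc (p ≫ f₁) φ₁ (by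
    rw [← Category.assoc, hip, Category.assoc, hjφ₁, hφ₁])
  have hkφ₂ : k₂ ≫ φ₂ = p ≫ f₁ := sq₂.inl_desc _ _ _
  have hjφ₂ : j₂ ≫ φ₂ = φ₁ := sq₂.inr_desc _ _ _
  have hε₂ : W ε₂ := H.of_comp_left hk₂ (hkε₂ ▸ H.F_le_W hp)
  have := H.leftHomotopic_of_weak hp (j₀ := k₁ ≫ j₂) (j₁ := k₂) hε₂
    (by rw [Category.assoc, hjε₂, hkε₁]) hkε₂ φ₂
  rw [Category.assoc, hjφ₂, hkφ₁, hkφ₂] at this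
  exact ⟨Q, p, hp, this⟩

theorem quasiHomotopic_equivalence (B D : C) :
    _root_.Equivalence (W.QuasiHomotopic F : (B ⟶ D) → (B ⟶ D) → Prop) where
  refl f := ⟨B, 𝟙 B, H.id_F B, H.leftHomotopic_refl _⟩
  symm := fun ⟨P, p, hp, h⟩ => ⟨P, p, hp, h.symm⟩
  trans := by
    rintro f₀ f₁ f₂ ⟨P, p, hp, h⟩ ⟨P', p', hp', h'⟩
    obtain ⟨R, r, l, sq, hr⟩ := H.exists_isPullback hp' p
    have e := H.leftHomotopic_precomp h r
    have e' := H.leftHomotopic_precomp h' l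
    rw [← Category.assoc, ← Category.assoc] at e e'
    rw [← sq.w] at e'
    obtain ⟨S, s, hs, e''⟩ := H.exists_leftHomotopic_trans e e'
    refine ⟨S, s ≫ r ≫ p, H.comp_F hs (H.comp_F hr hp), ?_⟩
    simpa only [Category.assoc] using e''

theorem quasiHomotopic_precomp {A B D : C} (g : A ⟶ B) {f₀ f₁ : B ⟶ D}
    (h : W.QuasiHomotopic F f₀ f₁) : W.QuasiHomotopic F (g ≫ f₀) (g ≫ f₁) := by
  obtain ⟨P, p, hp, h⟩ := h
  obtain ⟨R, r, l, sq, hr⟩ := H.exists_isPullback hp g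
  have := H.leftHomotopic_precomp h l
  rw [← Category.assoc, ← Category.assoc, ← sq.w, Category.assoc, Category.assoc] at this
  exact ⟨R, r, hr, this⟩

end IsTrivialFibrationStructure

end CategoryTheory.MorphismProperty

section Under

variable {C : Type*} [Category C] {W F : MorphismProperty C} (A : C)

/-- The morphisms under `A` whose underlying morphism has a given property. -/
def underProperty (W : MorphismProperty C) : MorphismProperty (Under A) := fun _ _ f => W f.right

theorem hCofibrations_under {X Q : Under A} {i : X ⟶ Q} (hi : W.hCofibrations i.right) :
    (underProperty A W).hCofibrations i := by
  intro E g
  obtain ⟨Z, k, j, sq, hW⟩ := hi g.right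
  have hk : Q.hom ≫ k = E.hom ≫ j := by
    rw [← Under.w i, Category.assoc, sq.w, ← Category.assoc, Under.w g]
  refine ⟨Under.mk (E.hom ≫ j), Under.homMk k hk, Under.homMk j, isPushout_of_exists ?_ ?_ ?_, hW⟩
  · ext
    exact sq.w
  · intro T a b h
    have h' : i.right ≫ a.right = g.right ≫ b.right := congrArg CommaMorphism.right h
    refine ⟨Under.homMk (sq.desc a.right b.right h') ?_, ?_, ?_⟩
    · change (E.hom ≫ j) ≫ _ = _
      rw [Category.assoc, sq.inr_desc, Under.w]
    · ext
      exact sq.inl_desc _ _ _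
    · ext
      exact sq.inr_desc _ _ _
  · intro T c c' h h'
    ext
    exact sq.hom_ext (congrArg CommaMorphism.right h) (congrArg CommaMorphism.right h')

/-- The structure passes to the category of objects under `A`. -/
theorem isTrivialFibrationStructure_under (H : W.IsTrivialFibrationStructure F) :
    (underProperty A W).IsTrivialFibrationStructure (underProperty A F) where
  id_W X := H.id_W X.right
  comp_W := H.comp_W
  of_comp_left := H.of_comp_left
  of_comp_right := H.of_comp_right
  F_le_W := H.F_le_W
  comp_F := H.comp_F
  F_of_section s hp h := H.F_of_section s.right hp (congrArg CommaMorphism.right h)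
  exists_isPullback {Y B D p} hp g := by
    obtain ⟨P, r, l, sq, hr⟩ := H.exists_isPullback hp g.right
    have hA : D.hom ≫ g.right = Y.hom ≫ p.right := by rw [Under.w, Under.w]
    refine ⟨Under.mk (sq.lift D.hom Y.hom hA), Under.homMk r (sq.lift_fst _ _ _),
      Under.homMk l (sq.lift_snd _ _ _), ⟨⟨?_⟩, ⟨PullbackCone.IsLimit.mk _
        (fun s => Under.homMk (sq.lift s.fst.right s.snd.right
          (congrArg CommaMorphism.right s.condition)) ?_) ?_ ?_ ?_⟩⟩, hr⟩
    · ext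
      exact sq.w
    · refine sq.hom_ext ?_ ?_
      · rw [Category.assoc, sq.lift_fst, Under.w]
        exact (sq.lift_fst _ _ _).symm
      · rw [Category.assoc, sq.lift_snd, Under.w]
        exact (sq.lift_snd _ _ _).symm
    · intro s
      ext
      exact sq.lift_fst _ _ _
    · intro s
      ext
      exact sq.lift_snd _ _ _
    · intro s m h₁ h₂
      ext
      refine sq.hom_ext ?_ ?_
      · exact (congrArg CommaMorphism.right h₁).trans (sq.lift_fst _ _ _).symm
      · exact (congrArg CommaMorphism.right h₂).trans (sq.lift_snd _ _ _).symm
  exists_factorization {X Y} f := by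
    obtain ⟨Q, i, p, hi, hp, hip⟩ := H.exists_factorization f.right
    refine ⟨Under.mk (X.hom ≫ i), Under.homMk i, Under.homMk p ?_, hCofibrations_under A hi, hp, ?_⟩
    · change (X.hom ≫ i) ≫ p = Y.hom
      rw [Category.assoc, hip, Under.w]
    · ext
      exact hip

/-- Every object under `A` is the target of a trivial fibration from an object that has a coproduct
with itself: the coproduct under `A` is the pushout along an h-cofibration. -/
theorem exists_coproduct_under (H : W.IsTrivialFibrationStructure F)
    (B : Under A) : ∃ (P : Under A) (p : P ⟶ B), underProperty A F p ∧
      ∃ (T : Under A) (ι₀ ι₁ : P ⟶ T), Nonempty (IsColimit (BinaryCofan.mk ι₀ ι₁)) := by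
  obtain ⟨Q, i, p, hi, hp, hip⟩ := H.exists_factorization B.hom
  obtain ⟨Z, k, j, sq, -⟩ := hi i
  refine ⟨Under.mk i, Under.homMk p hip, hp, Under.mk (i ≫ k), Under.homMk k,
    Under.homMk j sq.w.symm, ⟨BinaryCofan.IsColimit.mk _ (fun {T} a b => Under.homMk (sq.desc a.right b.right
      ((Under.w a).trans (Under.w b).symm)) ?_) ?_ ?_ ?_⟩⟩
  · change (i ≫ k) ≫ _ = _
    rw [Category.assoc, sq.inl_desc]
    exact Under.w a
  · intro T a b
    ext
    exact sq.inl_desc _ _ _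
  · intro T a b
    ext
    exact sq.inr_desc _ _ _
  · intro T a b m h₁ h₂
    ext
    refine sq.hom_ext ?_ ?_
    · exact (congrArg CommaMorphism.right h₁).trans (sq.inl_desc _ _ _).symm
    · exact (congrArg CommaMorphism.right h₂).trans (sq.inr_desc _ _ _).symm

end Under

/-! ### Sheaves of commutative DG rings and relative quasi-homotopy -/

namespace DGSheaf

variable {K : Type u} [CommRing K] {X : TopCat.{u}}

open DGRing

/-- The quasi-isomorphisms between sheaves of commutative DG rings. -/
def sheafW (K : Type u) [CommRing K] (X : TopCat.{u}) : MorphismProperty (DGSheaf K X) :=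
  fun _ _ f => DGSheaf.IsQuasiIso f

/-- The quasi-isomorphisms that are surjective on homogeneous sections over every open set. -/
def sheafF (K : Type u) [CommRing K] (X : TopCat.{u}) : MorphismProperty (DGSheaf K X) :=
  fun _ _ f => SectionwiseSurjective f.hom ∧ DGSheaf.IsQuasiIso f

theorem hasGluing (B : DGSheaf K X) : HasGluing B.obj := (isSheaf_iff_hasGluing _).mp B.property

/-- The sheaf associated to a presheaf of commutative DG rings. -/
noncomputable def ofPresheaf (Q : TopCat.Presheaf (DGRing.{u} K) X) : DGSheaf K X :=
  ⟨sheafify Q, (isSheaf_iff_hasGluing _).mpr (hasGluing_sheafify Q)⟩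

/-- The canonical morphism to the associated sheaf. -/
noncomputable def toOfPresheaf (Q : TopCat.Presheaf (DGRing.{u} K) X) : Q ⟶ (ofPresheaf Q).obj :=
  toSheafify Q

theorem presheafQuasiIso_toOfPresheaf (Q : TopCat.Presheaf (DGRing.{u} K) X) :
    PresheafQuasiIso (toOfPresheaf Q) := presheafQuasiIso_toSheafify Q

/-- The morphism from the associated sheaf induced by a morphism to a sheaf. -/
noncomputable def ofPresheafDesc {Q : TopCat.Presheaf (DGRing.{u} K) X} {S : DGSheaf K X}
    (f : Q ⟶ S.obj) : ofPresheaf Q ⟶ S :=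
  ObjectProperty.homMk (sheafifyDesc S.hasGluing f)

theorem toOfPresheaf_desc {Q : TopCat.Presheaf (DGRing.{u} K) X} {S : DGSheaf K X}
    (f : Q ⟶ S.obj) : toOfPresheaf Q ≫ (ofPresheafDesc f).hom = f :=
  toSheafify_desc S.hasGluing f

theorem ofPresheaf_hom_ext {Q : TopCat.Presheaf (DGRing.{u} K) X} {S : DGSheaf K X}
    {f g : ofPresheaf Q ⟶ S} (h : toOfPresheaf Q ≫ f.hom = toOfPresheaf Q ≫ g.hom) : f = g :=
  ObjectProperty.hom_ext _ (sheafify_hom_ext S.hasGluing h)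

/-- The associated sheaf functor turns a pushout of presheaves into a pushout of sheaves, and does
not change whether a morphism is a quasi-isomorphism. -/
theorem hCofibrations_toOfPresheaf {S : DGSheaf K X} {Q : TopCat.Presheaf (DGRing.{u} K) X}
    {i : S.obj ⟶ Q} (hi : (presheafW K X).hCofibrations i) :
    (sheafW K X).hCofibrations (ObjectProperty.homMk (i ≫ toOfPresheaf Q) : S ⟶ ofPresheaf Q) := by
  intro E g
  obtain ⟨Z, k, j, sq, hW⟩ := hi g.hom
  let k' : ofPresheaf Q ⟶ ofPresheaf Z :=
    ofPresheafDesc (k ≫ toOfPresheaf Z)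
  have hk' : toOfPresheaf Q ≫ k'.hom = k ≫ toOfPresheaf Z := toOfPresheaf_desc _
  let j' : E ⟶ ofPresheaf Z := ObjectProperty.homMk (j ≫ toOfPresheaf Z)
  refine ⟨ofPresheaf Z, k', j', isPushout_of_exists ?_ ?_ ?_, fun hg => ?_⟩
  · refine ObjectProperty.hom_ext _ ?_
    change (i ≫ toOfPresheaf Q) ≫ k'.hom = g.hom ≫ j ≫ toOfPresheaf Z
    rw [Category.assoc, hk', ← Category.assoc, sq.w, Category.assoc]
  · intro T a b h
    have h' : i ≫ toOfPresheaf Q ≫ a.hom = g.hom ≫ b.hom :=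
      (Category.assoc _ _ _).symm.trans (congrArg (fun f => f.hom) h)
    let c : ofPresheaf Z ⟶ T := ofPresheafDesc (sq.desc (toOfPresheaf Q ≫ a.hom) b.hom h')
    have hc : toOfPresheaf Z ≫ c.hom = sq.desc (toOfPresheaf Q ≫ a.hom) b.hom h' :=
      toOfPresheaf_desc _
    refine ⟨c, ofPresheaf_hom_ext ?_, ObjectProperty.hom_ext _ ?_⟩
    · change toOfPresheaf Q ≫ k'.hom ≫ c.hom = _
      rw [← Category.assoc, hk', Category.assoc, hc, sq.inl_desc]
    · change (j ≫ toOfPresheaf Z) ≫ c.hom = _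
      rw [Category.assoc, hc, sq.inr_desc]
  · intro T c c' h h'
    have e : k'.hom ≫ c.hom = k'.hom ≫ c'.hom := congrArg (fun f => f.hom) h
    have e' : (j ≫ toOfPresheaf Z) ≫ c.hom = (j ≫ toOfPresheaf Z) ≫ c'.hom :=
      congrArg (fun f => f.hom) h'
    refine ofPresheaf_hom_ext (sq.hom_ext ?_ ?_)
    · rw [← Category.assoc, ← Category.assoc, ← hk', Category.assoc, Category.assoc, e]
    · rw [← Category.assoc, ← Category.assoc, e']
  · exact (presheafQuasiIso_toOfPresheaf Q).of_comp_left
      (hk' ▸ (hW hg).comp (presheafQuasiIso_toOfPresheaf Z))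

/-- The quasi-isomorphisms and the surjective quasi-isomorphisms of sheaves of commutative DG rings
satisfy the axioms. -/
theorem isTrivialFibrationStructure (K : Type u) [CommRing K] (X : TopCat.{u}) :
    (sheafW K X).IsTrivialFibrationStructure (sheafF K X) where
  id_W B := presheafQuasiIso_of_isIso (𝟙 B.obj)
  comp_W := PresheafQuasiIso.comp
  of_comp_left := PresheafQuasiIso.of_comp_left
  of_comp_right := PresheafQuasiIso.of_comp_right
  F_le_W h := h.2
  comp_F {_ _ _ f g} hf hg := by
    refine ⟨fun U n c hc => ?_, PresheafQuasiIso.comp hf.2 hg.2⟩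
    obtain ⟨b, hb, rfl⟩ := hg.1 U n c hc
    obtain ⟨a, ha, rfl⟩ := hf.1 U n b hb
    exact ⟨a, ha, ap_comp f.hom g.hom a⟩
  F_of_section {_ _ p} s hp h := by
    refine ⟨fun U n y hy => ⟨ap s.hom U y, ap_mem s.hom hy, ?_⟩, hp⟩
    rw [← ap_comp]
    exact congrArg (fun f => ap f.hom U y) h
  exists_isPullback {Y B D p} hp g := by
    have sq : IsPullback (presheafFst g.hom p.hom) (presheafSnd g.hom p.hom) g.hom p.hom :=
      isPullback_presheafFiber
    let P : DGSheaf K X := ⟨presheafFiber g.hom p.hom, (isSheaf_iff_hasGluing _).mpr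
      (hasGluing_presheafFiber D.hasGluing Y.hasGluing B.hasGluing)⟩
    refine ⟨P, ObjectProperty.homMk (presheafFst g.hom p.hom),
      ObjectProperty.homMk (presheafSnd g.hom p.hom),
      IsPullback.of_map (DGRing.isSheaf K X).ι (ObjectProperty.hom_ext _ sq.w) sq,
      sectionwiseSurjective_presheafFst hp.1, presheafQuasiIso_presheafFst hp.1 hp.2⟩
  exists_factorization {B C} f := by
    obtain ⟨Q, i, q, hi, hiq, hq⟩ := DGRing.exists_factorization f.hom
    have hq' : toOfPresheaf Q ≫ (ofPresheafDesc q).hom = q := toOfPresheaf_desc q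
    refine ⟨ofPresheaf Q, _, ofPresheafDesc q, hCofibrations_toOfPresheaf hi, ⟨?_, ?_⟩, ?_⟩
    · intro U n y hy
      obtain ⟨x, hx, rfl⟩ := hq.surjective hy
      refine ⟨ap (toOfPresheaf Q) U x, ap_mem _ hx, ?_⟩
      rw [← ap_comp, hq']
    · exact (presheafQuasiIso_toOfPresheaf Q).of_comp_left
        ((congrArg PresheafQuasiIso hq').mpr hq.presheafQuasiIso)
    · refine ObjectProperty.hom_ext _ ?_
      change (i ≫ toOfPresheaf Q) ≫ (ofPresheafDesc q).hom = _
      rw [Category.assoc, hq', hiq]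

variable {A : DGSheaf K X}

/-- A relative homotopy is a left homotopy whose source has a tensor product with itself. Since every
object has a surjective quasi-isomorphism from one that does, relative quasi-homotopy is
quasi-homotopy with respect to the surjective quasi-isomorphisms. -/
theorem relQuasiHomotopy_iff {B C : DGRingOver A} (φ₀ φ₁ : B ⟶ C) :
    relQuasiHomotopy A φ₀ φ₁ ↔
      (underProperty A (sheafW K X)).QuasiHomotopic (underProperty A (sheafF K X)) φ₀ φ₁ := by
  have H := isTrivialFibrationStructure_under A (isTrivialFibrationStructure K X)
  constructor
  · rintro ⟨B', ψ, hψ, ⟨h⟩⟩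
    refine H.quasiHomotopic_of_W ⟨B', ψ, hψ, h.Bplus, h.ι₀ ≫ h.η, h.ι₁ ≫ h.η, h.ε, h.φ,
      h.quasiIso, ?_, ?_, ?_, ?_⟩
    · rw [Category.assoc, h.η_ε]
      exact h.isColimit.fac _ ⟨WalkingPair.left⟩
    · rw [Category.assoc, h.η_ε]
      exact h.isColimit.fac _ ⟨WalkingPair.right⟩
    · rw [Category.assoc, h.η_φ]
      exact h.isColimit.fac _ ⟨WalkingPair.left⟩
    · rw [Category.assoc, h.η_φ]
      exact h.isColimit.fac _ ⟨WalkingPair.right⟩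
  · rintro ⟨P, p, hp, h⟩
    obtain ⟨P', r, hr, T, ι₀, ι₁, ⟨hT⟩⟩ :=
      exists_coproduct_under A (isTrivialFibrationStructure K X) P
    obtain ⟨Z, i₀, i₁, ε, φ, hε, h₀, h₁, hφ₀, hφ₁⟩ := H.leftHomotopic_precomp h r
    have hl : ∀ {S : DGRingOver A} (a b : P' ⟶ S), ι₀ ≫ hT.desc (BinaryCofan.mk a b) = a :=
      fun a b => hT.fac (BinaryCofan.mk a b) ⟨WalkingPair.left⟩
    have hr' : ∀ {S : DGRingOver A} (a b : P' ⟶ S), ι₁ ≫ hT.desc (BinaryCofan.mk a b) = b :=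
      fun a b => hT.fac (BinaryCofan.mk a b) ⟨WalkingPair.right⟩
    refine ⟨P', r ≫ p, H.comp_W (H.F_le_W hr) (H.F_le_W hp), ⟨
      { tensor := T
        ι₀ := ι₀
        ι₁ := ι₁
        isColimit := hT
        Bplus := Z
        η := hT.desc (BinaryCofan.mk i₀ i₁)
        ε := ε
        φ := φ
        quasiIso := hε
        η_ε := ?_
        η_φ := ?_ }⟩⟩
    · refine BinaryCofan.IsColimit.hom_ext hT ?_ ?_
      · exact (Category.assoc _ _ _).symm.trans ((congrArg (· ≫ ε) (hl _ _)).trans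
          (h₀.trans (hl _ _).symm))
      · exact (Category.assoc _ _ _).symm.trans ((congrArg (· ≫ ε) (hr' _ _)).trans
          (h₁.trans (hr' _ _).symm))
    · refine BinaryCofan.IsColimit.hom_ext hT ?_ ?_
      · exact (Category.assoc _ _ _).symm.trans ((congrArg (· ≫ φ) (hl _ _)).trans
          (hφ₀.trans ((Category.assoc _ _ _).symm.trans (hl _ _).symm)))
      · exact (Category.assoc _ _ _).symm.trans ((congrArg (· ≫ φ) (hr' _ _)).trans
          (hφ₁.trans ((Category.assoc _ _ _).symm.trans (hr' _ _).symm)))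

theorem congruence_relQuasiHomotopy (A : DGSheaf K X) : Congruence (relQuasiHomotopy A) := by
  have H := isTrivialFibrationStructure_under A (isTrivialFibrationStructure K X)
  refine { comp_left := ?_, comp_right := ?_, equivalence := ?_ }
  · intro _ _ _ f g g' h
    rw [relQuasiHomotopy_iff] at h ⊢
    exact H.quasiHomotopic_precomp f h
  · intro _ _ _ f f' g h
    rw [relQuasiHomotopy_iff] at h ⊢
    exact h.postcomp g
  · intro B C
    have e := H.quasiHomotopic_equivalence B C
    exact
      { refl := fun f => (relQuasiHomotopy_iff f f).mpr (e.refl f)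
        symm := fun h => (relQuasiHomotopy_iff _ _).mpr (e.symm ((relQuasiHomotopy_iff _ _).mp h))
        trans := fun h h' => (relQuasiHomotopy_iff _ _).mpr
          (e.trans ((relQuasiHomotopy_iff _ _).mp h) ((relQuasiHomotopy_iff _ _).mp h')) }

end DGSheaf

/-- Relative quasi-homotopy is a congruence on the category of commutative DG `A`-rings, so that the
homotopy category has the same objects, and its morphisms are exactly the classes of morphisms
modulo relative quasi-homotopy. -/
theorem mainTheorem3 (K : Type u) [CommRing K] (X : TopCat.{u}) (A : DGSheaf K X) :
    Congruence (relQuasiHomotopy A) ∧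
      Function.Bijective (toDGHomotopyCategory A).obj ∧
      (toDGHomotopyCategory A).Full ∧
      ∀ (B C : DGRingOver A) (φ₀ φ₁ : B ⟶ C),
        (toDGHomotopyCategory A).map φ₀ = (toDGHomotopyCategory A).map φ₁ ↔
          relQuasiHomotopy A φ₀ φ₁ := by
  have h := DGSheaf.congruence_relQuasiHomotopy A
  exact ⟨h, ⟨fun _ _ e => congrArg CategoryTheory.Quotient.as e, fun B => ⟨B.as, rfl⟩⟩, inferInstance,
    fun _ _ φ₀ φ₁ => CategoryTheory.Quotient.functor_map_eq_iff _ φ₀ φ₁⟩
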